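/- Let $\{\eta_k\}_{k=0}^\infty$ be a sequence of independent identically distributed real-valued random variables on a probability space, with $\mathbf P\{\eta_0=0\}<1$. For $n\ge 0$ put $g_n(x)=\sum_{k=0}^n\eta_kx^k$, and let $M_n$ denote the number of real roots of $g_n$, counted with multiplicity, where $M_n:=0$ on the event that $g_n$ is the zero polynomial. Then $$\mathbf P\left\{\frac{M_n}{n}\underset{n\to\infty}{\longrightarrow}0\right\}=1,$$ and each $M_n$ is an integrable random variable, with $$\mathbf E M_n=o(n),\quad n\to\infty.$$ -/

import Mathlib

open Polynomial MeasureTheory ProbabilityTheory Filter Topology Asymptotics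

namespace RandomPolynomial

/-- The polynomial `a 0 + a 1 * x + ... + a n * x ^ n` with real coefficients. -/
noncomputable def partialPoly (a : ℕ → ℝ) (n : ℕ) : ℝ[X] :=
  ∑ k ∈ Finset.range (n + 1), C (a k) * X ^ k

/-- The number of real roots of `a 0 + a 1 * x + ... + a n * x ^ n`, counted with multiplicity.
If the polynomial vanishes identically, the multiset `roots` is empty and the number is `0`. -/
noncomputable def realRootCount (a : ℕ → ℝ) (n : ℕ) : ℕ :=
  (partialPoly a n).roots.card

end RandomPolynomial

/-! The proof compares two growth functions of the polynomial `G` on the circle of radius `exp t`: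
the average of `log ‖G‖` (`radialMean`, explicit in the roots by Jensen's formula) and the logarithm
of the largest term (`logMaxTerm`, convex and piecewise linear, with slope the index `V t` of that
term). The average never exceeds the maximal term by more than `log (n + 1)`. Conversely, where one
index stays maximal on an annulus of logarithmic width `h`, a Harnack-type argument with chains of
discs (`IsDominant.exists_le_radialMean`) shows that the average falls short by at most an
exponential in `1 / h` at some radius of the annulus. Few distinct maximal indices therefore mean
that the two functions are close.

Closeness controls the positive roots. Jensen's bound in a small disc, centred near the positive
axis at a point where `‖G‖` is not too small, counts the roots in a short logarithmic window by a
small multiple of the increment of `V` plus an error (`countP_near_le`). The increments telescope to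
a multiple of `n`. The errors occur only in windows that contain a root, and a circle carrying a
root must lie near a change of the maximal index, so there are few such windows. Roots where `V` is
within `D` of `0` or `n` are bounded directly.

Probability enters only through the set of possible maximal indices. For `t ≤ 0` the first maximal
term has a coefficient of record absolute value, and for `t ≥ 0` the last one is a record read from
the other end (`exists_isDominant_mem_recordIndices`). For exchangeable coefficients a strict record
at `k` has probability at most `1 / (k + 1)`. A Chernoff bound and Borel–Cantelli give `O(log n)`
records in all, and at most an arbitrarily small multiple of `log n` at distance more than `n ^ (1 -
c)` from both ends. Exponentials of the latter number are then small powers of `n`, without any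
moment assumption. Negative roots follow from `G(-x)`, and the expectation from `M_n ≤ n` by
dominated convergence. -/

namespace RandomPolynomial

/-! ### The logarithmic potential of a polynomial -/

/-- The average of `log ‖G‖` over the circle with center `c` and radius `r`, in terms of the
roots of `G`. -/
noncomputable def logPotential (G : ℂ[X]) (c : ℂ) (r : ℝ) : ℝ :=
  Real.log ‖G.leadingCoeff‖ + (G.roots.map fun ζ => Real.log (max r ‖c - ζ‖)).sum

theorem circleIntegrable_log_norm_eval (G : ℂ[X]) (c : ℂ) (r : ℝ) :
    CircleIntegrable (fun z => Real.log ‖G.eval z‖) c r :=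
  MeromorphicOn.circleIntegrable_log_norm
    (analyticOnNhd_id.aeval_polynomial G).meromorphicOn

theorem eval_ne_zero_mem_codiscreteWithin {G : ℂ[X]} (hG : G ≠ 0) (s : Set ℂ) :
    ∀ᶠ z in codiscreteWithin s, G.eval z ≠ 0 := by
  have h : (G.roots.toFinset : Set ℂ)ᶜ ∈ codiscreteWithin s :=
    compl_finite_mem_codiscreteWithin (Finset.finite_toSet _)
  filter_upwards [h] with z hz
  simpa [hG] using hz

theorem circleAverage_log_norm_sub_eq {c ζ : ℂ} {r : ℝ} (hr : 0 < r) :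
    Real.circleAverage (fun z => Real.log ‖z - ζ‖) c r = Real.log (max r ‖c - ζ‖) := by
  have h := circleAverage_log_norm_sub_const_eq_log_radius_add_posLog (a := ζ) (c := c) hr.ne'
  rw [h, Real.posLog_eq_log_max_one (by positivity), ← Real.log_mul hr.ne' (by positivity)]
  congr 1
  rw [mul_max_of_nonneg _ _ hr.le]
  field_simp

theorem circleAverage_log_norm_mul {F G : ℂ[X]} (hF : F ≠ 0) (hG : G ≠ 0) {c : ℂ} {r : ℝ}
    (hr : 0 < r) :
    Real.circleAverage (fun z => Real.log ‖(F * G).eval z‖) c r =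
      Real.circleAverage (fun z => Real.log ‖F.eval z‖) c r +
      Real.circleAverage (fun z => Real.log ‖G.eval z‖) c r := by
  rw [← Real.circleAverage_fun_add (circleIntegrable_log_norm_eval F c r)
    (circleIntegrable_log_norm_eval G c r)]
  refine Real.circleAverage_congr_codiscreteWithin ?_ hr.ne'
  filter_upwards [eval_ne_zero_mem_codiscreteWithin hF _,
    eval_ne_zero_mem_codiscreteWithin hG _] with z h1 h2
  rw [eval_mul, norm_mul, Real.log_mul (norm_ne_zero_iff.2 h1) (norm_ne_zero_iff.2 h2)]

theorem circleAverage_log_norm_prod_X_sub_C (s : Multiset ℂ) {c : ℂ} {r : ℝ} (hr : 0 < r) :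
    Real.circleAverage (fun z => Real.log ‖((s.map fun ζ => X - C ζ).prod).eval z‖) c r =
      (s.map fun ζ => Real.log (max r ‖c - ζ‖)).sum := by
  induction s using Multiset.induction_on with
  | empty => simp [Real.circleAverage_const]
  | cons a s ih =>
    rw [Multiset.map_cons, Multiset.prod_cons, circleAverage_log_norm_mul (X_sub_C_ne_zero a)
      (Multiset.prod_ne_zero (by simp [X_sub_C_ne_zero])) hr, ih]
    simp [circleAverage_log_norm_sub_eq hr]

/-- Over `ℂ` the polynomial splits, and each linear factor has circle average `log (max r ‖c - ζ‖)`.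
This is Jensen's formula, and it justifies the definition of `logPotential`. -/
theorem circleAverage_log_norm_eval {G : ℂ[X]} (hG : G ≠ 0) (c : ℂ) {r : ℝ} (hr : 0 < r) :
    Real.circleAverage (fun z => Real.log ‖G.eval z‖) c r = logPotential G c r := by
  have hl : G.leadingCoeff ≠ 0 := leadingCoeff_ne_zero.2 hG
  conv_lhs => rw [(IsAlgClosed.splits G).eq_prod_roots]
  rw [circleAverage_log_norm_mul (C_ne_zero.2 hl)
    (Multiset.prod_ne_zero (by simp [X_sub_C_ne_zero])) hr,
    circleAverage_log_norm_prod_X_sub_C _ hr]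
  simp [logPotential, Real.circleAverage_const]

theorem logPotential_mono (G : ℂ[X]) (c : ℂ) {r r' : ℝ} (hr : 0 < r) (h : r ≤ r') :
    logPotential G c r ≤ logPotential G c r' := by
  refine add_le_add le_rfl (Multiset.sum_map_le_sum_map _ _ fun ζ _ => ?_)
  exact Real.log_le_log (lt_max_of_lt_left hr) (max_le_max h le_rfl)

theorem log_norm_eval_le_logPotential {G : ℂ[X]} {c : ℂ} (hc : G.eval c ≠ 0) (r : ℝ) : Real.log ‖G.eval c‖ ≤ logPotential G c r := by
  have hG : G ≠ 0 := by rintro rfl; simp at hc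
  have hl : G.leadingCoeff ≠ 0 := leadingCoeff_ne_zero.2 hG
  have key : ∀ s : Multiset ℂ, ((s.map fun ζ => X - C ζ).prod).eval c ≠ 0 →
      Real.log ‖((s.map fun ζ => X - C ζ).prod).eval c‖ ≤
        (s.map fun ζ => Real.log (max r ‖c - ζ‖)).sum := by
    intro s
    induction s using Multiset.induction_on with
    | empty => simp
    | cons a s ih =>
      intro h
      rw [Multiset.map_cons, Multiset.prod_cons, eval_mul] at h ⊢
      have h1 := left_ne_zero_of_mul h
      rw [norm_mul, Real.log_mul (norm_ne_zero_iff.2 h1)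
        (norm_ne_zero_iff.2 (right_ne_zero_of_mul h)), Multiset.map_cons, Multiset.sum_cons]
      refine add_le_add ?_ (ih (right_ne_zero_of_mul h))
      simp only [eval_sub, eval_X, eval_C] at h1 ⊢
      exact Real.log_le_log (norm_pos_iff.2 h1) (le_max_right _ _)
  have hfac := (IsAlgClosed.splits G).eq_prod_roots
  have he : G.eval c = G.leadingCoeff * ((G.roots.map fun ζ => X - C ζ).prod).eval c := by
    conv_lhs => rw [hfac]
    rw [eval_mul, eval_C]
  rw [he] at hc ⊢
  rw [norm_mul, Real.log_mul (norm_ne_zero_iff.2 hl)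
    (norm_ne_zero_iff.2 (right_ne_zero_of_mul hc)), logPotential]
  exact add_le_add le_rfl (key _ (right_ne_zero_of_mul hc))

theorem sum_map_ite_one (s : Multiset ℂ) (p : ℂ → Prop) [DecidablePred p] (a : ℝ) :
    (s.map fun ζ => if p ζ then a else 0).sum = (s.countP p : ℝ) * a := by
  induction s using Multiset.induction_on with
  | empty => simp
  | cons b s ih =>
    rw [Multiset.map_cons, Multiset.sum_cons, ih, Multiset.countP_cons]
    split_ifs <;> push_cast <;> ring

open Classical in
/-- Jensen's bound for the number of roots in a disc. -/
theorem countP_mul_log_two_le (G : ℂ[X]) (c : ℂ) {r : ℝ} (hr : 0 < r) :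
    (G.roots.countP (fun ζ => ‖c - ζ‖ ≤ r) : ℝ) * Real.log 2 ≤
      logPotential G c (2 * r) - logPotential G c r := by
  rw [← sum_map_ite_one]
  have : (G.roots.map fun ζ => if ‖c - ζ‖ ≤ r then Real.log 2 else 0).sum +
      (G.roots.map fun ζ => Real.log (max r ‖c - ζ‖)).sum ≤
      (G.roots.map fun ζ => Real.log (max (2 * r) ‖c - ζ‖)).sum := by
    rw [← Multiset.sum_map_add]
    refine Multiset.sum_map_le_sum_map _ _ fun ζ _ => ?_
    split_ifs with h
    · rw [max_eq_left h, max_eq_left (h.trans (by linarith)), Real.log_mul two_ne_zero hr.ne']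
    · rw [zero_add]
      exact Real.log_le_log (by positivity) (max_le_max (by linarith) le_rfl)
  unfold logPotential
  linarith

/-- The average of `log ‖G‖` over the circle of radius `exp t` around the origin. -/
noncomputable def radialMean (G : ℂ[X]) (t : ℝ) : ℝ := logPotential G 0 (Real.exp t)

theorem radialMean_mono (G : ℂ[X]) : Monotone (radialMean G) := fun _ _ h =>
  logPotential_mono G 0 (Real.exp_pos _) (Real.exp_le_exp.2 h)

theorem log_max_exp_add_le (t s a : ℝ) (h : t ≤ s) :
    Real.log (max (Real.exp s) a) ≤ Real.log (max (Real.exp t) a) + (s - t) := by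
  have hp : 0 < max (Real.exp t) a := lt_max_of_lt_left (Real.exp_pos _)
  rw [← Real.log_exp (s - t), ← Real.log_mul hp.ne' (Real.exp_pos _).ne']
  refine Real.log_le_log (lt_max_of_lt_left (Real.exp_pos _)) ?_
  have h1 : (1 : ℝ) ≤ Real.exp (s - t) := Real.one_le_exp (by linarith)
  refine max_le ?_ ?_
  · calc Real.exp s = Real.exp t * Real.exp (s - t) := by rw [← Real.exp_add]; ring_nf
      _ ≤ _ := by gcongr; exact le_max_left _ _
  · calc a ≤ max (Real.exp t) a := le_max_right _ _
      _ ≤ _ := le_mul_of_one_le_right hp.le h1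

-- As `t` increases to `s`, a root contributes growth at most `s - t`, and none at all if it lies on
-- or outside the outer circle.
open Classical in
theorem radialMean_add_countP_le (G : ℂ[X]) {n : ℕ} (hn : G.natDegree ≤ n) {t s : ℝ}
    (h : t ≤ s) :
    radialMean G s + (G.roots.countP (fun ζ => Real.exp s ≤ ‖ζ‖) : ℝ) * (s - t) ≤
      radialMean G t + n * (s - t) := by
  rw [← sum_map_ite_one]
  have hc : (G.roots.card : ℝ) ≤ n := by exact_mod_cast (card_roots' G).trans hn
  have h1 : (G.roots.map fun ζ => Real.log (max (Real.exp s) ‖0 - ζ‖)).sum +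
      (G.roots.map fun ζ => if Real.exp s ≤ ‖ζ‖ then s - t else 0).sum ≤
      (G.roots.map fun ζ => Real.log (max (Real.exp t) ‖0 - ζ‖)).sum +
        G.roots.card * (s - t) := by
    have h2 : (G.roots.map fun _ => (s - t)).sum = G.roots.card * (s - t) := by simp
    rw [← h2, ← Multiset.sum_map_add, ← Multiset.sum_map_add]
    refine Multiset.sum_map_le_sum_map _ _ fun ζ _ => ?_
    rw [zero_sub, norm_neg]
    split_ifs with hs
    · rw [max_eq_right hs, max_eq_right ((Real.exp_le_exp.2 h).trans hs)]
    · rw [add_zero]; exact log_max_exp_add_le _ _ _ h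
  have h3 : (G.roots.card : ℝ) * (s - t) ≤ n * (s - t) := by gcongr
  unfold radialMean logPotential
  linarith

theorem radialMean_le_add (G : ℂ[X]) {n : ℕ} (hn : G.natDegree ≤ n) {t s : ℝ} (h : t ≤ s) :
    radialMean G s ≤ radialMean G t + n * (s - t) := by
  classical
  have h1 := radialMean_add_countP_le G hn h
  have h2 : 0 ≤ (G.roots.countP (fun ζ => Real.exp s ≤ ‖ζ‖) : ℝ) * (s - t) :=
    mul_nonneg (Nat.cast_nonneg _) (by linarith)
  linarith

-- Each root inside the smaller disc contributes slope exactly one on `[t, t + 1]`, and the other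
-- roots contribute nonnegatively.
open Classical in
theorem countP_norm_le_exp (G : ℂ[X]) (t : ℝ) :
    (G.roots.countP (fun ζ => ‖ζ‖ ≤ Real.exp t) : ℝ) ≤
      radialMean G (t + 1) - radialMean G t := by
  rw [← mul_one (G.roots.countP _ : ℝ), ← sum_map_ite_one]
  have : (G.roots.map fun ζ => if ‖ζ‖ ≤ Real.exp t then (1 : ℝ) else 0).sum +
      (G.roots.map fun ζ => Real.log (max (Real.exp t) ‖0 - ζ‖)).sum ≤
      (G.roots.map fun ζ => Real.log (max (Real.exp (t + 1)) ‖0 - ζ‖)).sum := by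
    rw [← Multiset.sum_map_add]
    refine Multiset.sum_map_le_sum_map _ _ fun ζ _ => ?_
    rw [zero_sub, norm_neg]
    have h1 : Real.exp t ≤ Real.exp (t + 1) := Real.exp_le_exp.2 (by linarith)
    split_ifs with h
    · rw [max_eq_left h, max_eq_left (h.trans h1), Real.log_exp, Real.log_exp]; linarith
    · rw [zero_add]
      exact Real.log_le_log (by positivity) (max_le_max h1 le_rfl)
  unfold radialMean logPotential
  linarith

/-! ### Area integrals of nonnegative superharmonic functions -/

theorem setLIntegral_polar (f : ℂ → ENNReal) (hf : Measurable f) (c : ℂ) {A : Set ℝ}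
    (hA : MeasurableSet A) :
    ∫⁻ z in {z | ‖z - c‖ ∈ A}, f z =
      ∫⁻ ρ in Set.Ioi 0 ∩ A, ENNReal.ofReal ρ *
        ∫⁻ θ in Set.Ioo (-Real.pi) Real.pi, f (circleMap c ρ θ) := by
  have hm : MeasurableSet {z : ℂ | ‖z - c‖ ∈ A} :=
    (measurable_id.sub_const c).norm hA
  set g : ℂ → ENNReal := Set.indicator {z : ℂ | ‖z - c‖ ∈ A} f with hg
  have hgm : Measurable g := hf.indicator hm
  have h1 : ∫⁻ z in {z | ‖z - c‖ ∈ A}, f z = ∫⁻ z, g (z + c) := by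
    rw [lintegral_add_right_eq_self g c, hg, lintegral_indicator hm]
  rw [h1, ← Complex.lintegral_comp_polarCoord_symm, polarCoord_target, Measure.volume_eq_prod,
    ← Measure.prod_restrict, lintegral_prod]
  · rw [← Measure.restrict_restrict_of_subset (Set.inter_subset_left : Set.Ioi (0 : ℝ) ∩ A ⊆ _),
      ← lintegral_indicator (measurableSet_Ioi.inter hA)]
    refine setLIntegral_congr_fun measurableSet_Ioi fun ρ hρ => ?_
    have hρ' : (0 : ℝ) < ρ := hρ
    have hc : ∀ θ : ℝ, Complex.polarCoord.symm (ρ, θ) + c = circleMap c ρ θ := by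
      intro θ
      rw [Complex.polarCoord_symm_apply, circleMap, Complex.exp_mul_I, add_comm]
      simp
    simp only [smul_eq_mul, hc]
    have hn : ∀ θ : ℝ, ‖circleMap c ρ θ - c‖ = ρ := by
      intro θ; simp [circleMap, abs_of_pos hρ']
    by_cases hρA : ρ ∈ A
    · rw [Set.indicator_of_mem (show ρ ∈ Set.Ioi 0 ∩ A from ⟨hρ, hρA⟩), lintegral_const_mul]
      · congr 1
        refine lintegral_congr fun θ => ?_
        rw [hg, Set.indicator_of_mem]
        rw [Set.mem_ofPred_eq, hn]; exact hρA
      · exact hgm.comp (continuous_circleMap c ρ).measurable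
    · rw [Set.indicator_of_notMem (fun h => hρA h.2)]
      simp only [hg]
      rw [← lintegral_zero]
      refine lintegral_congr fun θ => ?_
      rw [Set.indicator_of_notMem, mul_zero]
      rw [Set.mem_ofPred_eq, hn]; exact hρA
  · refine Measurable.aemeasurable ?_
    have hsm : Measurable fun p : ℝ × ℝ => Complex.polarCoord.symm p := by
      simp only [Complex.polarCoord_symm_apply]
      fun_prop
    exact Measurable.smul (ENNReal.measurable_ofReal.comp measurable_fst) (hgm.comp (hsm.add_const c))

/-- Periodicity reconciles the angle range `(-π, π)` of polar coordinates with the range `[0, 2π]`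
of `circleAverage`. -/
theorem setLIntegral_circle_eq {s : ℂ → ℝ} {c : ℂ} {ρ : ℝ} (hi : CircleIntegrable s c ρ)
    (h0 : ∀ᵐ θ : ℝ, 0 ≤ s (circleMap c ρ θ)) :
    ∫⁻ θ in Set.Ioo (-Real.pi) Real.pi, ENNReal.ofReal (s (circleMap c ρ θ)) =
      ENNReal.ofReal (2 * Real.pi * Real.circleAverage s c ρ) := by
  have hp : Function.Periodic (fun θ => s (circleMap c ρ θ)) (2 * Real.pi) := fun θ => by
    simp only [periodic_circleMap c ρ θ]
  have hi' : IntervalIntegrable (fun θ => s (circleMap c ρ θ)) volume (-Real.pi) Real.pi := by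
    refine hp.intervalIntegrable (by positivity) (t := 0) ?_ (-Real.pi) Real.pi
    rw [zero_add]; exact hi
  have hle : -Real.pi ≤ Real.pi := by linarith [Real.pi_pos]
  rw [Real.circleAverage_def, smul_eq_mul, ← mul_assoc,
    mul_inv_cancel₀ (by positivity : (2 * Real.pi) ≠ 0), one_mul]
  have h2 : ∫ θ in (0 : ℝ)..2 * Real.pi, s (circleMap c ρ θ) =
      ∫ θ in (-Real.pi)..Real.pi, s (circleMap c ρ θ) := by
    have := hp.intervalIntegral_add_eq 0 (-Real.pi)
    rw [zero_add] at this
    rw [this]; congr 1; ring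
  rw [h2, intervalIntegral.integral_of_le hle, ofReal_integral_eq_lintegral_ofReal,
    ← restrict_Ioo_eq_restrict_Ioc]
  · exact (intervalIntegrable_iff_integrableOn_Ioc_of_le hle).1 hi'
  · exact ae_restrict_of_ae h0

theorem ae_eval_circleMap_ne_zero {G : ℂ[X]} (hG : G ≠ 0) (c : ℂ) {ρ : ℝ} (hρ : 0 < ρ) :
    ∀ᵐ θ : ℝ, G.eval (circleMap c ρ θ) ≠ 0 := by
  have h := circleMap_preimage_codiscrete (c := c) hρ.ne'
    (eval_ne_zero_mem_codiscreteWithin hG (Metric.sphere c |ρ|))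
  have h2 := ae_restrict_le_codiscreteWithin (μ := (volume : Measure ℝ)) MeasurableSet.univ h
  rw [Measure.restrict_univ] at h2
  exact h2

/-- The difference between `β + v * log ‖z‖` and `log ‖G z‖`. -/
noncomputable def logGap (G : ℂ[X]) (β : ℝ) (v : ℕ) (z : ℂ) : ℝ :=
  β + v * Real.log ‖z‖ - Real.log ‖G.eval z‖

theorem measurable_logGap (G : ℂ[X]) (β : ℝ) (v : ℕ) : Measurable (logGap G β v) := by
  unfold logGap
  have : Measurable fun z : ℂ => G.eval z := G.continuous.measurable
  fun_prop

theorem circleIntegrable_log_norm (c : ℂ) (ρ : ℝ) :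
    CircleIntegrable (fun z : ℂ => Real.log ‖z‖) c ρ := by
  simpa using circleIntegrable_log_norm_sub_const (a := 0) (c := c) ρ

theorem circleIntegrable_logGap (G : ℂ[X]) (β : ℝ) (v : ℕ) (c : ℂ) (ρ : ℝ) :
    CircleIntegrable (logGap G β v) c ρ :=
  CircleIntegrable.sub (f := fun z : ℂ => β + v * Real.log ‖z‖)
    (CircleIntegrable.add (f := fun _ => β) (circleIntegrable_const β c ρ)
      (IntervalIntegrable.const_mul (circleIntegrable_log_norm c ρ) _))
    (circleIntegrable_log_norm_eval G c ρ)

theorem circleAverage_logGap {G : ℂ[X]} (hG : G ≠ 0) (β : ℝ) (v : ℕ) (c : ℂ) {ρ : ℝ}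
    (hρ : 0 < ρ) :
    Real.circleAverage (logGap G β v) c ρ =
      β + v * Real.log (max ρ ‖c‖) - logPotential G c ρ := by
  have h1 : Real.circleAverage (fun z : ℂ => Real.log ‖z‖) c ρ = Real.log (max ρ ‖c‖) := by
    simpa using circleAverage_log_norm_sub_eq (c := c) (ζ := 0) hρ
  have h2 : CircleIntegrable (fun z : ℂ => (v : ℝ) * Real.log ‖z‖) c ρ :=
    IntervalIntegrable.const_mul (circleIntegrable_log_norm c ρ) _
  unfold logGap
  rw [Real.circleAverage_fun_sub
    (f₁ := fun z => β + v * Real.log ‖z‖)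
    (CircleIntegrable.add (f := fun _ => β) (circleIntegrable_const β c ρ) h2)
    (circleIntegrable_log_norm_eval G c ρ),
    Real.circleAverage_fun_add (circleIntegrable_const β c ρ) h2,
    circleAverage_log_norm_eval hG c hρ, Real.circleAverage_const]
  have h3 : Real.circleAverage (fun z : ℂ => (v : ℝ) * Real.log ‖z‖) c ρ =
      v * Real.circleAverage (fun z : ℂ => Real.log ‖z‖) c ρ :=
    Real.circleAverage_fun_smul (a := (v : ℝ)) (f := fun z : ℂ => Real.log ‖z‖)
  rw [h3, h1]

theorem setLIntegral_ofReal_const_mul {a b : ℝ} (ha : 0 ≤ a) (hab : a ≤ b) {C : ℝ}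
    (hC : 0 ≤ C) :
    ∫⁻ ρ in Set.Ioo a b, ENNReal.ofReal (ρ * C) = ENNReal.ofReal ((b ^ 2 - a ^ 2) / 2 * C) := by
  have h : ∫ ρ in Set.Ioo a b, ρ * C = (b ^ 2 - a ^ 2) / 2 * C := by
    rw [← integral_Ioc_eq_integral_Ioo, ← intervalIntegral.integral_of_le hab,
      intervalIntegral.integral_mul_const, integral_id]
  rw [← h, ofReal_integral_eq_lintegral_ofReal]
  · rw [restrict_Ioo_eq_restrict_Ioc]
    exact (intervalIntegrable_iff_integrableOn_Ioc_of_le hab).1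
      (Continuous.intervalIntegrable (by fun_prop) _ _)
  · refine (ae_restrict_iff' measurableSet_Ioo).2 (ae_of_all _ fun ρ hρ => ?_)
    exact mul_nonneg (ha.trans hρ.1.le) hC

/-- The integral of the positive part of `logGap G β v` over a set. -/
noncomputable def gapMass (G : ℂ[X]) (β : ℝ) (v : ℕ) (A : Set ℂ) : ENNReal :=
  ∫⁻ z in A, ENNReal.ofReal (logGap G β v z)

/-- Polar coordinates, with the circle averages known from Jensen's formula. The sign hypothesis
leaves out the roots, where `Real.log 0 = 0` makes `logGap` meaningless; they are negligible on
every circle. -/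
theorem gapMass_eq {G : ℂ[X]} (hG : G ≠ 0) (β : ℝ) (v : ℕ) (c : ℂ) {A : Set ℝ}
    (hA : MeasurableSet A)
    (h0 : ∀ z, ‖z - c‖ ∈ A → G.eval z ≠ 0 → 0 ≤ logGap G β v z) :
    gapMass G β v {z | ‖z - c‖ ∈ A} = ∫⁻ ρ in Set.Ioi 0 ∩ A,
      ENNReal.ofReal (ρ * (2 * Real.pi *
        (β + v * Real.log (max ρ ‖c‖) - logPotential G c ρ))) := by
  rw [gapMass, setLIntegral_polar _ (measurable_logGap G β v).ennreal_ofReal c hA]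
  refine setLIntegral_congr_fun (measurableSet_Ioi.inter hA) fun ρ hρ => ?_
  have hρ0 : (0 : ℝ) < ρ := hρ.1
  rw [setLIntegral_circle_eq (circleIntegrable_logGap G β v c ρ), circleAverage_logGap hG β v c hρ0,
    ← ENNReal.ofReal_mul hρ0.le]
  filter_upwards [ae_eval_circleMap_ne_zero hG c hρ0] with θ hθ
  refine h0 _ ?_ hθ
  have : ‖circleMap c ρ θ - c‖ = ρ := by simp [circleMap, abs_of_pos hρ0]
  rw [this]; exact hρ.2

theorem ball_eq_norm_sub (c : ℂ) (r : ℝ) : Metric.ball c r = {z | ‖z - c‖ ∈ Set.Iio r} := by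
  ext z; simp [dist_eq_norm]

theorem Ioi_inter_Iio' (r : ℝ) : Set.Ioi (0 : ℝ) ∩ Set.Iio r = Set.Ioo 0 r := rfl

theorem logPotential_le {G : ℂ[X]} (hG : G ≠ 0) {β : ℝ} {v : ℕ} {c : ℂ} {r : ℝ} (hr : 0 < r)
    (h0 : ∀ z, ‖z - c‖ = r → G.eval z ≠ 0 → 0 ≤ logGap G β v z) :
    logPotential G c r ≤ β + v * Real.log (max r ‖c‖) := by
  rw [← sub_nonneg, ← circleAverage_logGap hG β v c hr, Real.circleAverage_def, smul_eq_mul]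
  refine mul_nonneg (by positivity) (intervalIntegral.integral_nonneg_of_ae
    (by positivity) ?_)
  filter_upwards [ae_eval_circleMap_ne_zero hG c hr] with θ hθ
  exact h0 _ (by simp [circleMap, abs_of_pos hr]) hθ

/-- The mean over a disc is at most the value at the center. -/
theorem gapMass_ball_le {G : ℂ[X]} {β : ℝ} {v : ℕ} {c : ℂ} {r : ℝ} (hr : 0 < r)
    (hrc : r ≤ ‖c‖) (hc : G.eval c ≠ 0)
    (h0 : ∀ z ∈ Metric.ball c r, G.eval z ≠ 0 → 0 ≤ logGap G β v z) :
    gapMass G β v (Metric.ball c r) ≤ ENNReal.ofReal (Real.pi * r ^ 2 * logGap G β v c) := by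
  have hG : G ≠ 0 := by rintro rfl; simp at hc
  have hs : 0 ≤ logGap G β v c := h0 c (Metric.mem_ball_self hr) hc
  rw [ball_eq_norm_sub] at h0 ⊢
  rw [gapMass_eq hG β v c measurableSet_Iio (fun z hz => h0 z hz), Ioi_inter_Iio']
  have h1 := setLIntegral_ofReal_const_mul le_rfl hr.le
    (mul_nonneg (by positivity : 0 ≤ 2 * Real.pi) hs)
  have h2 : Real.pi * r ^ 2 * logGap G β v c =
      (r ^ 2 - 0 ^ 2) / 2 * (2 * Real.pi * logGap G β v c) := by ring
  rw [h2, ← h1]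
  refine setLIntegral_mono (by fun_prop) fun ρ hρ => ENNReal.ofReal_le_ofReal ?_
  have h3 := log_norm_eval_le_logPotential hc ρ
  -- The disc avoids the origin, so `v * log ‖z‖` is harmonic in it and its circle averages equal
  -- its value at the centre.
  rw [max_eq_right (hρ.2.le.trans hrc)]
  unfold logGap
  have := hρ.1.le
  gcongr

/-- The mean over a disc of twice the radius is no larger. -/
theorem gapMass_ball_two_mul_le {G : ℂ[X]} (hG : G ≠ 0) {β : ℝ} {v : ℕ} {c : ℂ} {r : ℝ}
    (hr : 0 < r) (hrc : 2 * r ≤ ‖c‖)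
    (h0 : ∀ z ∈ Metric.ball c (2 * r), G.eval z ≠ 0 → 0 ≤ logGap G β v z) :
    gapMass G β v (Metric.ball c (2 * r)) ≤ 4 * gapMass G β v (Metric.ball c r) := by
  have h0' : ∀ z, ‖z - c‖ ∈ Set.Iio r → G.eval z ≠ 0 → 0 ≤ logGap G β v z := by
    intro z hz
    refine h0 z (Metric.mem_ball.2 ?_)
    rw [dist_eq_norm]; have : ‖z - c‖ < r := hz; linarith
  rw [ball_eq_norm_sub] at h0 ⊢
  rw [ball_eq_norm_sub, gapMass_eq hG β v c measurableSet_Iio (fun z hz => h0 z hz),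
    gapMass_eq hG β v c measurableSet_Iio h0', Ioi_inter_Iio', Ioi_inter_Iio']
  set σ : ℝ → ℝ := fun ρ => β + v * Real.log (max ρ ‖c‖) - logPotential G c ρ with hσ
  have hσr : 0 ≤ σ r := by
    refine sub_nonneg.2 (logPotential_le hG hr fun z hz => h0 z ?_)
    rw [Set.mem_ofPred_eq, hz, Set.mem_Iio]; linarith
  have hanti : ∀ ρ ρ', 0 < ρ → ρ ≤ ρ' → ρ' ≤ 2 * r → σ ρ' ≤ σ ρ := by
    intro ρ ρ' h1 h2 h3
    simp only [hσ]
    rw [max_eq_right (h3.trans hrc), max_eq_right ((h2.trans h3).trans hrc)]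
    linarith [logPotential_mono G c h1 h2]
  have hlow : ENNReal.ofReal (Real.pi * r ^ 2 * σ r) ≤
      ∫⁻ ρ in Set.Ioo 0 r, ENNReal.ofReal (ρ * (2 * Real.pi * σ ρ)) := by
    have h1 := setLIntegral_ofReal_const_mul le_rfl hr.le
      (mul_nonneg (by positivity : 0 ≤ 2 * Real.pi) hσr)
    have h2 : Real.pi * r ^ 2 * σ r = (r ^ 2 - 0 ^ 2) / 2 * (2 * Real.pi * σ r) := by ring
    rw [h2, ← h1]
    refine setLIntegral_mono' measurableSet_Ioo fun ρ hρ => ENNReal.ofReal_le_ofReal ?_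
    have h3 := hanti ρ r hρ.1 hρ.2.le (by linarith)
    have := hρ.1.le
    gcongr
  -- The averages `σ` decrease in `ρ`, and the ring between `r` and `2 * r` has three times the area
  -- of the disc. This gives the total factor `1 + 3 = 4`.
  have hup : ∫⁻ ρ in Set.Ioo r (2 * r), ENNReal.ofReal (ρ * (2 * Real.pi * σ ρ)) ≤
      3 * ENNReal.ofReal (Real.pi * r ^ 2 * σ r) := by
    have h1 := setLIntegral_ofReal_const_mul hr.le (by linarith : r ≤ 2 * r)
      (mul_nonneg (by positivity : 0 ≤ 2 * Real.pi) hσr)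
    have h2 : 3 * ENNReal.ofReal (Real.pi * r ^ 2 * σ r) =
        ENNReal.ofReal (((2 * r) ^ 2 - r ^ 2) / 2 * (2 * Real.pi * σ r)) := by
      rw [← ENNReal.ofReal_ofNat, ← ENNReal.ofReal_mul (by norm_num)]
      congr 1; ring
    rw [h2, ← h1]
    refine setLIntegral_mono' measurableSet_Ioo fun ρ hρ => ENNReal.ofReal_le_ofReal ?_
    have h3 := hanti r ρ hr hρ.1.le hρ.2.le
    have := hr.le.trans hρ.1.le
    gcongr
  have hsplit : ∫⁻ ρ in Set.Ioo 0 (2 * r), ENNReal.ofReal (ρ * (2 * Real.pi * σ ρ)) ≤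
      (∫⁻ ρ in Set.Ioo 0 r, ENNReal.ofReal (ρ * (2 * Real.pi * σ ρ))) +
      ∫⁻ ρ in Set.Ioo r (2 * r), ENNReal.ofReal (ρ * (2 * Real.pi * σ ρ)) := by
    have hio : (volume : Measure ℝ).restrict (Set.Ioo 0 r) = volume.restrict (Set.Ioc 0 r) :=
      restrict_Ioo_eq_restrict_Ioc
    rw [hio, ← Set.Ioc_union_Ioo_eq_Ioo hr.le (by linarith : r < 2 * r)]
    exact lintegral_union_le _ _ _
  calc _ ≤ _ := hsplit
    _ ≤ (∫⁻ ρ in Set.Ioo 0 r, ENNReal.ofReal (ρ * (2 * Real.pi * σ ρ))) +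
        3 * ∫⁻ ρ in Set.Ioo 0 r, ENNReal.ofReal (ρ * (2 * Real.pi * σ ρ)) := by
      gcongr; exact hup.trans (by gcongr)
    _ = _ := by ring

/-! ### Dominating coefficients -/

/-- The term of index `v` has the largest modulus on the circle of radius `exp t`. -/
def IsDominant (G : ℂ[X]) (v : ℕ) (t : ℝ) : Prop :=
  G.coeff v ≠ 0 ∧
    ∀ k, ‖G.coeff k‖ * Real.exp (k * t) ≤ ‖G.coeff v‖ * Real.exp (v * t)

/-- The ratio of the `k`-th term to the `v`-th is `exp ((k - v) * t)` up to a constant factor. It is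
at most one at both ends; moving inwards by `H`, from `t₂` if `k ≥ v` and from `t₁` otherwise, gains
the factor `exp (-(H * |k - v|))`. -/
theorem IsDominant.coeff_mul_exp_le {G : ℂ[X]} {v : ℕ} {t₁ t₂ τ H : ℝ}
    (h₁ : IsDominant G v t₁) (h₂ : IsDominant G v t₂) (ht₁ : t₁ + H ≤ τ) (ht₂ : τ + H ≤ t₂)
    (k : ℕ) :
    ‖G.coeff k‖ * Real.exp (k * τ) ≤
      ‖G.coeff v‖ * Real.exp (v * τ) * Real.exp (-(H * |(k : ℝ) - v|)) := by
  rcases le_total v k with hk | hk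
  · have hk' : (0 : ℝ) ≤ k - v := by
      have : (v : ℝ) ≤ k := by exact_mod_cast hk
      linarith
    rw [abs_of_nonneg hk']
    calc ‖G.coeff k‖ * Real.exp (k * τ)
        = ‖G.coeff k‖ * Real.exp (k * t₂) * Real.exp (k * (τ - t₂)) := by
          rw [mul_assoc, ← Real.exp_add]; ring_nf
      _ ≤ ‖G.coeff v‖ * Real.exp (v * t₂) * Real.exp (k * (τ - t₂)) := by
          gcongr ?_ * _
          exact h₂.2 k
      _ ≤ _ := by
          rw [mul_assoc, mul_assoc, ← Real.exp_add, ← Real.exp_add]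
          refine mul_le_mul_of_nonneg_left (Real.exp_le_exp.2 ?_) (norm_nonneg _)
          nlinarith
  · have hk' : (k : ℝ) - v ≤ 0 := by
      have : (k : ℝ) ≤ v := by exact_mod_cast hk
      linarith
    rw [abs_of_nonpos hk']
    calc ‖G.coeff k‖ * Real.exp (k * τ)
        = ‖G.coeff k‖ * Real.exp (k * t₁) * Real.exp (k * (τ - t₁)) := by
          rw [mul_assoc, ← Real.exp_add]; ring_nf
      _ ≤ ‖G.coeff v‖ * Real.exp (v * t₁) * Real.exp (k * (τ - t₁)) := by
          gcongr ?_ * _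
          exact h₁.2 k
      _ ≤ _ := by
          rw [mul_assoc, mul_assoc, ← Real.exp_add, ← Real.exp_add]
          refine mul_le_mul_of_nonneg_left (Real.exp_le_exp.2 ?_) (norm_nonneg _)
          nlinarith

theorem IsDominant.of_le_of_le {G : ℂ[X]} {v : ℕ} {t₁ t₂ τ : ℝ}
    (h₁ : IsDominant G v t₁) (h₂ : IsDominant G v t₂) (ht₁ : t₁ ≤ τ) (ht₂ : τ ≤ t₂) :
    IsDominant G v τ := by
  refine ⟨h₁.1, fun k => ?_⟩
  simpa using h₁.coeff_mul_exp_le (H := 0) h₂ (by simpa using ht₁) (by simpa using ht₂) k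

theorem IsDominant.index_le {G : ℂ[X]} {v w : ℕ} {t s : ℝ} (hv : IsDominant G v t)
    (hw : IsDominant G w s) (h : t < s) : v ≤ w := by
  by_contra hlt
  push Not at hlt
  have hlt' : (w : ℝ) < v := by exact_mod_cast hlt
  have h1 := hv.2 w
  have h2 := hw.2 v
  have a1 : 0 < ‖G.coeff w‖ := norm_pos_iff.2 hw.1
  have a2 : 0 < ‖G.coeff v‖ := norm_pos_iff.2 hv.1
  have e1 := Real.log_le_log (by positivity) h1
  have e2 := Real.log_le_log (by positivity) h2
  rw [Real.log_mul a1.ne' (Real.exp_pos _).ne', Real.log_mul a2.ne' (Real.exp_pos _).ne',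
    Real.log_exp, Real.log_exp] at e1 e2
  nlinarith

theorem norm_eval_le_sum (G : ℂ[X]) {n : ℕ} (hn : G.natDegree ≤ n) {z : ℂ} {t : ℝ}
    (hz : ‖z‖ = Real.exp t) :
    ‖G.eval z‖ ≤ ∑ k ∈ Finset.range (n + 1), ‖G.coeff k‖ * Real.exp (k * t) := by
  rw [eval_eq_sum_range' (Nat.lt_succ_of_le hn)]
  refine (norm_sum_le _ _).trans (Finset.sum_le_sum fun k _ => ?_)
  rw [norm_mul, norm_pow, hz, ← Real.exp_nat_mul]

theorem IsDominant.norm_eval_le {G : ℂ[X]} {n : ℕ} (hn : G.natDegree ≤ n) {v : ℕ} {t : ℝ}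
    (hv : IsDominant G v t) {z : ℂ} (hz : ‖z‖ = Real.exp t) :
    ‖G.eval z‖ ≤ (n + 1) * (‖G.coeff v‖ * Real.exp (v * t)) := by
  refine (norm_eval_le_sum G hn hz).trans ?_
  refine (Finset.sum_le_sum fun k _ => hv.2 k).trans ?_
  simp

theorem sum_geometric_le {q : ℝ} (h0 : 0 ≤ q) (h1 : q < 1) (m : ℕ) :
    ∑ k ∈ Finset.range m, q ^ k ≤ 1 / (1 - q) := by
  rw [one_div]; exact (summable_geometric_of_lt_one h0 h1).sum_le_tsum _ (fun _ _ => by positivity)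
    |>.trans (tsum_geometric_of_lt_one h0 h1).le

theorem sum_exp_neg_abs_sub_le {H : ℝ} (hH : 0 < H) (v N : ℕ) :
    ∑ k ∈ (Finset.range N).erase v, Real.exp (-(H * |(k : ℝ) - v|)) ≤
      2 * Real.exp (-H) / (1 - Real.exp (-H)) := by
  set q := Real.exp (-H) with hq
  have hq0 : 0 ≤ q := (Real.exp_pos _).le
  have hq1 : q < 1 := by rw [hq, Real.exp_lt_one_iff]; linarith
  have hsub : (Finset.range N).erase v ⊆ Finset.range v ∪ Finset.Ico (v + 1) (v + 1 + N) := by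
    intro k hk
    simp only [Finset.mem_erase, Finset.mem_range, Finset.mem_union, Finset.mem_Ico] at hk ⊢
    omega
  refine (Finset.sum_le_sum_of_subset_of_nonneg hsub fun _ _ _ => (Real.exp_pos _).le).trans ?_
  rw [Finset.sum_union (by
    rw [Finset.disjoint_left]; intro k; simp only [Finset.mem_range, Finset.mem_Ico]; omega)]
  have h1 : ∑ k ∈ Finset.range v, Real.exp (-(H * |(k : ℝ) - v|)) ≤ q * (1 / (1 - q)) := by
    rw [← Finset.sum_range_reflect]
    refine le_trans ?_ (mul_le_mul_of_nonneg_left (sum_geometric_le hq0 hq1 v) hq0)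
    rw [Finset.mul_sum]
    refine Finset.sum_le_sum fun k hk => ?_
    have hk := Finset.mem_range.1 hk
    have h2 : ((v - 1 - k : ℕ) : ℝ) - v = -((k : ℝ) + 1) := by
      rw [Nat.sub_sub, Nat.cast_sub (by omega)]; push_cast; ring
    rw [h2, abs_neg, abs_of_nonneg (by positivity), ← pow_succ', hq, ← Real.exp_nat_mul]
    apply le_of_eq; congr 1; push_cast; ring
  have h2 : ∑ k ∈ Finset.Ico (v + 1) (v + 1 + N), Real.exp (-(H * |(k : ℝ) - v|)) ≤
      q * (1 / (1 - q)) := by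
    rw [Finset.sum_Ico_eq_sum_range]
    refine le_trans ?_ (mul_le_mul_of_nonneg_left (sum_geometric_le hq0 hq1 (v + 1 + N - (v + 1))) hq0)
    rw [Finset.mul_sum]
    refine Finset.sum_le_sum fun k _ => ?_
    have h2 : ((v + 1 + k : ℕ) : ℝ) - v = (k : ℝ) + 1 := by push_cast; ring
    rw [h2, abs_of_nonneg (by positivity), ← pow_succ', hq, ← Real.exp_nat_mul]
    apply le_of_eq; congr 1; push_cast; ring
  calc _ ≤ q * (1 / (1 - q)) + q * (1 / (1 - q)) := add_le_add h1 h2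
    _ = _ := by ring

/-- A polynomial has no zero on a circle on which one of its terms strongly dominates. -/
theorem IsDominant.eval_ne_zero {G : ℂ[X]} {v : ℕ} {t : ℝ}
    (h₁ : IsDominant G v (t - 2)) (h₂ : IsDominant G v (t + 2)) {z : ℂ}
    (hz : ‖z‖ = Real.exp t) : G.eval z ≠ 0 := by
  intro h0
  have hv : v ∈ Finset.range (G.natDegree + 1) :=
    Finset.mem_range.2 (Nat.lt_succ_of_le (le_natDegree_of_ne_zero h₁.1))
  rw [eval_eq_sum_range, ← Finset.add_sum_erase _ _ hv] at h0
  have hb : 0 < ‖G.coeff v‖ * Real.exp (v * t) :=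
    mul_pos (norm_pos_iff.2 h₁.1) (Real.exp_pos _)
  have h1 : ‖G.coeff v‖ * Real.exp (v * t) ≤
      ∑ k ∈ (Finset.range (G.natDegree + 1)).erase v,
        ‖G.coeff v‖ * Real.exp (v * t) * Real.exp (-(2 * |(k : ℝ) - v|)) := by
    have h2 : ‖G.coeff v * z ^ v‖ = ‖G.coeff v‖ * Real.exp (v * t) := by
      rw [norm_mul, norm_pow, hz, ← Real.exp_nat_mul]
    have h3 : ‖G.coeff v‖ * Real.exp (v * t) =
        ‖∑ k ∈ (Finset.range (G.natDegree + 1)).erase v, G.coeff k * z ^ k‖ := by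
      rw [← h2, eq_neg_of_add_eq_zero_left h0, norm_neg]
    refine h3.le.trans ((norm_sum_le _ _).trans (Finset.sum_le_sum fun k _ => ?_))
    rw [norm_mul, norm_pow, hz, ← Real.exp_nat_mul]
    exact h₁.coeff_mul_exp_le h₂ (by linarith) le_rfl k
  rw [← Finset.mul_sum] at h1
  have h3 := sum_exp_neg_abs_sub_le (H := 2) (by norm_num) v (G.natDegree + 1)
  -- With margin `2` the other terms total at most `2q / (1 - q)` times the dominant one, where `q =
  -- exp (-2)`; this is less than one, so no cancellation to zero is possible.
  have h4 : Real.exp (-2) < 1 / 4 := by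
    rw [Real.exp_neg, inv_eq_one_div]
    apply one_div_lt_one_div_of_lt (by norm_num)
    have h5 : (2 : ℝ) < Real.exp 1 := by linarith [Real.exp_one_gt_d9]
    have h6 : Real.exp 2 = Real.exp 1 * Real.exp 1 := by rw [← Real.exp_add]; norm_num
    rw [h6]; nlinarith
  have h5 : 2 * Real.exp (-2) / (1 - Real.exp (-2)) < 1 := by
    rw [div_lt_one (by linarith)]; linarith
  nlinarith

/-- Cauchy's estimate for the `v`-th coefficient, read at a point where `‖G‖` is maximal on the
circle. -/
theorem exists_norm_eval_ge (G : ℂ[X]) (v : ℕ) (t : ℝ) :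
    ∃ z : ℂ, ‖z‖ = Real.exp t ∧ ‖G.coeff v‖ * Real.exp (v * t) ≤ ‖G.eval z‖ := by
  have hne : (Metric.sphere (0 : ℂ) (Real.exp t)).Nonempty :=
    NormedSpace.sphere_nonempty.2 (Real.exp_pos t).le
  obtain ⟨z, hz, hmax⟩ := (isCompact_sphere (0 : ℂ) (Real.exp t)).exists_isMaxOn hne
    (f := fun z => ‖G.eval z‖) (by fun_prop)
  refine ⟨z, by simpa using hz, ?_⟩
  have h := Complex.norm_iteratedDeriv_le_of_forall_mem_sphere_norm_le v (Real.exp_pos t)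
    (f := fun z => G.eval z) (c := 0) G.differentiable.diffContOnCl (C := ‖G.eval z‖)
    (fun w hw => hmax hw)
  have hd : iteratedDeriv v (fun z => G.eval z) 0 = (v.factorial : ℂ) * G.coeff v := by
    have h2 : iteratedDeriv v (fun z => G.eval z) = fun z => (derivative^[v] G).eval z := by
      induction v with
      | zero => simp
      | succ m ih =>
        rw [iteratedDeriv_succ, ih]
        · ext x; rw [Polynomial.deriv, Function.iterate_succ_apply']
        -- The bound `h` depends on `v`, so the induction hypothesis requires it for `m`.
        · exact Complex.norm_iteratedDeriv_le_of_forall_mem_sphere_norm_le m (Real.exp_pos t)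
            G.differentiable.diffContOnCl (fun w hw => hmax hw)
    rw [h2]
    simp only
    rw [← coeff_zero_eq_eval_zero, coeff_iterate_derivative, zero_add, Nat.descFactorial_self,
      nsmul_eq_mul]
  rw [hd, norm_mul, Complex.norm_natCast, ← Real.exp_nat_mul, mul_div_assoc] at h
  have hf : (0 : ℝ) < v.factorial := by exact_mod_cast v.factorial_pos
  have h3 := le_of_mul_le_mul_left h hf
  rwa [le_div_iff₀ (Real.exp_pos _)] at h3

/-! ### The radial mean on an annulus with a dominating term -/

theorem exp_neg_le_one_sub_half {x : ℝ} (h0 : 0 ≤ x) (h1 : x ≤ 1) :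
    Real.exp (-x) ≤ 1 - x / 2 := by
  have h2 : Real.exp (-x) ≤ 1 / (1 + x) := by
    rw [Real.exp_neg, inv_eq_one_div]
    apply one_div_le_one_div_of_le (by linarith)
    linarith [Real.add_one_le_exp x]
  refine h2.trans ?_
  rw [div_le_iff₀ (by linarith)]
  nlinarith

/-- The terms decay geometrically on both sides of `v` with ratio `exp (-(h / 2)) ≤ 1 - h / 4`. The
factor `8 / h` does not depend on the degree. -/
theorem IsDominant.norm_eval_le_of_gap {G : ℂ[X]} {v : ℕ} {t₁ t₂ τ h : ℝ} (h0 : 0 < h)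
    (h1 : h ≤ 1) (h₁ : IsDominant G v t₁) (h₂ : IsDominant G v t₂)
    (ht₁ : t₁ + h / 2 ≤ τ) (ht₂ : τ + h / 2 ≤ t₂) {z : ℂ} (hz : ‖z‖ = Real.exp τ) :
    ‖G.eval z‖ ≤ ‖G.coeff v‖ * Real.exp (v * τ) * (8 / h) := by
  have hv : v ∈ Finset.range (G.natDegree + 1) :=
    Finset.mem_range.2 (Nat.lt_succ_of_le (le_natDegree_of_ne_zero h₁.1))
  refine (norm_eval_le_sum G le_rfl hz).trans ?_
  refine (Finset.sum_le_sum fun k _ => h₁.coeff_mul_exp_le h₂ ht₁ ht₂ k).trans ?_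
  rw [← Finset.mul_sum]
  refine mul_le_mul_of_nonneg_left ?_ (by positivity)
  rw [← Finset.add_sum_erase _ _ hv]
  have h3 := sum_exp_neg_abs_sub_le (H := h / 2) (by linarith) v (G.natDegree + 1)
  have h4 := exp_neg_le_one_sub_half (x := h / 2) (by linarith) (by linarith)
  have h5 : 0 < Real.exp (-(h / 2)) := Real.exp_pos _
  have h6 : 2 * Real.exp (-(h / 2)) / (1 - Real.exp (-(h / 2))) ≤ 8 / h - 1 := by
    rw [div_le_iff₀ (by linarith), sub_mul, one_mul, div_mul_eq_mul_div, le_sub_iff_add_le,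
      le_div_iff₀ h0]
    nlinarith
  simp only [sub_self, abs_zero, mul_zero, neg_zero, Real.exp_zero]
  linarith

theorem norm_exp_I_sub_exp_I_le (a b : ℝ) :
    ‖Complex.exp (a * Complex.I) - Complex.exp (b * Complex.I)‖ ≤ |a - b| := by
  have h1 : Complex.exp (a * Complex.I) - Complex.exp (b * Complex.I) =
      Complex.exp (b * Complex.I) * (Complex.exp (Complex.I * (a - b : ℝ)) - 1) := by
    rw [mul_sub, ← Complex.exp_add]; push_cast; ring_nf
  rw [h1, norm_mul, Complex.norm_exp_ofReal_mul_I, one_mul]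
  exact Real.norm_exp_I_mul_ofReal_sub_one_le

theorem gapMass_mono (G : ℂ[X]) (β : ℝ) (v : ℕ) {A B : Set ℂ} (h : A ⊆ B) :
    gapMass G β v A ≤ gapMass G β v B := lintegral_mono_set h

theorem gapMass_biUnion_le (G : ℂ[X]) (β : ℝ) (v : ℕ) {ι : Type*} (s : Finset ι)
    (A : ι → Set ℂ) :
    gapMass G β v (⋃ i ∈ s, A i) ≤ ∑ i ∈ s, gapMass G β v (A i) := by
  classical
  induction s using Finset.induction_on with
  | empty => simp [gapMass]
  | insert i s hi ih =>
    rw [Finset.set_biUnion_insert, Finset.sum_insert hi]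
    exact (lintegral_union_le _ _ _).trans (add_le_add le_rfl ih)

/-- Along a chain of overlapping discs around the origin the mass grows at most geometrically. -/
theorem gapMass_chain_le {G : ℂ[X]} {β : ℝ} {v : ℕ} {z₀ : ℂ} {η : ℝ} (hη : 0 < η)
    (hη1 : 2 * η ≤ 1) (hz₀ : z₀ ≠ 0) (hGz : G.eval z₀ ≠ 0)
    (h0 : ∀ z, (1 - 2 * η) * ‖z₀‖ ≤ ‖z‖ → ‖z‖ ≤ (1 + 2 * η) * ‖z₀‖ → G.eval z ≠ 0 →
      0 ≤ logGap G β v z) (j : ℕ) :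
    gapMass G β v (Metric.ball (z₀ * Complex.exp ((j * (η / 2) : ℝ) * Complex.I)) (η * ‖z₀‖)) ≤
      4 ^ j * ENNReal.ofReal (Real.pi * (η * ‖z₀‖) ^ 2 * logGap G β v z₀) := by
  have hP : 0 < ‖z₀‖ := norm_pos_iff.2 hz₀
  have hG : G ≠ 0 := by rintro rfl; simp at hGz
  have hball : ∀ c : ℂ, ‖c‖ = ‖z₀‖ → ∀ z ∈ Metric.ball c (2 * (η * ‖z₀‖)),
      G.eval z ≠ 0 → 0 ≤ logGap G β v z := by
    intro c hc z hz hGz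
    rw [Metric.mem_ball, dist_eq_norm] at hz
    have h1 := norm_sub_norm_le z c
    have h2 := norm_sub_norm_le c z
    rw [norm_sub_rev] at h2
    exact h0 z (by linarith) (by linarith) hGz
  have hnorm : ∀ θ : ℝ, ‖z₀ * Complex.exp (θ * Complex.I)‖ = ‖z₀‖ := by
    intro θ; rw [norm_mul, Complex.norm_exp_ofReal_mul_I, mul_one]
  induction j with
  | zero =>
    simp only [Nat.cast_zero, zero_mul, Complex.ofReal_zero, Complex.exp_zero, mul_one, pow_zero,
      one_mul]
    refine gapMass_ball_le (by positivity) ?_ hGz fun z hz => hball z₀ rfl z ?_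
    · nlinarith
    · exact Metric.ball_subset_ball (by nlinarith) hz
  | succ j ih =>
    have h1 := gapMass_ball_two_mul_le (v := v) (β := β) hG
      (c := z₀ * Complex.exp ((j * (η / 2) : ℝ) * Complex.I)) (r := η * ‖z₀‖) (by positivity)
      (by rw [hnorm]; nlinarith) (hball _ (hnorm _))
    -- Neighbouring centres are at most `η / 2 * ‖z₀‖` apart, so the next disc lies in the doubled
    -- current disc.
    refine (gapMass_mono G β v ?_).trans (h1.trans ?_)
    · refine Metric.ball_subset_ball' ?_
      rw [dist_eq_norm, ← mul_sub, norm_mul]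
      have h2 := norm_exp_I_sub_exp_I_le ((j + 1 : ℕ) * (η / 2)) (j * (η / 2))
      have h3 : |((j + 1 : ℕ) : ℝ) * (η / 2) - j * (η / 2)| = η / 2 := by
        push_cast; rw [abs_of_nonneg] <;> nlinarith
      rw [h3] at h2
      nlinarith
    · calc _ ≤ 4 * (4 ^ j * ENNReal.ofReal (Real.pi * (η * ‖z₀‖) ^ 2 * logGap G β v z₀)) := by
            gcongr
        _ = _ := by rw [pow_succ']; ring

/-- The centres are spaced by the angle `η / 2`. Rounding the argument in `[0, 2π)` down to the grid
and allowing radial deviation `η / 4` stays within `3η / 4 < η` of a centre. -/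
theorem annulus_subset_iUnion_ball {z₀ : ℂ} {η : ℝ} (hη : 0 < η) (hz₀ : z₀ ≠ 0) :
    {z : ℂ | ‖z - 0‖ ∈ Set.Ioo ((1 - η / 4) * ‖z₀‖) ((1 + η / 4) * ‖z₀‖)} ⊆
      ⋃ j ∈ Finset.range (⌊4 * Real.pi / η⌋₊ + 1),
        Metric.ball (z₀ * Complex.exp ((j * (η / 2) : ℝ) * Complex.I)) (η * ‖z₀‖) := by
  intro z hz
  have hP : 0 < ‖z₀‖ := norm_pos_iff.2 hz₀
  rw [Set.mem_ofPred_eq, sub_zero] at hz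
  obtain ⟨α, hα0, hα1, hα⟩ : ∃ α : ℝ, 0 ≤ α ∧ α < 2 * Real.pi ∧
      z = z₀ * ((‖z‖ / ‖z₀‖ : ℝ) * Complex.exp (α * Complex.I)) := by
    refine ⟨toIcoMod Real.two_pi_pos 0 (z / z₀).arg, (toIcoMod_mem_Ico' _ _).1,
      (toIcoMod_mem_Ico' _ _).2, ?_⟩
    have h1 : Complex.exp ((toIcoMod Real.two_pi_pos 0 (z / z₀).arg : ℝ) * Complex.I) =
        Complex.exp ((z / z₀).arg * Complex.I) := by
      rw [toIcoMod]
      push_cast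
      rw [sub_mul, Complex.exp_sub, show (toIcoDiv Real.two_pi_pos 0 (z / z₀).arg •
        (2 * (Real.pi : ℂ))) * Complex.I = (toIcoDiv Real.two_pi_pos 0 (z / z₀).arg) *
        (2 * Real.pi * Complex.I) by simp [mul_assoc], Complex.exp_int_mul_two_pi_mul_I, div_one]
    rw [h1, ← norm_div, Complex.norm_mul_exp_arg_mul_I, mul_div_cancel₀ _ hz₀]
  set j := ⌊α / (η / 2)⌋₊ with hj
  have hj1 : (j : ℝ) * (η / 2) ≤ α := by
    rw [← le_div_iff₀ (by linarith)]; exact Nat.floor_le (by positivity)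
  have hj2 : α < (j + 1) * (η / 2) := by
    rw [← div_lt_iff₀ (by linarith)]; exact Nat.lt_floor_add_one _
  refine Set.mem_iUnion₂.2 ⟨j, ?_, ?_⟩
  · rw [Finset.mem_range, Nat.lt_succ_iff]
    refine Nat.floor_le_floor ?_
    rw [div_le_div_iff₀ (by linarith) hη]
    nlinarith
  · rw [Metric.mem_ball, dist_eq_norm]
    have h1 : z - z₀ * Complex.exp ((j * (η / 2) : ℝ) * Complex.I) =
        z₀ * ((‖z‖ / ‖z₀‖ - 1 : ℝ) * Complex.exp (α * Complex.I)) +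
        z₀ * (Complex.exp (α * Complex.I) - Complex.exp ((j * (η / 2) : ℝ) * Complex.I)) := by
      conv_lhs => rw [hα]
      push_cast; ring
    rw [h1]
    refine (norm_add_le _ _).trans_lt ?_
    rw [norm_mul, norm_mul, norm_mul, Complex.norm_exp_ofReal_mul_I, mul_one, Complex.norm_real,
      ← mul_add, mul_comm]
    refine mul_lt_mul_of_pos_right ?_ hP
    have h2 := norm_exp_I_sub_exp_I_le α (j * (η / 2))
    rw [abs_of_nonneg (by linarith)] at h2
    have h3 : ‖‖z‖ / ‖z₀‖ - 1‖ < η / 4 := by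
      rw [Real.norm_eq_abs, abs_lt]
      constructor
      · have := (lt_div_iff₀ hP).2 hz.1; linarith
      · have := (div_lt_iff₀ hP).2 hz.2; linarith
    nlinarith

theorem gapMass_annulus_le {G : ℂ[X]} {β : ℝ} {v : ℕ} {z₀ : ℂ} {η : ℝ} (hη : 0 < η)
    (hη1 : 2 * η ≤ 1) (hz₀ : z₀ ≠ 0) (hGz : G.eval z₀ ≠ 0)
    (h0 : ∀ z, (1 - 2 * η) * ‖z₀‖ ≤ ‖z‖ → ‖z‖ ≤ (1 + 2 * η) * ‖z₀‖ → G.eval z ≠ 0 →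
      0 ≤ logGap G β v z) :
    gapMass G β v {z : ℂ | ‖z - 0‖ ∈ Set.Ioo ((1 - η / 4) * ‖z₀‖) ((1 + η / 4) * ‖z₀‖)} ≤
      4 ^ (⌊4 * Real.pi / η⌋₊ + 1) *
        ENNReal.ofReal (Real.pi * (η * ‖z₀‖) ^ 2 * logGap G β v z₀) := by
  set N := ⌊4 * Real.pi / η⌋₊ + 1 with hN
  set M := ENNReal.ofReal (Real.pi * (η * ‖z₀‖) ^ 2 * logGap G β v z₀) with hM
  calc _ ≤ gapMass G β v (⋃ j ∈ Finset.range N,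
        Metric.ball (z₀ * Complex.exp ((j * (η / 2) : ℝ) * Complex.I)) (η * ‖z₀‖)) :=
        gapMass_mono G β v (annulus_subset_iUnion_ball hη hz₀)
    _ ≤ ∑ j ∈ Finset.range N, gapMass G β v
        (Metric.ball (z₀ * Complex.exp ((j * (η / 2) : ℝ) * Complex.I)) (η * ‖z₀‖)) := by
        exact gapMass_biUnion_le G β v _ _
    _ ≤ ∑ j ∈ Finset.range N, 4 ^ j * M :=
        Finset.sum_le_sum fun j _ => gapMass_chain_le hη hη1 hz₀ hGz h0 j
    _ ≤ 4 ^ N * M := by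
        rw [← Finset.sum_mul]
        gcongr
        have : ∀ m : ℕ, ∑ j ∈ Finset.range m, (4 : ENNReal) ^ j ≤ 4 ^ m := by
          intro m
          induction m with
          | zero => simp
          | succ m ih =>
            rw [Finset.sum_range_succ, pow_succ]
            calc _ ≤ (4 : ENNReal) ^ m + 4 ^ m := by gcongr
              _ = 4 ^ m * 2 := by ring
              _ ≤ _ := by gcongr; norm_num
        exact this N

theorem le_gapMass_annulus {G : ℂ[X]} (hG : G ≠ 0) {β : ℝ} {v : ℕ} {a b L : ℝ} (ha : 0 < a)
    (hab : a ≤ b) (hL : 0 ≤ L)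
    (h0 : ∀ z, a < ‖z‖ → ‖z‖ < b → G.eval z ≠ 0 → 0 ≤ logGap G β v z)
    (h1 : ∀ ρ, a < ρ → ρ < b → L ≤ β + v * Real.log ρ - logPotential G 0 ρ) :
    ENNReal.ofReal ((b ^ 2 - a ^ 2) / 2 * (2 * Real.pi * L)) ≤
      gapMass G β v {z : ℂ | ‖z - 0‖ ∈ Set.Ioo a b} := by
  rw [gapMass_eq hG β v 0 measurableSet_Ioo (fun z hz => by
    rw [sub_zero] at hz; exact h0 z hz.1 hz.2), ← setLIntegral_ofReal_const_mul ha.le hab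
    (by positivity)]
  have hs : Set.Ioi 0 ∩ Set.Ioo a b = Set.Ioo a b :=
    Set.inter_eq_right.2 fun ρ hρ => ha.trans hρ.1
  rw [hs]
  refine setLIntegral_mono' measurableSet_Ioo fun ρ hρ => ENNReal.ofReal_le_ofReal ?_
  have hρ0 := ha.trans hρ.1
  rw [norm_zero, max_eq_left hρ0.le]
  have := h1 ρ hρ.1 hρ.2
  gcongr

/-- If one term dominates on an annulus of logarithmic width `2 * h`, then the radial mean is
somewhere in this annulus not much smaller than the logarithm of that term. -/
theorem IsDominant.exists_le_radialMean {G : ℂ[X]} {v : ℕ} {p h : ℝ} (h0 : 0 < h) (h1 : h ≤ 1)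
    (h₁ : IsDominant G v (p - h)) (h₂ : IsDominant G v (p + h)) :
    ∃ t, p - h ≤ t ∧ t ≤ p + h ∧
      Real.log ‖G.coeff v‖ + v * t ≤ radialMean G t + Real.exp (300 / h) := by
  by_contra! hcon
  have hG : G ≠ 0 := by rintro rfl; exact h₁.1 (by simp)
  have hA : 0 < ‖G.coeff v‖ := norm_pos_iff.2 h₁.1
  obtain ⟨z₀, hz₀, hmax⟩ := exists_norm_eval_ge G v p
  have hP : 0 < ‖z₀‖ := by rw [hz₀]; exact Real.exp_pos p
  have hGz : G.eval z₀ ≠ 0 := norm_pos_iff.1 (lt_of_lt_of_le (by positivity) hmax)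
  -- By `norm_eval_le_of_gap` this constant makes `logGap` nonnegative off the roots near the middle
  -- circle, while `logGap` at `z₀` is at most `log (8 / h)`.
  set β := Real.log ‖G.coeff v‖ + Real.log (8 / h) with hβ
  have h8 : 0 ≤ Real.log (8 / h) := Real.log_nonneg (by rw [le_div_iff₀ h0]; linarith)
  have hlog : ∀ ρ : ℝ, (1 - h / 4) * ‖z₀‖ ≤ ρ → ρ ≤ (1 + h / 4) * ‖z₀‖ →
      0 < ρ ∧ p - h / 2 ≤ Real.log ρ ∧ Real.log ρ ≤ p + h / 2 := by
    intro ρ hl hu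
    have hρ : 0 < ρ := lt_of_lt_of_le (mul_pos (by linarith) hP) hl
    refine ⟨hρ, ?_, ?_⟩
    · rw [Real.le_log_iff_exp_le hρ, sub_eq_add_neg, Real.exp_add, ← hz₀, mul_comm]
      refine le_trans (mul_le_mul_of_nonneg_right ?_ hP.le) hl
      have := exp_neg_le_one_sub_half (x := h / 2) (by linarith) (by linarith)
      linarith
    · rw [Real.log_le_iff_le_exp hρ, Real.exp_add, ← hz₀, mul_comm]
      refine hu.trans (mul_le_mul_of_nonneg_right ?_ hP.le)
      linarith [Real.add_one_le_exp (h / 2)]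
  have hnn : ∀ z, (1 - h / 4) * ‖z₀‖ ≤ ‖z‖ → ‖z‖ ≤ (1 + h / 4) * ‖z₀‖ → G.eval z ≠ 0 →
      0 ≤ logGap G β v z := by
    intro z hl hu hGz
    obtain ⟨hz, h3, h4⟩ := hlog ‖z‖ hl hu
    have h5 := h₁.norm_eval_le_of_gap h0 h1 h₂ (τ := Real.log ‖z‖) (by linarith) (by linarith)
      (Real.exp_log hz).symm
    have h6 := Real.log_le_log (norm_pos_iff.2 hGz) h5
    rw [Real.log_mul (by positivity) (by positivity), Real.log_mul hA.ne' (Real.exp_pos _).ne',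
      Real.log_exp] at h6
    unfold logGap
    linarith
  -- The doubled discs stay where `logGap` is known to be nonnegative. If the claim failed on the
  -- whole annulus, the area integral would be at least a multiple of `exp (300 / h)`; the chain of
  -- discs bounds it by `4 ^ N / 2` times the same multiple.
  set η := h / 16 with hη
  have hηpos : 0 < η := by positivity
  have hup := gapMass_annulus_le (β := β) (v := v) hηpos (by linarith) (norm_pos_iff.1 hP) hGz
    (fun z hl hu => hnn z (le_trans (by gcongr; linarith) hl) (hu.trans (by gcongr; linarith)))
  have hlow := le_gapMass_annulus hG (β := β) (v := v) (a := (1 - η / 4) * ‖z₀‖)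
    (b := (1 + η / 4) * ‖z₀‖) (L := Real.exp (300 / h)) (by apply mul_pos _ hP; linarith)
    (by gcongr; linarith) (Real.exp_pos _).le
    (fun z hl hu => hnn z (le_trans (by gcongr; linarith) hl.le)
      (hu.le.trans (by gcongr; linarith)))
    (fun ρ hl hu => by
      obtain ⟨hρ, h3, h4⟩ := hlog ρ (le_trans (by gcongr; linarith) hl.le)
        (hu.le.trans (by gcongr; linarith))
      have h5 := hcon (Real.log ρ) (by linarith) (by linarith)
      rw [radialMean, Real.exp_log hρ] at h5
      linarith)
  have hs0 : logGap G β v z₀ ≤ 8 / h := by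
    have h6 := Real.log_le_log (by positivity) hmax
    rw [Real.log_mul hA.ne' (Real.exp_pos _).ne', Real.log_exp] at h6
    have h7 := Real.log_le_self (by positivity : 0 ≤ 8 / h)
    unfold logGap
    rw [hz₀, Real.log_exp]
    linarith
  have hfin := hlow.trans hup
  set N := ⌊4 * Real.pi / η⌋₊ + 1 with hN
  have h4N : (4 : ENNReal) ^ N = ENNReal.ofReal (4 ^ N) := by
    rw [ENNReal.ofReal_pow (by norm_num)]; norm_num
  have hs0' : 0 ≤ logGap G β v z₀ :=
    hnn z₀ (by nlinarith) (by nlinarith) hGz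
  rw [h4N, ← ENNReal.ofReal_mul (by positivity), ENNReal.ofReal_le_ofReal_iff (by positivity)]
    at hfin
  -- The chain has `N ≤ 64π / h + 1 ≤ 203 / h` discs and `log 4 < 7 / 5`, so the exponent is below
  -- `285 / h`. This fixes the constant `300`.
  have h9 : (4 : ℝ) ^ N < Real.exp (300 / h) := by
    have hNle : (N : ℝ) ≤ 203 / h := by
      have h10 : (⌊4 * Real.pi / η⌋₊ : ℝ) ≤ 4 * Real.pi / η := Nat.floor_le (by positivity)
      have h11 : 4 * Real.pi / η = 64 * Real.pi / h := by rw [hη]; field_simp; ring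
      have h12 : 64 * Real.pi / h + 1 ≤ 203 / h := by
        rw [← le_sub_iff_add_le, div_le_iff₀ h0, sub_mul, div_mul_cancel₀ _ h0.ne']
        nlinarith [Real.pi_lt_d2]
      rw [hN]; push_cast; linarith
    have h13 : (4 : ℝ) < Real.exp (7 / 5) := by
      have e1 : Real.log 4 < 7 / 5 := by
        rw [show (4 : ℝ) = 2 ^ 2 by norm_num, Real.log_pow]
        push_cast; linarith [Real.log_two_lt_d9]
      rwa [Real.log_lt_iff_lt_exp (by norm_num)] at e1
    calc (4 : ℝ) ^ N ≤ Real.exp (7 / 5) ^ N := by gcongr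
      _ = Real.exp (N * (7 / 5)) := by rw [← Real.exp_nat_mul]
      _ < _ := by
        apply Real.exp_lt_exp.2
        calc (N : ℝ) * (7 / 5) ≤ 203 / h * (7 / 5) := by gcongr
          _ < 300 / h := by rw [div_mul_eq_mul_div]; gcongr; norm_num
  have h14 : Real.pi * (η * ‖z₀‖) ^ 2 * logGap G β v z₀ ≤ Real.pi * (η * ‖z₀‖) ^ 2 * (8 / h) := by
    gcongr
  have h15 : (((1 + η / 4) * ‖z₀‖) ^ 2 - ((1 - η / 4) * ‖z₀‖) ^ 2) / 2 *
      (2 * Real.pi * Real.exp (300 / h)) = Real.pi * η * ‖z₀‖ ^ 2 * Real.exp (300 / h) := by ring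
  have h16 : Real.pi * (η * ‖z₀‖) ^ 2 * (8 / h) = Real.pi * η * ‖z₀‖ ^ 2 * (1 / 2) := by
    rw [hη]; field_simp; ring
  rw [h15] at hfin
  rw [h16] at h14
  have h17 : Real.pi * η * ‖z₀‖ ^ 2 * Real.exp (300 / h) ≤
      Real.pi * η * ‖z₀‖ ^ 2 * (4 ^ N * (1 / 2)) := by
    refine hfin.trans ?_
    calc _ ≤ 4 ^ N * (Real.pi * η * ‖z₀‖ ^ 2 * (1 / 2)) := by gcongr
      _ = _ := by ring
  have h18 := le_of_mul_le_mul_left h17 (by positivity)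
  have h19 : (0 : ℝ) < 4 ^ N := by positivity
  linarith

/-! ### The maximal term and the radial mean -/

/-- `V t ∈ S` is the index of a term of `G` of maximal modulus on the circle of radius `exp t`. -/
structure IsMaxTermIndex (G : ℂ[X]) (n : ℕ) (S : Finset ℕ) (V : ℝ → ℕ) : Prop where
  natDegree_le : G.natDegree ≤ n
  mem : ∀ t, V t ∈ S
  isDominant : ∀ t, IsDominant G (V t) t

/-- The logarithm of the maximal term of `G` on the circle of radius `exp t`. -/
noncomputable def logMaxTerm (G : ℂ[X]) (V : ℝ → ℕ) (t : ℝ) : ℝ :=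
  Real.log ‖G.coeff (V t)‖ + V t * t

theorem IsDominant.log_add_le {G : ℂ[X]} {v k : ℕ} {t : ℝ} (hv : IsDominant G v t)
    (hk : G.coeff k ≠ 0) :
    Real.log ‖G.coeff k‖ + k * t ≤ Real.log ‖G.coeff v‖ + v * t := by
  have a1 : 0 < ‖G.coeff k‖ := norm_pos_iff.2 hk
  have a2 : 0 < ‖G.coeff v‖ := norm_pos_iff.2 hv.1
  have e1 := Real.log_le_log (by positivity) (hv.2 k)
  rwa [Real.log_mul a1.ne' (Real.exp_pos _).ne', Real.log_mul a2.ne' (Real.exp_pos _).ne',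
    Real.log_exp, Real.log_exp] at e1

namespace IsMaxTermIndex

variable {G : ℂ[X]} {n : ℕ} {S : Finset ℕ} {V : ℝ → ℕ}

theorem ne_zero (hV : IsMaxTermIndex G n S V) : G ≠ 0 := by
  rintro rfl; exact (hV.isDominant 0).1 (by simp)

theorem le (hV : IsMaxTermIndex G n S V) (t : ℝ) : V t ≤ n :=
  (le_natDegree_of_ne_zero (hV.isDominant t).1).trans hV.natDegree_le

theorem mono (hV : IsMaxTermIndex G n S V) : Monotone V := by
  intro t s h
  rcases h.eq_or_lt with rfl | h
  · exact le_rfl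
  · exact (hV.isDominant t).index_le (hV.isDominant s) h

/-- As a maximum of affine functions, `logMaxTerm` is convex and lies above its supporting line of
slope `V t`. -/
theorem logMaxTerm_add_le (hV : IsMaxTermIndex G n S V) (t s : ℝ) :
    logMaxTerm G V t + V t * (s - t) ≤ logMaxTerm G V s := by
  have := (hV.isDominant s).log_add_le (hV.isDominant t).1
  unfold logMaxTerm
  linarith

theorem logMaxTerm_eq (hV : IsMaxTermIndex G n S V) {v : ℕ} {t : ℝ} (hv : IsDominant G v t) :
    logMaxTerm G V t = Real.log ‖G.coeff v‖ + v * t :=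
  le_antisymm (hv.log_add_le (hV.isDominant t).1) ((hV.isDominant t).log_add_le hv.1)

theorem log_norm_eval_le (hV : IsMaxTermIndex G n S V) {z : ℂ} (hz : z ≠ 0)
    (hGz : G.eval z ≠ 0) :
    Real.log ‖G.eval z‖ ≤ Real.log (n + 1) + logMaxTerm G V (Real.log ‖z‖) := by
  have hz' : 0 < ‖z‖ := norm_pos_iff.2 hz
  have hd := hV.isDominant (Real.log ‖z‖)
  have h1 := hd.norm_eval_le hV.natDegree_le (Real.exp_log hz').symm
  have h2 := Real.log_le_log (norm_pos_iff.2 hGz) h1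
  have hA : 0 < ‖G.coeff (V (Real.log ‖z‖))‖ := norm_pos_iff.2 hd.1
  rwa [Real.log_mul (by positivity) (by positivity), Real.log_mul hA.ne' (Real.exp_pos _).ne',
    Real.log_exp] at h2

theorem radialMean_le (hV : IsMaxTermIndex G n S V) (t : ℝ) :
    radialMean G t ≤ Real.log (n + 1) + logMaxTerm G V t := by
  have h := logPotential_le hV.ne_zero (β := Real.log (n + 1) + logMaxTerm G V t) (v := 0)
    (c := 0) (Real.exp_pos t) (fun z hz hGz => by
      rw [sub_zero] at hz
      have hz0 : z ≠ 0 := norm_pos_iff.1 (by rw [hz]; exact Real.exp_pos t)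
      have h1 := hV.log_norm_eval_le hz0 hGz
      rw [hz, Real.log_exp] at h1
      unfold logGap
      push_cast; linarith)
  simpa [radialMean] using h

theorem exists_gap_le (hV : IsMaxTermIndex G n S V) {t h : ℝ} (h0 : 0 < h) (h1 : h ≤ 1)
    {v : ℕ} (hv : IsDominant G v t) (hv' : IsDominant G v (t + h)) :
    ∃ p, t ≤ p ∧ p ≤ t + h ∧ IsDominant G v p ∧
      logMaxTerm G V p ≤ radialMean G p + Real.exp (600 / h) := by
  obtain ⟨p, hp1, hp2, hp⟩ := IsDominant.exists_le_radialMean (G := G) (v := v) (p := t + h / 2)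
    (h := h / 2) (by linarith) (by linarith) (by simpa using hv)
    (by rw [add_assoc, add_halves]; exact hv')
  have hd := hv.of_le_of_le hv' (τ := p) (by linarith) (by linarith)
  refine ⟨p, by linarith, by linarith, hd, ?_⟩
  rw [hV.logMaxTerm_eq hd]
  have e : 300 / (h / 2) = 600 / h := by field_simp; norm_num
  rwa [e] at hp

/-- Move left in steps of length `h` until the index survives a whole step; `exists_gap_le` applies
there, and monotonicity of `radialMean` carries the bound back. A step from `t` loses at most `h * V
t`, and each change of index uses up an element of `S`. -/
theorem logMaxTerm_le_left (hV : IsMaxTermIndex G n S V) {h : ℝ} (h0 : 0 < h) (h1 : h ≤ 1)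
    (t : ℝ) :
    logMaxTerm G V t ≤ radialMean G t + Real.exp (600 / h) +
      h * ∑ w ∈ S.filter (· ≤ V t), (w : ℝ) := by
  induction hm : V t using Nat.strong_induction_on generalizing t with
  | _ m ih =>
    subst hm
    have hmem : V t ∈ S.filter (· ≤ V t) := Finset.mem_filter.2 ⟨hV.mem t, le_rfl⟩
    by_cases hd : IsDominant G (V t) (t - h)
    · obtain ⟨p, hp1, hp2, hp, hle⟩ := hV.exists_gap_le h0 h1 hd
        (by rw [sub_add_cancel]; exact hV.isDominant t)
      rw [hV.logMaxTerm_eq hp] at hle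
      have h2 := radialMean_mono G (show p ≤ t by linarith)
      have h3 : (V t : ℝ) ≤ ∑ w ∈ S.filter (· ≤ V t), (w : ℝ) :=
        Finset.single_le_sum (f := fun w : ℕ => (w : ℝ)) (fun _ _ => Nat.cast_nonneg _) hmem
      have h4 : (V t : ℝ) * (t - p) ≤ V t * h := by gcongr; linarith
      have h5 := mul_le_mul_of_nonneg_left h3 h0.le
      unfold logMaxTerm
      linarith
    · have hlt : V (t - h) < V t := by
        refine lt_of_le_of_ne (hV.mono (by linarith)) fun he => hd ?_
        rw [← he]; exact hV.isDominant _
      have h2 := ih _ hlt (t - h) rfl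
      have h3 := hV.logMaxTerm_add_le t (t - h)
      have h4 := radialMean_mono G (show t - h ≤ t by linarith)
      have h5 : (∑ w ∈ S.filter (· ≤ V (t - h)), (w : ℝ)) + V t ≤
          ∑ w ∈ S.filter (· ≤ V t), (w : ℝ) := by
        rw [← Finset.sum_erase_add _ _ hmem]
        gcongr
        intro w hw
        rw [Finset.mem_filter] at hw
        exact Finset.mem_erase.2 ⟨(lt_of_le_of_lt hw.2 hlt).ne,
          Finset.mem_filter.2 ⟨hw.1, hw.2.trans hlt.le⟩⟩
      have h6 := mul_le_mul_of_nonneg_left h5 h0.le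
      linarith

/-- Mirror image of `logMaxTerm_le_left`: to the right `radialMean` grows at rate at most `n` and
`logMaxTerm` at rate at least `V t`, so a step costs at most `h * (n - V t)`. -/
theorem logMaxTerm_le_right (hV : IsMaxTermIndex G n S V) {h : ℝ} (h0 : 0 < h) (h1 : h ≤ 1)
    (hS : ∀ w ∈ S, w ≤ n) (t : ℝ) :
    logMaxTerm G V t ≤ radialMean G t + Real.exp (600 / h) +
      h * ∑ w ∈ S.filter (V t ≤ ·), ((n : ℝ) - w) := by
  induction hm : n - V t using Nat.strong_induction_on generalizing t with
  | _ m ih =>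
    subst hm
    have hmem : V t ∈ S.filter (V t ≤ ·) := Finset.mem_filter.2 ⟨hV.mem t, le_rfl⟩
    have hnn : ∀ w ∈ S, (0 : ℝ) ≤ (n : ℝ) - w := fun w hw => by
      have : (w : ℝ) ≤ n := by exact_mod_cast hS w hw
      linarith
    by_cases hd : IsDominant G (V t) (t + h)
    · obtain ⟨p, hp1, hp2, hp, hle⟩ := hV.exists_gap_le h0 h1 (hV.isDominant t) hd
      rw [hV.logMaxTerm_eq hp] at hle
      have h2 := radialMean_le_add G hV.natDegree_le (show t ≤ p by linarith)
      have h3 : ((n : ℝ) - V t) ≤ ∑ w ∈ S.filter (V t ≤ ·), ((n : ℝ) - w) :=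
        Finset.single_le_sum (f := fun w : ℕ => ((n : ℝ) - w))
          (fun w hw => hnn w (Finset.mem_filter.1 hw).1) hmem
      have h4 : ((n : ℝ) - V t) * (p - t) ≤ (n - V t) * h :=
        mul_le_mul_of_nonneg_left (by linarith) (hnn _ (hV.mem t))
      have h5 := mul_le_mul_of_nonneg_left h3 h0.le
      unfold logMaxTerm
      linarith
    · have hlt : V t < V (t + h) := by
        refine lt_of_le_of_ne (hV.mono (by linarith)) fun he => hd ?_
        rw [he]; exact hV.isDominant _
      have h2 := ih _ (by have := hV.le (t + h); omega) (t + h) rfl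
      have h3 := hV.logMaxTerm_add_le t (t + h)
      have h4 := radialMean_le_add G hV.natDegree_le (show t ≤ t + h by linarith)
      have h5 : (∑ w ∈ S.filter (V (t + h) ≤ ·), ((n : ℝ) - w)) + ((n : ℝ) - V t) ≤
          ∑ w ∈ S.filter (V t ≤ ·), ((n : ℝ) - w) := by
        rw [← Finset.sum_erase_add _ _ hmem]
        gcongr ?_ + _
        refine Finset.sum_le_sum_of_subset_of_nonneg ?_ fun w hw _ =>
          hnn w (Finset.mem_filter.1 (Finset.mem_erase.1 hw).2).1
        intro w hw
        rw [Finset.mem_filter] at hw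
        exact Finset.mem_erase.2 ⟨(lt_of_lt_of_le hlt hw.2).ne',
          Finset.mem_filter.2 ⟨hw.1, hlt.le.trans hw.2⟩⟩
      have h6 := mul_le_mul_of_nonneg_left h5 h0.le
      linarith

end IsMaxTermIndex

/-- The elements of `S` at distance more than `D` from both ends of `[0, n]`. -/
def midIndices (S : Finset ℕ) (n D : ℕ) : Finset ℕ := S.filter fun w => D < w ∧ w + D < n

theorem sum_le_card_mul_add_card_mul {T S : Finset ℕ} {f : ℕ → ℝ} {n D : ℕ} (hTS : T ⊆ S)
    (h : ∀ w ∈ T, f w ≤ n ∧ (w ∉ midIndices S n D → f w ≤ D)) :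
    ∑ w ∈ T, f w ≤ S.card * D + (midIndices S n D).card * n := by
  have h1 : ∑ w ∈ T, f w ≤ ∑ w ∈ S, ((D : ℝ) + if w ∈ midIndices S n D then (n : ℝ) else 0) := by
    refine (Finset.sum_le_sum (g := fun w => (D : ℝ) + if w ∈ midIndices S n D then (n : ℝ) else 0)
      fun w hw => ?_).trans
      (Finset.sum_le_sum_of_subset_of_nonneg hTS fun _ _ _ => by positivity)
    obtain ⟨ha, hb⟩ := h w hw
    have hD : (0 : ℝ) ≤ D := Nat.cast_nonneg _
    split_ifs with hm
    · linarith
    · simpa using hb hm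
  refine h1.trans (le_of_eq ?_)
  have hf : S.filter (· ∈ midIndices S n D) = midIndices S n D := by
    ext w
    simp only [midIndices, Finset.mem_filter]
    tauto
  rw [Finset.sum_add_distrib, Finset.sum_const, nsmul_eq_mul, ← Finset.sum_filter, hf,
    Finset.sum_const, nsmul_eq_mul]

/-- Move towards the nearer end of `[0, n]`: left if `V t ≤ n / 2`, right otherwise. An index met on
the way then costs at most `h * D` unless it is a middle one, which costs at most `h * n`. -/
theorem IsMaxTermIndex.logMaxTerm_le {G : ℂ[X]} {n : ℕ} {S : Finset ℕ} {V : ℝ → ℕ}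
    (hV : IsMaxTermIndex G n S V) {h : ℝ} (h0 : 0 < h) (h1 : h ≤ 1)
    (hS : ∀ w ∈ S, w ≤ n) (D : ℕ) (t : ℝ) :
    logMaxTerm G V t ≤ radialMean G t + (Real.exp (600 / h) +
      h * (S.card * D + (midIndices S n D).card * n)) := by
  have hcast : ∀ w ∈ S, (w : ℝ) ≤ n := fun w hw => by exact_mod_cast hS w hw
  rcases le_total (2 * V t) n with hc | hc
  · refine (hV.logMaxTerm_le_left h0 h1 t).trans ?_
    rw [← add_assoc]
    gcongr
    refine sum_le_card_mul_add_card_mul (Finset.filter_subset _ _) fun w hw => ?_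
    obtain ⟨hwS, hwV⟩ := Finset.mem_filter.1 hw
    refine ⟨hcast w hwS, fun hm => ?_⟩
    by_contra! hD
    have hD' : D < w := by exact_mod_cast hD
    exact hm (Finset.mem_filter.2 ⟨hwS, hD', by omega⟩)
  · refine (hV.logMaxTerm_le_right h0 h1 hS t).trans ?_
    rw [← add_assoc]
    gcongr
    refine sum_le_card_mul_add_card_mul (Finset.filter_subset _ _) fun w hw => ?_
    obtain ⟨hwS, hwV⟩ := Finset.mem_filter.1 hw
    refine ⟨by linarith [(Nat.cast_nonneg w : (0 : ℝ) ≤ w)], fun hm => ?_⟩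
    by_contra! hD
    have hD' : w + D < n := by
      have : (w : ℝ) + D < n := by linarith
      exact_mod_cast this
    exact hm (Finset.mem_filter.2 ⟨hwS, by omega, hD'⟩)

/-- If the maximal term takes few values on an interval, then at some point of the interval
the radial mean is not much smaller than the maximal term. -/
theorem IsMaxTermIndex.exists_logMaxTerm_le {G : ℂ[X]} {n : ℕ} {S T : Finset ℕ} {V : ℝ → ℕ}
    (hV : IsMaxTermIndex G n S V) {a γ : ℝ} (h0 : 0 < γ) (h1 : γ ≤ 1)
    (hT : ∀ t, a ≤ t → t ≤ a + γ → V t ∈ T) :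
    ∃ p, a ≤ p ∧ p ≤ a + γ ∧
      logMaxTerm G V p ≤ radialMean G p + Real.exp (600 * (T.card + 1) / γ) := by
  set K := T.card with hK
  set h : ℝ := γ / (K + 1) with hh
  have hKpos : (0 : ℝ) < K + 1 := by positivity
  have hpos : 0 < h := by positivity
  have hγ : (K + 1) * h = γ := by rw [hh]; field_simp
  have hpt : ∀ i : ℕ, i ≤ K + 1 → a ≤ a + i * h ∧ a + i * h ≤ a + γ := by
    intro i hi
    have hi' : (i : ℝ) ≤ K + 1 := by exact_mod_cast hi
    exact ⟨by linarith [mul_nonneg (Nat.cast_nonneg i : (0 : ℝ) ≤ i) hpos.le], by nlinarith⟩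
  -- Pigeonhole: `K + 1` grid points, at most `K` indices. Between two points with the same index
  -- that term stays dominant, for a length of at least `h`.
  obtain ⟨i, hi, j, hj, hne, he⟩ : ∃ i ∈ Finset.range (K + 1), ∃ j ∈ Finset.range (K + 1),
      i ≠ j ∧ V (a + i * h) = V (a + j * h) := by
    refine Finset.exists_ne_map_eq_of_card_lt_of_maps_to (t := T) (by simp [hK])
      (f := fun i : ℕ => V (a + i * h)) fun i hi => ?_
    have := hpt i (Finset.mem_range.1 (Finset.mem_coe.1 hi)).le
    exact hT _ this.1 this.2
  wlog hij : i < j generalizing i j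
  · exact this j hj i hi hne.symm he.symm (lt_of_le_of_ne (not_lt.1 hij) hne.symm)
  have hstep : a + (i : ℝ) * h + h ≤ a + j * h := by
    have : (i : ℝ) + 1 ≤ j := by exact_mod_cast hij
    nlinarith
  have hd2 : IsDominant G (V (a + i * h)) (a + i * h + h) := by
    refine (hV.isDominant _).of_le_of_le (t₂ := a + j * h) ?_ (by linarith) hstep
    rw [he]; exact hV.isDominant _
  have hh1 : h ≤ 1 := by
    rw [hh, div_le_one hKpos]
    linarith [(Nat.cast_nonneg K : (0 : ℝ) ≤ K)]
  obtain ⟨p, hp1, hp2, -, hp⟩ := hV.exists_gap_le hpos hh1 (hV.isDominant _) hd2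
  have hj' := hpt j (Finset.mem_range.1 hj).le
  have hi' := hpt i (Finset.mem_range.1 hi).le
  refine ⟨p, by linarith, by linarith, hp.trans_eq ?_⟩
  rw [hh]; congr 2; field_simp

/-! ### Counting positive roots -/

/-- On a circle, most points near the positive real axis are not too close to the roots. -/
theorem exists_eval_ge_near_positive {G : ℂ[X]} {n : ℕ} {S : Finset ℕ} {V : ℝ → ℕ}
    (hV : IsMaxTermIndex G n S V) {p γ B : ℝ} (hγ : 0 < γ) (hγ1 : γ ≤ 1) (hB : 0 < B)
    (hp : logMaxTerm G V p ≤ radialMean G p + B) :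
    ∃ θ : ℝ, |θ| < γ ∧ G.eval (circleMap 0 (Real.exp p) θ) ≠ 0 ∧
      Real.log (n + 1) + logMaxTerm G V p - 4 / γ * (B + Real.log (n + 1)) ≤
        Real.log ‖G.eval (circleMap 0 (Real.exp p) θ)‖ := by
  by_contra! hcon
  set L := Real.log (n + 1) with hL
  have hL0 : 0 ≤ L := Real.log_nonneg (by linarith [(Nat.cast_nonneg n : (0 : ℝ) ≤ n)])
  -- Chebyshev: `logGap` is nonnegative on the circle off the roots, with mean at most `B + L`.
  -- Exceeding `X` on an arc of length `2 * γ` would give it integral at least `8 * (B + L)`, more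
  -- than `2π * (B + L)`.
  set X := 4 / γ * (B + L) with hX
  set β := L + logMaxTerm G V p with hβ
  have hnn : ∀ z : ℂ, ‖z‖ = Real.exp p → G.eval z ≠ 0 → 0 ≤ logGap G β 0 z := by
    intro z hz hGz
    have hz0 : z ≠ 0 := norm_pos_iff.1 (by rw [hz]; exact Real.exp_pos p)
    have h1 := hV.log_norm_eval_le hz0 hGz
    rw [hz, Real.log_exp] at h1
    unfold logGap
    push_cast; linarith
  have hnorm : ∀ θ : ℝ, ‖circleMap 0 (Real.exp p) θ‖ = Real.exp p := by
    intro θ; simp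
  have hnz := ae_eval_circleMap_ne_zero hV.ne_zero 0 (Real.exp_pos p)
  have h1 := setLIntegral_circle_eq (circleIntegrable_logGap G β 0 0 (Real.exp p)) (by
    filter_upwards [hnz] with θ hθ using hnn _ (hnorm θ) hθ)
  rw [circleAverage_logGap hV.ne_zero β 0 0 (Real.exp_pos p)] at h1
  have hsub : Set.Ioo (-γ) γ ⊆ Set.Ioo (-Real.pi) Real.pi :=
    Set.Ioo_subset_Ioo (by linarith [Real.pi_gt_three]) (by linarith [Real.pi_gt_three])
  have h2 : ∫⁻ θ in Set.Ioo (-γ) γ, ENNReal.ofReal X ≤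
      ∫⁻ θ in Set.Ioo (-γ) γ, ENNReal.ofReal (logGap G β 0 (circleMap 0 (Real.exp p) θ)) := by
    refine lintegral_mono_ae ((ae_restrict_iff' measurableSet_Ioo).2 ?_)
    filter_upwards [hnz] with θ hθ hmem
    refine ENNReal.ofReal_le_ofReal ?_
    have h3 := hcon θ (abs_lt.2 hmem) hθ
    unfold logGap
    push_cast; linarith
  have h3 := (h2.trans (lintegral_mono_set hsub)).trans_eq h1
  rw [setLIntegral_const, Real.volume_Ioo, ← ENNReal.ofReal_mul (by positivity),
    ENNReal.ofReal_le_ofReal_iff'] at h3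
  have h4 : X * (γ - -γ) = 8 * (B + L) := by rw [hX]; field_simp; ring
  have h5 : β + ((0 : ℕ) : ℝ) * Real.log (max (Real.exp p) ‖(0 : ℂ)‖) -
      logPotential G 0 (Real.exp p) ≤ B + L := by
    unfold radialMean at hp
    push_cast; linarith
  rw [h4] at h3
  rcases h3 with h3 | h3
  · have h6 : 2 * Real.pi * (β + ((0 : ℕ) : ℝ) * Real.log (max (Real.exp p) ‖(0 : ℂ)‖) -
      logPotential G 0 (Real.exp p)) ≤ 2 * Real.pi * (B + L) := by gcongr
    nlinarith [Real.pi_lt_d2]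
  · linarith

open Classical in
/-- The number of positive roots on a short logarithmic interval. -/
theorem countP_near_le {G : ℂ[X]} {n : ℕ} {S : Finset ℕ} {V : ℝ → ℕ}
    (hV : IsMaxTermIndex G n S V) {p γ B : ℝ} (hγ : 0 < γ) (hγ1 : γ ≤ 1 / 24) (hB : 0 < B)
    (hp : logMaxTerm G V p ≤ radialMean G p + B) :
    (G.roots.countP (fun ζ => ∃ τ : ℝ, |τ - p| ≤ γ ∧ ζ = (Real.exp τ : ℂ)) : ℝ) ≤
      16 * γ * ((V (p + 8 * γ) : ℝ) - V (p - 8 * γ)) + 8 / γ * (B + Real.log (n + 1)) := by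
  obtain ⟨θ, hθ, hGc, hc⟩ := exists_eval_ge_near_positive hV hγ (by linarith) hB hp
  set L := Real.log (n + 1) with hL
  set c := circleMap 0 (Real.exp p) θ with hcdef
  have hcn : ‖c‖ = Real.exp p := by simp [hcdef]
  have hep := Real.exp_pos p
  -- The angle `θ` accounts for `γ` and the radial deviation of `exp τ` for `2 * γ`, so the disc
  -- about `c` catches every positive root counted. On the circle of radius `2 * r` the logarithmic
  -- modulus stays within `8 * γ` of `p`.
  set r := 3 * γ * Real.exp p with hr
  have hrpos : 0 < r := by positivity
  set inc : ℝ := (V (p + 8 * γ) : ℝ) - V (p - 8 * γ) with hinc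
  have h1 : (G.roots.countP (fun ζ => ∃ τ : ℝ, |τ - p| ≤ γ ∧ ζ = (Real.exp τ : ℂ)) : ℝ) ≤
      G.roots.countP (fun ζ => ‖c - ζ‖ ≤ r) := by
    rw [Multiset.countP_eq_card_filter, Multiset.countP_eq_card_filter]
    refine Nat.cast_le.2 (Multiset.card_le_card (Multiset.monotone_filter_right _ ?_))
    rintro ζ ⟨τ, hτ, rfl⟩
    have h2 : c - (Real.exp τ : ℂ) = Real.exp p * (Complex.exp (θ * Complex.I) -
        Complex.exp ((0 : ℝ) * Complex.I)) - Real.exp p * ((Real.exp (τ - p) - 1 : ℝ) : ℂ) := by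
      have h3 : Real.exp τ = Real.exp p * Real.exp (τ - p) := by rw [← Real.exp_add]; ring_nf
      rw [hcdef, circleMap, h3]
      push_cast
      simp only [zero_mul, Complex.exp_zero]
      ring
    rw [h2]
    refine (norm_sub_le _ _).trans ?_
    rw [norm_mul, norm_mul, Complex.norm_real, Complex.norm_real, Real.norm_of_nonneg hep.le,
      Real.norm_eq_abs]
    have h4 := norm_exp_I_sub_exp_I_le θ 0
    rw [sub_zero] at h4
    have h5 := Real.abs_exp_sub_one_le (x := τ - p) (by linarith)
    have h6 : ‖Complex.exp (θ * Complex.I) - Complex.exp ((0 : ℝ) * Complex.I)‖ ≤ γ :=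
      h4.trans hθ.le
    have h7 : |Real.exp (τ - p) - 1| ≤ 2 * γ := by linarith
    calc _ ≤ Real.exp p * γ + Real.exp p * (2 * γ) := by gcongr
      _ = r := by rw [hr]; ring
  have hpot : logPotential G c (2 * r) ≤
      (L + logMaxTerm G V p - V p * p + 8 * γ * inc) + V p * Real.log (max (2 * r) ‖c‖) := by
    refine logPotential_le hV.ne_zero (by linarith) fun z hz hGz => ?_
    have h2 := norm_sub_norm_le z c
    have h3 := norm_sub_norm_le c z
    rw [norm_sub_rev] at h3
    rw [hz, hcn] at h2 h3
    have hz1 : (1 - 6 * γ) * Real.exp p ≤ ‖z‖ := by rw [hr] at h3; linarith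
    have hz2 : ‖z‖ ≤ (1 + 6 * γ) * Real.exp p := by rw [hr] at h2; linarith
    have hzpos : 0 < ‖z‖ := lt_of_lt_of_le (mul_pos (by linarith) hep) hz1
    set τ := Real.log ‖z‖ with hτ
    have hτ1 : p - 8 * γ ≤ τ := by
      rw [hτ, Real.le_log_iff_exp_le hzpos, sub_eq_add_neg, Real.exp_add, mul_comm]
      refine le_trans (mul_le_mul_of_nonneg_right ?_ hep.le) hz1
      have h4 : Real.exp (-(8 * γ)) ≤ 1 / (1 + 8 * γ) := by
        rw [Real.exp_neg, inv_eq_one_div]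
        apply one_div_le_one_div_of_le (by linarith)
        linarith [Real.add_one_le_exp (8 * γ)]
      refine h4.trans ?_
      rw [div_le_iff₀ (by linarith)]
      nlinarith
    have hτ2 : τ ≤ p + 8 * γ := by
      rw [hτ, Real.log_le_iff_le_exp hzpos, Real.exp_add, mul_comm]
      refine hz2.trans (mul_le_mul_of_nonneg_right ?_ hep.le)
      linarith [Real.add_one_le_exp (8 * γ)]
    have h4 := hV.log_norm_eval_le (norm_pos_iff.1 hzpos) hGz
    rw [← hτ] at h4
    have h5 := hV.logMaxTerm_add_le τ p
    -- This product bounds the excess of `logMaxTerm` at `τ` over its supporting line at `p`. The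
    -- line itself has the form `const + V p * log ‖z‖`, harmonic off the origin, so only the
    -- increment of `V` matters.
    have h6 : ((V τ : ℝ) - V p) * (τ - p) ≤ inc * (8 * γ) := by
      have m1 : (V (p - 8 * γ) : ℝ) ≤ V τ := by exact_mod_cast hV.mono hτ1
      have m2 : (V τ : ℝ) ≤ V (p + 8 * γ) := by exact_mod_cast hV.mono hτ2
      have m3 : (V (p - 8 * γ) : ℝ) ≤ V p := by exact_mod_cast hV.mono (by linarith)
      have m4 : (V p : ℝ) ≤ V (p + 8 * γ) := by exact_mod_cast hV.mono (by linarith)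
      rcases le_total p τ with h | h
      · have m5 : (V p : ℝ) ≤ V τ := by exact_mod_cast hV.mono h
        apply mul_le_mul <;> linarith
      · have m5 : (V τ : ℝ) ≤ V p := by exact_mod_cast hV.mono h
        rw [← neg_mul_neg]
        apply mul_le_mul <;> linarith
    unfold logGap
    rw [← hτ]
    linarith
  rw [hcn, max_eq_right (by rw [hr]; nlinarith), Real.log_exp] at hpot
  have hj := countP_mul_log_two_le G c hrpos
  have hlow := log_norm_eval_le_logPotential hGc r
  set N : ℝ := (G.roots.countP (fun ζ => ‖c - ζ‖ ≤ r) : ℝ) with hN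
  have hN0 : 0 ≤ N := Nat.cast_nonneg _
  have hlog2 : 1 / 2 ≤ Real.log 2 := by linarith [Real.log_two_gt_d9]
  have h8 : N * (1 / 2) ≤ N * Real.log 2 := by gcongr
  have h9 : 8 / γ * (B + L) = 2 * (4 / γ * (B + L)) := by ring
  linarith

open Classical in
/-- Roots in discs on which the maximal term has small index. -/
theorem countP_low_le {G : ℂ[X]} {n : ℕ} {S : Finset ℕ} {V : ℝ → ℕ}
    (hV : IsMaxTermIndex G n S V) {B : ℝ} (hB : 0 ≤ B)
    (hF : ∀ t, logMaxTerm G V t ≤ radialMean G t + B) (D : ℕ) :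
    (G.roots.countP (fun ζ => ζ ≠ 0 ∧ V (Real.log ‖ζ‖ + 1) ≤ D) : ℝ) ≤
      D + Real.log (n + 1) + B := by
  have hL0 : 0 ≤ Real.log ((n : ℝ) + 1) :=
    Real.log_nonneg (by linarith [(Nat.cast_nonneg n : (0 : ℝ) ≤ n)])
  set F := G.roots.toFinset.filter (fun ζ => ζ ≠ 0 ∧ V (Real.log ‖ζ‖ + 1) ≤ D) with hFdef
  rcases F.eq_empty_or_nonempty with he | hne
  · have : G.roots.countP (fun ζ => ζ ≠ 0 ∧ V (Real.log ‖ζ‖ + 1) ≤ D) = 0 := by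
      rw [Multiset.countP_eq_zero]
      intro ζ hζ hlow
      have : ζ ∈ F := Finset.mem_filter.2 ⟨Multiset.mem_toFinset.2 hζ, hlow⟩
      simp [he] at this
    rw [this]; push_cast; positivity
  -- All these roots lie in the disc through the largest one. Their number is at most the growth of
  -- `radialMean` over `[t, t + 1]`, where `logMaxTerm` has slope at most `D`.
  · obtain ⟨ζ₀, hζ₀, hmax⟩ := F.exists_max_image (fun ζ => ‖ζ‖) hne
    obtain ⟨-, hζ₀0, hζ₀V⟩ := Finset.mem_filter.1 hζ₀
    have hpos : 0 < ‖ζ₀‖ := norm_pos_iff.2 hζ₀0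
    set t := Real.log ‖ζ₀‖ with ht
    have h1 : (G.roots.countP (fun ζ => ζ ≠ 0 ∧ V (Real.log ‖ζ‖ + 1) ≤ D) : ℝ) ≤
        G.roots.countP (fun ζ => ‖ζ‖ ≤ Real.exp t) := by
      rw [Multiset.countP_eq_card_filter, Multiset.countP_eq_card_filter]
      refine Nat.cast_le.2 (Multiset.card_le_card ?_)
      rw [Multiset.le_filter]
      refine ⟨Multiset.filter_le _ _, fun ζ hζ => ?_⟩
      rw [Multiset.mem_filter] at hζ
      rw [ht, Real.exp_log hpos]
      exact hmax ζ (Finset.mem_filter.2 ⟨Multiset.mem_toFinset.2 hζ.1, hζ.2⟩)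
    have h2 := countP_norm_le_exp G t
    have h3 := hV.radialMean_le (t + 1)
    have h4 := hF t
    have h5 := hV.logMaxTerm_add_le (t + 1) t
    have h6 : (V (t + 1) : ℝ) ≤ D := by exact_mod_cast hζ₀V
    linarith

open Classical in
/-- Roots outside discs on which the maximal term has large index. -/
theorem countP_high_le {G : ℂ[X]} {n : ℕ} {S : Finset ℕ} {V : ℝ → ℕ}
    (hV : IsMaxTermIndex G n S V) {B : ℝ} (hB : 0 ≤ B)
    (hF : ∀ t, logMaxTerm G V t ≤ radialMean G t + B) (D : ℕ) :
    (G.roots.countP (fun ζ => ζ ≠ 0 ∧ n ≤ V (Real.log ‖ζ‖ - 1) + D) : ℝ) ≤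
      D + Real.log (n + 1) + B := by
  have hL0 : 0 ≤ Real.log ((n : ℝ) + 1) :=
    Real.log_nonneg (by linarith [(Nat.cast_nonneg n : (0 : ℝ) ≤ n)])
  set F := G.roots.toFinset.filter (fun ζ => ζ ≠ 0 ∧ n ≤ V (Real.log ‖ζ‖ - 1) + D) with hFdef
  rcases F.eq_empty_or_nonempty with he | hne
  · have : G.roots.countP (fun ζ => ζ ≠ 0 ∧ n ≤ V (Real.log ‖ζ‖ - 1) + D) = 0 := by
      rw [Multiset.countP_eq_zero]
      intro ζ hζ hlow
      have : ζ ∈ F := Finset.mem_filter.2 ⟨Multiset.mem_toFinset.2 hζ, hlow⟩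
      simp [he] at this
    rw [this]; push_cast; positivity
  -- All these roots lie on or outside the circle through the smallest one. They reduce the growth
  -- of `radialMean` over `[t - 1, t]` below `n`, while `logMaxTerm` rises by at least `n - D`.
  · obtain ⟨ζ₀, hζ₀, hmin⟩ := F.exists_min_image (fun ζ => ‖ζ‖) hne
    obtain ⟨-, hζ₀0, hζ₀V⟩ := Finset.mem_filter.1 hζ₀
    have hpos : 0 < ‖ζ₀‖ := norm_pos_iff.2 hζ₀0
    set t := Real.log ‖ζ₀‖ with ht
    have h1 : (G.roots.countP (fun ζ => ζ ≠ 0 ∧ n ≤ V (Real.log ‖ζ‖ - 1) + D) : ℝ) ≤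
        G.roots.countP (fun ζ => Real.exp t ≤ ‖ζ‖) := by
      rw [Multiset.countP_eq_card_filter, Multiset.countP_eq_card_filter]
      refine Nat.cast_le.2 (Multiset.card_le_card ?_)
      rw [Multiset.le_filter]
      refine ⟨Multiset.filter_le _ _, fun ζ hζ => ?_⟩
      rw [Multiset.mem_filter] at hζ
      rw [ht, Real.exp_log hpos]
      exact hmin ζ (Finset.mem_filter.2 ⟨Multiset.mem_toFinset.2 hζ.1, hζ.2⟩)
    have h2 := radialMean_add_countP_le G hV.natDegree_le (show t - 1 ≤ t by linarith)
    have h3 := hV.radialMean_le (t - 1)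
    have h4 := hF t
    have h5 := hV.logMaxTerm_add_le (t - 1) t
    have h6 : (n : ℝ) ≤ V (t - 1) + D := by exact_mod_cast hζ₀V
    linarith

/-! ### Counting lemmas for integers and multisets. -/

theorem Int.card_le_of_sub_le {J : Finset ℤ} {M : ℝ} (hM : 0 ≤ M)
    (h : ∀ i ∈ J, ∀ j ∈ J, i < j → (j : ℝ) - i ≤ M) : (J.card : ℝ) ≤ M + 1 := by
  rcases J.eq_empty_or_nonempty with rfl | hne
  · simp; linarith
  · set m := J.min' hne with hm
    have hsub : J ⊆ Finset.Icc m (m + ⌊M⌋) := by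
      intro j hj
      have h1 : m ≤ j := J.min'_le j hj
      refine Finset.mem_Icc.2 ⟨h1, ?_⟩
      have h2 : j - m ≤ ⌊M⌋ := by
        rw [Int.le_floor]
        rcases h1.eq_or_lt with h3 | h3
        · rw [← h3]; simpa using hM
        · have := h m (J.min'_mem hne) j hj h3
          push_cast; exact this
      linarith
    have h2 := Finset.card_le_card hsub
    rw [Int.card_Icc] at h2
    have h3 : (0 : ℤ) ≤ ⌊M⌋ := Int.floor_nonneg.2 hM
    have h4 : (J.card : ℤ) ≤ ⌊M⌋ + 1 := by omega
    have h5 : (J.card : ℝ) ≤ (⌊M⌋ : ℝ) + 1 := by exact_mod_cast h4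
    linarith [Int.floor_le M]

theorem sum_int_increments_le {f : ℤ → ℝ} (hf : Monotone f) (h0 : ∀ j, 0 ≤ f j) (J : Finset ℤ) :
    ∀ b, (∀ j ∈ J, j < b) → ∑ j ∈ J, (f (j + 1) - f j) ≤ f b := by
  induction J using Finset.induction_on_max with
  | empty => intro b _; simpa using h0 b
  | insert a s ha ih =>
    intro b hb
    rw [Finset.sum_insert fun h => lt_irrefl a (ha a h)]
    have h1 := ih a ha
    have h2 : f (a + 1) ≤ f b := hf (hb a (Finset.mem_insert_self a s))
    linarith

/-- An increment over `m` steps is a sum of `m` shifted unit increments, and for each shift the sum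
over `J` is at most the total variation. -/
theorem sum_int_increments_add_le {f : ℤ → ℝ} (hf : Monotone f) (h0 : ∀ j, 0 ≤ f j) {N : ℝ}
    (hN : ∀ j, f j ≤ N) (J : Finset ℤ) (a : ℤ) (m : ℕ) :
    ∑ j ∈ J, (f (j + a + m) - f (j + a)) ≤ m * N := by
  have h1 : ∀ j : ℤ, f (j + a + m) - f (j + a) =
      ∑ i ∈ Finset.range m, (f (j + 1 + (a + i)) - f (j + (a + i))) := by
    intro j
    have := Finset.sum_range_sub (fun i : ℕ => f (j + a + i)) m
    simp only [Nat.cast_zero, add_zero] at this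
    rw [← this]
    refine Finset.sum_congr rfl fun i _ => ?_
    push_cast
    congr 2 <;> ring
  rw [Finset.sum_congr rfl fun j _ => h1 j, Finset.sum_comm]
  have h2 : ∀ i ∈ Finset.range m, ∑ j ∈ J, (f (j + 1 + (a + i)) - f (j + (a + i))) ≤ N := by
    intro i _
    obtain ⟨b, hb⟩ := J.exists_le
    have := sum_int_increments_le (f := fun j => f (j + (a + i)))
      (fun x y hxy => hf (by linarith)) (fun j => h0 _) J (b + 1)
      (fun j hj => by linarith [hb j hj])
    exact this.trans (hN _)
  refine (Finset.sum_le_sum h2).trans ?_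
  simp

theorem Multiset.countP_le_sum_countP {ι α : Type*} (s : Multiset α) (J : Finset ι) (p : α → Prop)
    (q : ι → α → Prop) [DecidablePred p] [∀ j, DecidablePred (q j)]
    (h : ∀ x ∈ s, p x → ∃ j ∈ J, q j x) : s.countP p ≤ ∑ j ∈ J, s.countP (q j) := by
  induction s using Multiset.induction_on with
  | empty => simp
  | cons a s ih =>
    simp only [Multiset.countP_cons]
    rw [Finset.sum_add_distrib]
    refine add_le_add (ih fun x hx => h x (Multiset.mem_cons_of_mem hx)) ?_
    split_ifs with hp
    · obtain ⟨j, hj, hq⟩ := h a (Multiset.mem_cons_self a s) hp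
      exact le_trans (by rw [if_pos hq])
        (Finset.single_le_sum (f := fun j => if q j a then 1 else 0) (fun _ _ => by positivity) hj)
    · exact Nat.zero_le _

theorem Multiset.countP_le_add_countP {α : Type*} {p q r u : α → Prop} [DecidablePred p]
    [DecidablePred q] [DecidablePred r] [DecidablePred u] (s : Multiset α)
    (h : ∀ x ∈ s, p x → q x ∨ r x ∨ u x) :
    s.countP p ≤ s.countP q + s.countP r + s.countP u := by
  induction s using Multiset.induction_on with
  | empty => simp
  | cons a s ih =>
    have h1 := ih fun x hx => h x (Multiset.mem_cons_of_mem hx)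
    have h2 := h a (Multiset.mem_cons_self a s)
    simp only [Multiset.countP_cons]
    split_ifs <;> first | omega | tauto

/-! ### Logarithmic windows containing positive roots. -/

section Windows

variable {G : ℂ[X]} {n : ℕ} {S : Finset ℕ} {V : ℝ → ℕ}

/-- The grid interval `[j * γ, (j + 1) * γ)` contains the logarithm of a positive root at which the
maximal term has an index away from both ends. -/
def IsActiveWindow (G : ℂ[X]) (n : ℕ) (V : ℝ → ℕ) (D : ℕ) (γ : ℝ) (j : ℤ) : Prop :=
  ∃ τ : ℝ, G.eval (Real.exp τ : ℂ) = 0 ∧ j * γ ≤ τ ∧ τ < (j + 1) * γ ∧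
    D < V (τ + 1) ∧ V (τ - 1) + D < n

/-- With equal indices at distance `2` on both sides of a root, one term would strongly dominate
there, against `IsDominant.eval_ne_zero`. -/
theorem IsActiveWindow.lt {D : ℕ} {γ : ℝ} {j : ℤ} (hV : IsMaxTermIndex G n S V)
    (hj : IsActiveWindow G n V D γ j) : V (j * γ - 2) < V ((j + 1) * γ + 2) := by
  obtain ⟨τ, h0, h1, h2, -, -⟩ := hj
  by_contra! hle
  have h3 : V (τ - 2) = V (τ + 2) := by
    have a1 := hV.mono (show j * γ - 2 ≤ τ - 2 by linarith)
    have a2 := hV.mono (show τ - 2 ≤ τ + 2 by linarith)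
    have a3 := hV.mono (show τ + 2 ≤ (j + 1) * γ + 2 by linarith)
    omega
  have hd : IsDominant G (V (τ - 2)) (τ + 2) := by rw [h3]; exact hV.isDominant _
  refine IsDominant.eval_ne_zero (hV.isDominant _) hd (z := (Real.exp τ : ℂ)) ?_ h0
  rw [Complex.norm_real, Real.norm_of_nonneg (Real.exp_pos _).le]

/-- Since `V` is monotone, the hypothesis forces any two windows, each enlarged by `H`, to overlap.
Hence their indices span a bounded interval. -/
theorem card_le_of_crossing (hV : IsMaxTermIndex G n S V) {J : Finset ℤ} {γ H : ℝ} (hγ : 0 < γ)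
    (hH : 0 ≤ H)
    (h : ∀ i ∈ J, ∀ j ∈ J, V (j * γ - H) < V ((i + 1) * γ + H)) :
    (J.card : ℝ) ≤ 2 + 2 * H / γ := by
  have h1 := Int.card_le_of_sub_le (J := J) (M := 1 + 2 * H / γ) (by positivity) ?_
  · linarith
  · intro i hi j hj _
    have h2 : (j : ℝ) * γ - H < (i + 1) * γ + H := by
      by_contra! hle
      exact absurd (hV.mono hle) (not_le.2 (h i hi j hj))
    rw [← sub_le_iff_le_add', le_div_iff₀ hγ]
    linarith

/-- Such windows cluster near the one place where `V` crosses `D`, or the one where it crosses `n -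
D`. -/
theorem card_active_end_le (hV : IsMaxTermIndex G n S V) {J : Finset ℤ} {D : ℕ} {γ : ℝ}
    (hγ : 0 < γ) (hJ : ∀ j ∈ J, IsActiveWindow G n V D γ j)
    (hend : ∀ j ∈ J, V (j * γ) ≤ D ∨ n ≤ V ((j + 1) * γ) + D) :
    (J.card : ℝ) ≤ 4 + 4 / γ := by
  classical
  have h1 : ((J.filter fun j : ℤ => V ((j : ℝ) * γ) ≤ D).card : ℝ) ≤ 2 + 2 * 1 / γ := by
    refine card_le_of_crossing hV hγ zero_le_one fun i hi j hj => ?_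
    rw [Finset.mem_filter] at hi hj
    obtain ⟨τ, -, h1, h2, h3, -⟩ := hJ i hi.1
    have a1 := hV.mono (show j * γ - 1 ≤ j * γ by linarith)
    have a2 := hV.mono (show τ + 1 ≤ (i + 1) * γ + 1 by linarith)
    omega
  have h2 : ((J.filter fun j : ℤ => ¬ V ((j : ℝ) * γ) ≤ D).card : ℝ) ≤ 2 + 2 * 1 / γ := by
    refine card_le_of_crossing hV hγ zero_le_one fun i hi j hj => ?_
    rw [Finset.mem_filter] at hi hj
    obtain ⟨τ, -, h1, h2, -, h3⟩ := hJ j hj.1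
    have a1 := hV.mono (show j * γ - 1 ≤ τ - 1 by linarith)
    have a2 := hV.mono (show (i + 1) * γ ≤ (i + 1) * γ + 1 by linarith)
    have a3 := (hend i hi.1).resolve_left hi.2
    omega
  rw [← J.card_filter_add_card_filter_not (fun j : ℤ => V ((j : ℝ) * γ) ≤ D)]
  push_cast
  have : 2 * 1 / γ + 2 * 1 / γ = 4 / γ := by ring
  linarith

/-- Around an active window the index rises from `a j` to `b j`. Either one of these is a middle
index, or the rise spans the whole middle range. Windows sharing the same `a`, the same `b`, or the
full span all overlap after enlargement, so each class is small. -/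
theorem card_active_mid_le (hV : IsMaxTermIndex G n S V) {J : Finset ℤ} {D : ℕ} {γ : ℝ}
    (hγ : 0 < γ) (hJ : ∀ j ∈ J, IsActiveWindow G n V D γ j)
    (hmid : ∀ j ∈ J, D < V (j * γ) ∧ V ((j + 1) * γ) + D < n) :
    (J.card : ℝ) ≤ (2 * (midIndices S n D).card + 1) * (2 + 4 / γ) := by
  classical
  set T := midIndices S n D with hT
  set a : ℤ → ℕ := fun j => V (j * γ - 2) with ha
  set b : ℤ → ℕ := fun j => V ((j + 1) * γ + 2) with hb
  have hM : 2 * 2 / γ = 4 / γ := by norm_num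
  have hmono : ∀ i j : ℤ, i < j → a i ≤ a j ∧ b i ≤ b j := fun i j hij => by
    have hij' : (i : ℝ) < j := by exact_mod_cast hij
    exact ⟨hV.mono (by nlinarith), hV.mono (by nlinarith)⟩
  have hab : ∀ j ∈ J, a j < b j := fun j hj => (hJ j hj).lt hV
  have hwa : ∀ w ∈ T, ((J.filter fun j => a j = w).card : ℝ) ≤ 2 + 4 / γ := by
    intro w _
    rw [← hM]
    refine card_le_of_crossing hV hγ zero_le_two fun i hi j hj => ?_
    rw [Finset.mem_filter] at hi hj
    have := hab i hi.1
    change a j < b i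
    omega
  have hwb : ∀ w ∈ T, ((J.filter fun j => b j = w).card : ℝ) ≤ 2 + 4 / γ := by
    intro w _
    rw [← hM]
    refine card_le_of_crossing hV hγ zero_le_two fun i hi j hj => ?_
    rw [Finset.mem_filter] at hi hj
    have := hab j hj.1
    change a j < b i
    omega
  have hc : ((J.filter fun j => a j ≤ D ∧ n ≤ b j + D).card : ℝ) ≤ 2 + 4 / γ := by
    rw [← hM]
    refine card_le_of_crossing hV hγ zero_le_two fun i hi j hj => ?_
    rw [Finset.mem_filter] at hi hj
    have := hab i hi.1
    have := hab j hj.1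
    obtain ⟨h1, h2⟩ := hmid i hi.1
    have h3 := hV.mono (show i * γ ≤ (i + 1) * γ by nlinarith)
    change a j < b i
    omega
  have hsub : J ⊆ (T.biUnion fun w => J.filter fun j => a j = w) ∪
      (T.biUnion fun w => J.filter fun j => b j = w) ∪
      J.filter fun j => a j ≤ D ∧ n ≤ b j + D := by
    intro j hj
    obtain ⟨h1, h2⟩ := hmid j hj
    have h3 : a j ≤ V ((j + 1) * γ) := hV.mono (by nlinarith)
    have h4 : V (j * γ) ≤ b j := hV.mono (by nlinarith)
    simp only [Finset.mem_union, Finset.mem_biUnion, Finset.mem_filter]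
    by_cases h5 : D < a j
    · exact Or.inl (Or.inl ⟨a j, Finset.mem_filter.2 ⟨hV.mem _, h5, by omega⟩, hj, rfl⟩)
    · by_cases h6 : b j + D < n
      · exact Or.inl (Or.inr ⟨b j, Finset.mem_filter.2 ⟨hV.mem _, by omega, h6⟩, hj, rfl⟩)
      · exact Or.inr ⟨hj, by omega, by omega⟩
  have hbi : ∀ c : ℤ → ℕ, (∀ w ∈ T, ((J.filter fun j => c j = w).card : ℝ) ≤ 2 + 4 / γ) →
      ((T.biUnion fun w => J.filter fun j => c j = w).card : ℝ) ≤ T.card * (2 + 4 / γ) := by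
    intro c hc
    have h1 : ((T.biUnion fun w => J.filter fun j => c j = w).card : ℝ) ≤
        ∑ w ∈ T, ((J.filter fun j => c j = w).card : ℝ) := by
      exact_mod_cast Finset.card_biUnion_le
    refine (h1.trans (Finset.sum_le_sum hc)).trans ?_
    rw [Finset.sum_const, nsmul_eq_mul]
  have h7 := (Finset.card_le_card hsub).trans ((Finset.card_union_le _ _).trans
    (Nat.add_le_add_right (Finset.card_union_le _ _) _))
  have h8 : (J.card : ℝ) ≤ ((T.biUnion fun w => J.filter fun j => a j = w).card : ℝ) +
      (T.biUnion fun w => J.filter fun j => b j = w).card +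
      (J.filter fun j => a j ≤ D ∧ n ≤ b j + D).card := by exact_mod_cast h7
  have h9 := hbi a hwa
  have h10 := hbi b hwb
  linarith

-- As `p` may lie anywhere in the closed window, `[p - 8γ, p + 8γ]` is covered by grid points `j -
-- 8` to `j + 9`, hence the `17`.
open Classical in
theorem countP_window_le (hV : IsMaxTermIndex G n S V) {γ B : ℝ} (hγ : 0 < γ)
    (hγ1 : γ ≤ 1 / 24) (hB : 0 < B) {p : ℝ} {j : ℤ} (hp1 : j * γ ≤ p) (hp2 : p ≤ (j + 1) * γ)
    (hp : logMaxTerm G V p ≤ radialMean G p + B) :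
    (G.roots.countP (fun ζ => ∃ τ : ℝ, ζ = (Real.exp τ : ℂ) ∧ j * γ ≤ τ ∧ τ < (j + 1) * γ) : ℝ) ≤
      16 * γ * ((V ((j + (-8) + (17 : ℕ) : ℤ) * γ) : ℝ) - V ((j + (-8) : ℤ) * γ)) +
        8 / γ * (B + Real.log (n + 1)) := by
  have h1 := countP_near_le hV hγ hγ1 hB hp
  have h2 : (V (p + 8 * γ) : ℝ) ≤ V ((j + (-8) + (17 : ℕ) : ℤ) * γ) := by
    refine Nat.cast_le.2 (hV.mono ?_)
    push_cast; linarith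
  have h3 : (V ((j + (-8) : ℤ) * γ) : ℝ) ≤ V (p - 8 * γ) := by
    refine Nat.cast_le.2 (hV.mono ?_)
    push_cast; linarith
  have h4 : (G.roots.countP (fun ζ => ∃ τ : ℝ, ζ = (Real.exp τ : ℂ) ∧ j * γ ≤ τ ∧
      τ < (j + 1) * γ) : ℝ) ≤
      G.roots.countP (fun ζ => ∃ τ : ℝ, |τ - p| ≤ γ ∧ ζ = (Real.exp τ : ℂ)) := by
    rw [Multiset.countP_eq_card_filter, Multiset.countP_eq_card_filter]
    refine Nat.cast_le.2 (Multiset.card_le_card (Multiset.monotone_filter_right _ ?_))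
    rintro ζ ⟨τ, hζ, h5, h6⟩
    exact ⟨τ, abs_le.2 ⟨by linarith, by linarith⟩, hζ⟩
  refine h4.trans (h1.trans ?_)
  gcongr

open Classical in
/-- A polynomial with few maximal terms has few positive roots. -/
theorem countP_positive_le (hV : IsMaxTermIndex G n S V) {D : ℕ} {γ B E : ℝ} (hγ : 0 < γ) (hγ1 : γ ≤ 1 / 24) (hB : 0 < B)
    (hF : ∀ t, logMaxTerm G V t ≤ radialMean G t + B)
    (hE : Real.exp (600 * ((midIndices S n D).card + 1) / γ) ≤ E) :
    (G.roots.countP (fun ζ => ∃ τ : ℝ, ζ = (Real.exp τ : ℂ)) : ℝ) ≤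
      2 * (D + Real.log (n + 1) + B) + 272 * γ * n + 8 / γ *
        ((2 * (midIndices S n D).card + 1) * (2 + 4 / γ) * (E + Real.log (n + 1)) +
          (4 + 4 / γ) * (B + Real.log (n + 1))) := by
  set L := Real.log ((n : ℝ) + 1) with hL
  have hL0 : 0 ≤ L := Real.log_nonneg (by linarith [(Nat.cast_nonneg n : (0 : ℝ) ≤ n)])
  have hE0 : 0 < E := (Real.exp_pos _).trans_le hE
  set rem : ℂ → Prop := fun ζ => ∃ τ : ℝ, ζ = (Real.exp τ : ℂ) ∧ D < V (τ + 1) ∧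
    V (τ - 1) + D < n with hrem
  set win : ℤ → ℂ → Prop := fun j ζ => ∃ τ : ℝ, ζ = (Real.exp τ : ℂ) ∧ j * γ ≤ τ ∧
    τ < (j + 1) * γ with hwin
  set J : Finset ℤ := (G.roots.toFinset.filter rem).image fun ζ => ⌊Real.log ‖ζ‖ / γ⌋ with hJdef
  have hlogexp : ∀ τ : ℝ, Real.log ‖(Real.exp τ : ℂ)‖ = τ := fun τ => by
    rw [Complex.norm_real, Real.norm_of_nonneg (Real.exp_pos _).le, Real.log_exp]
  have hfl : ∀ τ : ℝ, (⌊τ / γ⌋ : ℝ) * γ ≤ τ ∧ τ < (⌊τ / γ⌋ + 1) * γ := fun τ =>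
    ⟨by rw [← le_div_iff₀ hγ]; exact Int.floor_le _,
      by rw [← div_lt_iff₀ hγ]; exact Int.lt_floor_add_one _⟩
  have hJ : ∀ j ∈ J, IsActiveWindow G n V D γ j := by
    intro j hj
    obtain ⟨ζ, hζ, rfl⟩ := Finset.mem_image.1 hj
    obtain ⟨hζr, τ, rfl, h1, h2⟩ := Finset.mem_filter.1 hζ
    rw [hlogexp]
    exact ⟨τ, (mem_roots'.1 (Multiset.mem_toFinset.1 hζr)).2, (hfl τ).1, (hfl τ).2, h1, h2⟩
  have hsplit : G.roots.countP (fun ζ => ∃ τ : ℝ, ζ = (Real.exp τ : ℂ)) ≤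
      G.roots.countP (fun ζ => ζ ≠ 0 ∧ V (Real.log ‖ζ‖ + 1) ≤ D) +
      G.roots.countP (fun ζ => ζ ≠ 0 ∧ n ≤ V (Real.log ‖ζ‖ - 1) + D) +
      ∑ j ∈ J, G.roots.countP (win j) := by
    have h1 := Multiset.countP_le_sum_countP G.roots J rem win (by
      rintro ζ hζ ⟨τ, rfl, h1, h2⟩
      refine ⟨⌊Real.log ‖(Real.exp τ : ℂ)‖ / γ⌋, Finset.mem_image.2 ⟨_, Finset.mem_filter.2
        ⟨Multiset.mem_toFinset.2 hζ, τ, rfl, h1, h2⟩, rfl⟩, τ, rfl, ?_⟩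
      rw [hlogexp]; exact hfl τ)
    refine (Multiset.countP_le_add_countP (q := fun ζ => ζ ≠ 0 ∧ V (Real.log ‖ζ‖ + 1) ≤ D)
      (r := fun ζ => ζ ≠ 0 ∧ n ≤ V (Real.log ‖ζ‖ - 1) + D) (u := rem) G.roots ?_).trans
      (Nat.add_le_add_left h1 _)
    rintro ζ _ ⟨τ, rfl⟩
    have hne : (Real.exp τ : ℂ) ≠ 0 := Complex.ofReal_ne_zero.2 (Real.exp_pos τ).ne'
    by_cases h3 : V (τ + 1) ≤ D
    · exact Or.inl ⟨hne, by rw [hlogexp]; exact h3⟩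
    · by_cases h4 : n ≤ V (τ - 1) + D
      · exact Or.inr (Or.inl ⟨hne, by rw [hlogexp]; exact h4⟩)
      · exact Or.inr (Or.inr ⟨τ, rfl, by omega, by omega⟩)
  have hsplit' : (G.roots.countP (fun ζ => ∃ τ : ℝ, ζ = (Real.exp τ : ℂ)) : ℝ) ≤
      G.roots.countP (fun ζ => ζ ≠ 0 ∧ V (Real.log ‖ζ‖ + 1) ≤ D) +
      G.roots.countP (fun ζ => ζ ≠ 0 ∧ n ≤ V (Real.log ‖ζ‖ - 1) + D) +
      ∑ j ∈ J, (G.roots.countP (win j) : ℝ) := by exact_mod_cast hsplit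
  have hlow := countP_low_le hV hB.le hF D
  have hhigh := countP_high_le hV hB.le hF D
  set mid : ℤ → Prop := fun j => D < V (j * γ) ∧ V ((j + 1) * γ) + D < n with hmid
  set f : ℤ → ℝ := fun j => V (j * γ) with hf
  -- In middle windows the pigeonhole argument gives the small error `E`. The larger uniform error
  -- `B` is used only in the boundedly many windows near the ends.
  have hwindow : ∀ j ∈ J, (G.roots.countP (win j) : ℝ) ≤
      16 * γ * (f (j + (-8) + (17 : ℕ)) - f (j + (-8))) +
        8 / γ * ((if mid j then E + L else 0) + if ¬ mid j then B + L else 0) := by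
    intro j _
    by_cases hm : mid j
    · rw [if_pos hm, if_neg (not_not.2 hm), add_zero]
      have hmem : ∀ t, j * γ ≤ t → t ≤ j * γ + γ → V t ∈ midIndices S n D := by
        intro t h1 h2
        have h3 := hV.mono h1
        have h4 := hV.mono (show t ≤ (j + 1) * γ by linarith)
        have h5 := hm.1
        have h6 := hm.2
        exact Finset.mem_filter.2 ⟨hV.mem t, by omega, by omega⟩
      obtain ⟨p, hp1, hp2, hp⟩ := hV.exists_logMaxTerm_le hγ (by linarith) hmem
      exact countP_window_le hV hγ hγ1 hE0 hp1 (by linarith) (by linarith)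
    · rw [if_neg hm, if_pos hm, zero_add]
      exact countP_window_le hV hγ hγ1 hB le_rfl (by nlinarith) (hF _)
  have hsum := Finset.sum_le_sum hwindow
  rw [Finset.sum_add_distrib, ← Finset.mul_sum, ← Finset.mul_sum, Finset.sum_add_distrib,
    ← Finset.sum_filter, ← Finset.sum_filter, Finset.sum_const, Finset.sum_const, nsmul_eq_mul,
    nsmul_eq_mul] at hsum
  have hinc := sum_int_increments_add_le (f := f)
    (fun i j hij => Nat.cast_le.2 (hV.mono (by
      have : (i : ℝ) ≤ j := by exact_mod_cast hij
      gcongr)))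
    (fun j => Nat.cast_nonneg _) (N := n) (fun j => Nat.cast_le.2 (hV.le _)) J (-8) 17
  have hcm := card_active_mid_le hV (J := J.filter mid) hγ
    (fun j hj => hJ j (Finset.mem_filter.1 hj).1) (fun j hj => (Finset.mem_filter.1 hj).2)
  have hce := card_active_end_le hV (J := J.filter fun j => ¬ mid j) (D := D) hγ
    (fun j hj => hJ j (Finset.mem_filter.1 hj).1) (fun j hj => by
      have := (Finset.mem_filter.1 hj).2
      simp only [hmid] at this
      omega)
  have h1 : 16 * γ * ∑ j ∈ J, (f (j + (-8) + (17 : ℕ)) - f (j + (-8))) ≤ 16 * γ * (17 * n) := by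
    gcongr; exact_mod_cast hinc
  have h2 : 8 / γ * (((J.filter mid).card : ℝ) * (E + L) +
      ((J.filter fun j => ¬ mid j).card : ℝ) * (B + L)) ≤
      8 / γ * ((2 * (midIndices S n D).card + 1) * (2 + 4 / γ) * (E + L) +
        (4 + 4 / γ) * (B + L)) := by gcongr
  have e1 : 16 * γ * (17 * n) = 272 * γ * n := by ring
  rw [e1] at h1
  have h3 := hsum.trans (add_le_add h1 h2)
  linarith

end Windows

/-! ### Records -/

/-- The term of index `k` exceeds all previous terms in absolute value. -/
def IsRecord (a : ℕ → ℝ) (k : ℕ) : Prop := ∀ i < k, |a i| < |a k|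

/-- The involution of `ℕ` reversing the order of `0, ..., n`. -/
def reflect (n k : ℕ) : ℕ := if k ≤ n then n - k else k

/-- The indices of the records of `a 0, ..., a n` in either direction. -/
noncomputable def recordIndices (a : ℕ → ℝ) (n : ℕ) : Finset ℕ :=
  @Finset.filter ℕ (fun k => IsRecord a k ∨ IsRecord (a ∘ reflect n) (n - k))
    (Classical.decPred _) (Finset.range (n + 1))

theorem mem_recordIndices {a : ℕ → ℝ} {n k : ℕ} : k ∈ recordIndices a n ↔
    k ∈ Finset.range (n + 1) ∧ (IsRecord a k ∨ IsRecord (a ∘ reflect n) (n - k)) :=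
  @Finset.mem_filter ℕ _ (Classical.decPred _) _ _

theorem le_of_mem_recordIndices {a : ℕ → ℝ} {n w : ℕ} (h : w ∈ recordIndices a n) : w ≤ n :=
  Nat.lt_succ_iff.1 (Finset.mem_range.1 (mem_recordIndices.1 h).1)

theorem recordIndices_congr_abs {a b : ℕ → ℝ} (h : ∀ k, |a k| = |b k|) (n : ℕ) :
    recordIndices a n = recordIndices b n := by
  have h1 : ∀ k, IsRecord a k ↔ IsRecord b k := fun k => by simp [IsRecord, h]
  have h2 : ∀ k, IsRecord (a ∘ reflect n) k ↔ IsRecord (b ∘ reflect n) k := fun k => by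
    simp [IsRecord, h]
  ext k
  simp only [mem_recordIndices, h1, h2]

/-! ### Maximal terms and real roots of a polynomial with given coefficients. -/

theorem coeff_partialPoly (a : ℕ → ℝ) (n k : ℕ) :
    (partialPoly a n).coeff k = if k ≤ n then a k else 0 := by
  simp [partialPoly, Polynomial.finsetSum_coeff, coeff_C_mul, coeff_X_pow]

theorem natDegree_partialPoly_le (a : ℕ → ℝ) (n : ℕ) : (partialPoly a n).natDegree ≤ n :=
  natDegree_le_iff_coeff_eq_zero.2 fun k hk => by
    rw [coeff_partialPoly, if_neg (not_le.2 hk)]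

theorem partialPoly_ne_zero {a : ℕ → ℝ} {n k : ℕ} (hk : k ≤ n) (h : a k ≠ 0) :
    partialPoly a n ≠ 0 := fun h0 => h (by
  have := coeff_partialPoly a n k
  rwa [h0, coeff_zero, if_pos hk, eq_comm] at this)

theorem realRootCount_le_self (a : ℕ → ℝ) (n : ℕ) : realRootCount a n ≤ n :=
  (card_roots' _).trans (natDegree_partialPoly_le a n)

theorem partialPoly_comp_neg_X (a : ℕ → ℝ) (n : ℕ) :
    (partialPoly a n).comp (-X) = partialPoly (fun k => (-1) ^ k * a k) n := by
  simp only [partialPoly, Polynomial.sum_comp, mul_comp, C_comp, X_pow_comp, map_mul,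
    map_pow, map_neg, map_one]
  refine Finset.sum_congr rfl fun k _ => ?_
  rw [neg_pow (X : ℝ[X])]
  ring

theorem norm_coeff_map_partialPoly (a : ℕ → ℝ) (n k : ℕ) :
    ‖((partialPoly a n).map Complex.ofRealHom).coeff k‖ = if k ≤ n then |a k| else 0 := by
  rw [coeff_map, coeff_partialPoly]
  split_ifs <;> simp

/-- For `t ≤ 0` the weights `exp (k * t)` do not increase in `k`, so the least maximizing index
beats all earlier coefficients strictly. For `t ≥ 0` the greatest maximizing index beats all later
ones. -/
theorem exists_isDominant_mem_recordIndices {a : ℕ → ℝ} {n k₀ : ℕ} (hk₀ : k₀ ≤ n)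
    (h₀ : a k₀ ≠ 0) (t : ℝ) :
    ∃ v ∈ recordIndices a n, IsDominant ((partialPoly a n).map Complex.ofRealHom) v t := by
  classical
  set f : ℕ → ℝ := fun k => |a k| * Real.exp (k * t) with hf
  set M := (Finset.range (n + 1)).filter fun k => ∀ i : ℕ, i ∈ Finset.range (n + 1) → f i ≤ f k with hM
  have hmem : ∀ v, v ∈ M ↔ v ∈ Finset.range (n + 1) ∧
      ∀ i : ℕ, i ∈ Finset.range (n + 1) → f i ≤ f v := fun v => by
    simp only [hM, Finset.mem_filter]
  have hne : M.Nonempty := by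
    obtain ⟨k, hk, h⟩ := (Finset.range (n + 1)).exists_max_image f ⟨0, by simp⟩
    exact ⟨k, (hmem _).2 ⟨hk, h⟩⟩
  have hdom : ∀ v ∈ M, IsDominant ((partialPoly a n).map Complex.ofRealHom) v t := by
    intro v hv
    obtain ⟨hv1, hv2⟩ := (hmem _).1 hv
    have hv1' := Nat.lt_succ_iff.1 (Finset.mem_range.1 hv1)
    have hv0 : a v ≠ 0 := by
      intro h
      have h1 := hv2 k₀ (by simpa [Nat.lt_succ_iff] using hk₀)
      simp only [hf, h, abs_zero, zero_mul] at h1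
      exact absurd h1 (not_le.2 (mul_pos (abs_pos.2 h₀) (Real.exp_pos _)))
    refine ⟨fun h => hv0 ?_, fun k => ?_⟩
    · have h1 := norm_coeff_map_partialPoly a n v
      rw [h, if_pos hv1', norm_zero, eq_comm, abs_eq_zero] at h1
      exact h1
    · rw [norm_coeff_map_partialPoly, norm_coeff_map_partialPoly, if_pos hv1']
      split_ifs with hk
      · exact hv2 k (by simpa [Nat.lt_succ_iff] using hk)
      · rw [zero_mul]; positivity
  have hcmp : ∀ i v : ℕ, f i < f v → (i : ℝ) * t ≥ v * t → |a i| < |a v| := by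
    intro i v h1 h2
    by_contra! h3
    refine absurd h1 (not_lt.2 (mul_le_mul h3 (Real.exp_le_exp.2 h2) (Real.exp_pos _).le
      (abs_nonneg _)))
  rcases le_total t 0 with ht | ht
  · have hv := M.min'_mem hne
    refine ⟨M.min' hne, mem_recordIndices.2 ⟨(((hmem _).1 hv)).1, Or.inl fun i hi => ?_⟩,
      hdom _ hv⟩
    obtain ⟨hv1, hv2⟩ := (hmem _).1 hv
    have hi1 : i ∈ Finset.range (n + 1) :=
      Finset.mem_range.2 (hi.trans (Finset.mem_range.1 hv1))
    refine hcmp _ _ (lt_of_not_ge fun hle => ?_)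
      (mul_le_mul_of_nonpos_right (Nat.cast_le.2 hi.le) ht)
    exact absurd (M.min'_le i ((hmem _).2 ⟨hi1, fun j hj => (hv2 j hj).trans hle⟩))
      (not_le.2 hi)
  · have hv := M.max'_mem hne
    refine ⟨M.max' hne, mem_recordIndices.2 ⟨(((hmem _).1 hv)).1, Or.inr fun i hi => ?_⟩,
      hdom _ hv⟩
    obtain ⟨hv1, hv2⟩ := (hmem _).1 hv
    have hv3 := Nat.lt_succ_iff.1 (Finset.mem_range.1 hv1)
    set v := M.max' hne
    have e1 : reflect n i = n - i := if_pos (by omega)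
    have e2 : reflect n (n - v) = v := by rw [reflect, if_pos (by omega)]; omega
    simp only [Function.comp_apply, e1, e2]
    have hi1 : n - i ∈ Finset.range (n + 1) := Finset.mem_range.2 (by omega)
    have hlt : v < n - i := by omega
    refine hcmp _ _ (lt_of_not_ge fun hle => ?_)
      (mul_le_mul_of_nonneg_right (Nat.cast_le.2 hlt.le) ht)
    exact absurd (M.le_max' _ ((hmem _).2 ⟨hi1, fun j hj => (hv2 j hj).trans hle⟩))
      (not_le.2 hlt)

theorem exists_isMaxTermIndex {a : ℕ → ℝ} {n k₀ : ℕ} (hk₀ : k₀ ≤ n) (h₀ : a k₀ ≠ 0) :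
    ∃ V, IsMaxTermIndex ((partialPoly a n).map Complex.ofRealHom) n (recordIndices a n) V := by
  choose V hV hd using exists_isDominant_mem_recordIndices hk₀ h₀
  exact ⟨V, natDegree_map_le.trans (natDegree_partialPoly_le a n), hV, hd⟩

open Classical in
theorem countP_pos_roots_le (P : ℝ[X]) :
    P.roots.countP (0 < ·) ≤
      (P.map Complex.ofRealHom).roots.countP (fun ζ => ∃ τ : ℝ, ζ = (Real.exp τ : ℂ)) := by
  refine le_trans ?_ (Multiset.countP_le_of_le _
    (map_roots_le_of_injective P (f := Complex.ofRealHom) Complex.ofReal_injective))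
  rw [Multiset.countP_map, Multiset.countP_eq_card_filter]
  refine Multiset.card_le_card (Multiset.monotone_filter_right _ fun x hx => ?_)
  exact ⟨Real.log x, by rw [Real.exp_log hx]; rfl⟩

theorem count_zero_roots_le {a : ℕ → ℝ} {n k₀ : ℕ} (hk₀ : k₀ ≤ n) (h₀ : a k₀ ≠ 0) :
    (partialPoly a n).roots.count 0 ≤ k₀ := by
  rw [count_roots]
  by_contra! h
  have h1 : X ^ (k₀ + 1) ∣ partialPoly a n := by
    have := (le_rootMultiplicity_iff (partialPoly_ne_zero hk₀ h₀)).1 (Nat.succ_le_of_lt h)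
    simpa using this
  have h2 := X_pow_dvd_iff.1 h1 k₀ (Nat.lt_succ_self _)
  rw [coeff_partialPoly, if_pos hk₀] at h2
  exact h₀ h2

theorem countP_positive_roots_partialPoly_le {a : ℕ → ℝ} {n k₀ : ℕ} (hk₀ : k₀ ≤ n)
    (h₀ : a k₀ ≠ 0) {D : ℕ} {γ E : ℝ} (hγ : 0 < γ) (hγ1 : γ ≤ 1 / 24)
    (hE : Real.exp (600 * ((midIndices (recordIndices a n) n D).card + 1) / γ ^ 3) ≤ E) :
    ((partialPoly a n).roots.countP (0 < ·) : ℝ) ≤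
      2 * (D + Real.log (n + 1) + (E + γ ^ 3 * ((recordIndices a n).card * D + n))) +
        272 * γ * n + 8 / γ * (E * (2 + 4 / γ) * (E + Real.log (n + 1)) +
          (4 + 4 / γ) * (E + γ ^ 3 * ((recordIndices a n).card * D + n) + Real.log (n + 1))) := by
  classical
  obtain ⟨V, hV⟩ := exists_isMaxTermIndex hk₀ h₀
  set S := recordIndices a n
  set K := (midIndices S n D).card
  have hE0 : 0 < E := (Real.exp_pos _).trans_le hE
  have hK : (0 : ℝ) < K + 1 := by positivity
  have hγ3 : γ ^ 3 ≤ γ := by nlinarith [pow_pos hγ 2, pow_pos hγ 3]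
  -- This step length makes the cost of the `K` middle indices at most `γ ^ 3 * n` while the
  -- exponential error stays below `E`.
  have hh : 0 < γ ^ 3 / (K + 1) := by positivity
  have hh1 : γ ^ 3 / (K + 1) ≤ γ ^ 3 := div_le_self (by positivity) (by
    linarith [(Nat.cast_nonneg K : (0 : ℝ) ≤ K)])
  have hF : ∀ t, logMaxTerm ((partialPoly a n).map Complex.ofRealHom) V t ≤
      radialMean ((partialPoly a n).map Complex.ofRealHom) t +
        (E + γ ^ 3 * (S.card * D + n)) := by
    intro t
    refine (hV.logMaxTerm_le hh (by linarith) (fun w hw => le_of_mem_recordIndices hw) D t).trans ?_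
    have e1 : 600 / (γ ^ 3 / (K + 1)) = 600 * (K + 1) / γ ^ 3 := by field_simp
    rw [e1, mul_add (γ ^ 3 / _)]
    have h2 : γ ^ 3 / (K + 1) * (S.card * D) ≤ γ ^ 3 * (S.card * D) := by gcongr
    have h3 : γ ^ 3 / (K + 1) * (K * n) ≤ γ ^ 3 * n := by
      rw [div_mul_eq_mul_div, div_le_iff₀ hK]
      have : (0 : ℝ) ≤ γ ^ 3 * n := by positivity
      nlinarith
    change _ + (Real.exp (600 * (K + 1) / γ ^ 3) +
      (γ ^ 3 / (K + 1) * (S.card * D) + γ ^ 3 / (K + 1) * (K * n))) ≤ _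
    rw [mul_add (γ ^ 3)]
    linarith
  have hKE : 2 * (K : ℝ) + 1 ≤ E := by
    refine le_trans ?_ hE
    have h2 : 600 * ((K : ℝ) + 1) ≤ 600 * (K + 1) / γ ^ 3 := by
      rw [le_div_iff₀ (by positivity)]
      have : γ ^ 3 ≤ 1 := by linarith
      nlinarith
    linarith [Real.add_one_le_exp (600 * ((K : ℝ) + 1) / γ ^ 3)]
  have hE' : Real.exp (600 * (K + 1) / γ) ≤ E := by
    refine le_trans (Real.exp_le_exp.2 ?_) hE
    gcongr
  have hmain := countP_positive_le (D := D) hV hγ hγ1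
    (B := E + γ ^ 3 * (S.card * D + n)) (by positivity) hF hE'
  have hL : 0 ≤ Real.log ((n : ℝ) + 1) :=
    Real.log_nonneg (by linarith [(Nat.cast_nonneg n : (0 : ℝ) ≤ n)])
  refine (Nat.cast_le.2 (countP_pos_roots_le _)).trans (hmain.trans ?_)
  change _ + _ + 8 / γ * ((2 * (K : ℝ) + 1) * (2 + 4 / γ) * _ + _) ≤ _
  gcongr

/-- Negative roots are positive roots of the polynomial at `-x`, whose coefficients have the same
absolute values and hence the same records. The root `0` has multiplicity at most `k₀`. -/
theorem realRootCount_le {a : ℕ → ℝ} {n k₀ : ℕ} (hk₀ : k₀ ≤ n)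
    (h₀ : a k₀ ≠ 0) {D : ℕ} {γ E : ℝ} (hγ : 0 < γ) (hγ1 : γ ≤ 1 / 24)
    (hE : Real.exp (600 * ((midIndices (recordIndices a n) n D).card + 1) / γ ^ 3) ≤ E) :
    (realRootCount a n : ℝ) ≤ k₀ + 2 * (
      2 * (D + Real.log (n + 1) + (E + γ ^ 3 * ((recordIndices a n).card * D + n))) +
        272 * γ * n + 8 / γ * (E * (2 + 4 / γ) * (E + Real.log (n + 1)) +
          (4 + 4 / γ) * (E + γ ^ 3 * ((recordIndices a n).card * D + n) + Real.log (n + 1)))) := by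
  classical
  have habs : ∀ k, |(-1) ^ k * a k| = |a k| := fun k => by simp [abs_mul]
  have hrec := recordIndices_congr_abs habs n
  have h1 := countP_positive_roots_partialPoly_le hk₀ h₀ hγ hγ1 hE
  have h2 := countP_positive_roots_partialPoly_le (a := fun k => (-1) ^ k * a k) hk₀
    (by simpa using h₀) (D := D) (E := E) hγ hγ1 (by rw [hrec]; exact hE)
  rw [hrec] at h2
  have h3 := count_zero_roots_le hk₀ h₀
  have h4 : realRootCount a n ≤ (partialPoly a n).roots.count 0 +
      (partialPoly a n).roots.countP (0 < ·) +
      (partialPoly (fun k => (-1) ^ k * a k) n).roots.countP (0 < ·) := by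
    rw [← partialPoly_comp_neg_X, roots_comp_neg_X, Multiset.countP_map,
      ← Multiset.countP_eq_card_filter, Multiset.count]
    have := Multiset.countP_le_add_countP (p := fun _ => True) (q := fun x : ℝ => 0 = x)
      (r := fun x => 0 < x) (u := fun x => 0 < -x) (partialPoly a n).roots (fun x _ _ => by
        rcases lt_trichotomy x 0 with h | h | h
        · exact Or.inr (Or.inr (by linarith))
        · exact Or.inl h.symm
        · exact Or.inr (Or.inl h))
    simpa [realRootCount] using this
  have h5 : (realRootCount a n : ℝ) ≤ ((partialPoly a n).roots.count 0 : ℝ) +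
      (partialPoly a n).roots.countP (0 < ·) +
      (partialPoly (fun k => (-1) ^ k * a k) n).roots.countP (0 < ·) := by exact_mod_cast h4
  have h6 : ((partialPoly a n).roots.count 0 : ℝ) ≤ k₀ := by exact_mod_cast h3
  linarith

/-! ### Records of exchangeable sequences -/

/-- The law of a random sequence is invariant under permutations of the indices. -/
def IsExchangeable (ν : Measure (ℕ → ℝ)) : Prop :=
  ∀ σ : Equiv.Perm ℕ, MeasurePreserving (fun a : ℕ → ℝ => a ∘ σ) ν ν

theorem measurableSet_isRecord (k : ℕ) : MeasurableSet {a : ℕ → ℝ | IsRecord a k} := by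
  simp only [IsRecord, Set.ofPred_forall]
  exact MeasurableSet.iInter fun i => MeasurableSet.iInter fun _ =>
    measurableSet_lt (by fun_prop) (by fun_prop)

theorem swap_le {i k j : ℕ} (hi : i ≤ k) (hj : j ≤ k) : Equiv.swap i k j ≤ k := by
  rw [Equiv.swap_apply_def]; split_ifs <;> omega

theorem abs_lt_of_isRecord_swap {a : ℕ → ℝ} {i j k : ℕ} (hi : i ≤ k) (hj : j ≤ k) (hij : j ≠ i)
    (h : IsRecord (a ∘ Equiv.swap i k) k) : |a j| < |a i| := by
  have h1 : Equiv.swap i k j ≠ k := fun h2 => hij (by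
    have := congrArg (Equiv.swap i k) h2
    simpa using this)
  have h2 := h _ (lt_of_le_of_ne (swap_le hi hj) h1)
  simpa using h2

theorem isRecord_swap_iff {a : ℕ → ℝ} {i m k : ℕ} (hi : i ≤ m) (hm : m < k) :
    IsRecord (a ∘ Equiv.swap i m) k ↔ IsRecord a k := by
  have hk : Equiv.swap i m k = k := Equiv.swap_apply_of_ne_of_ne (by omega) (by omega)
  have hlt : ∀ j < k, Equiv.swap i m j < k := fun j hj => by
    rw [Equiv.swap_apply_def]; split_ifs <;> omega
  constructor
  · intro h j hj
    have := h _ (hlt j hj)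
    simpa [hk] using this
  · intro h j hj
    simp only [Function.comp_apply, hk]
    exact h _ (hlt j hj)

/-- The events that `|a i|` is strictly largest among the indices up to `k` are disjoint for
different `i ≤ k`. By exchangeability and invariance of `F` they carry equal integrals. -/
theorem mul_setLIntegral_isRecord_le {ν : Measure (ℕ → ℝ)} (hν : IsExchangeable ν) (k : ℕ)
    {F : (ℕ → ℝ) → ENNReal} (hF : Measurable F)
    (hinv : ∀ i ≤ k, ∀ a, F (a ∘ Equiv.swap i k) = F a) :
    (k + 1 : ENNReal) * ∫⁻ a in {a | IsRecord a k}, F a ∂ν ≤ ∫⁻ a, F a ∂ν := by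
  have hmeas : ∀ i, MeasurableSet {a : ℕ → ℝ | IsRecord (a ∘ Equiv.swap i k) k} := fun i =>
    (hν (Equiv.swap i k)).measurable (measurableSet_isRecord k)
  have h1 : ∀ i ∈ Finset.range (k + 1), ∫⁻ a in {a | IsRecord a k}, F a ∂ν =
      ∫⁻ a in {a | IsRecord (a ∘ Equiv.swap i k) k}, F a ∂ν := by
    intro i hi
    have hi' : i ≤ k := Nat.lt_succ_iff.1 (Finset.mem_range.1 hi)
    rw [← (hν (Equiv.swap i k)).setLIntegral_comp_preimage (measurableSet_isRecord k) hF]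
    simp only [hinv i hi']
    rfl
  have h2 : (k + 1 : ENNReal) * ∫⁻ a in {a | IsRecord a k}, F a ∂ν =
      ∑ i ∈ Finset.range (k + 1), ∫⁻ a in {a | IsRecord (a ∘ Equiv.swap i k) k}, F a ∂ν := by
    rw [← Finset.sum_congr rfl h1, Finset.sum_const, Finset.card_range, nsmul_eq_mul]
    push_cast; rfl
  rw [h2, ← lintegral_biUnion_finset _ fun i _ => hmeas i]
  · exact setLIntegral_le_lintegral _ _
  · intro i hi j hj hij
    rw [Function.onFun, Set.disjoint_left]
    intro a ha hb
    have hi' : i ≤ k := Nat.lt_succ_iff.1 (Finset.mem_range.1 hi)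
    have hj' : j ≤ k := Nat.lt_succ_iff.1 (Finset.mem_range.1 hj)
    exact lt_asymm (abs_lt_of_isRecord_swap hi' hj' hij.symm ha)
      (abs_lt_of_isRecord_swap hj' hi' hij hb)

/-- The weight `1 + x` of a record at `k`. -/
noncomputable def recordWeight (x : ENNReal) (k : ℕ) (a : ℕ → ℝ) : ENNReal :=
  1 + Set.indicator {a | IsRecord a k} (fun _ => x) a

theorem measurable_recordWeight (x : ENNReal) (k : ℕ) : Measurable (recordWeight x k) :=
  (measurable_const (a := x)).indicator (measurableSet_isRecord k) |>.const_add 1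

theorem recordWeight_swap (x : ENNReal) {i m k : ℕ} (hi : i ≤ m) (hm : m < k) (a : ℕ → ℝ) :
    recordWeight x k (a ∘ Equiv.swap i m) = recordWeight x k a := by
  by_cases h : IsRecord a k
  · simp [recordWeight, h, (isRecord_swap_iff hi hm).2 h]
  · simp [recordWeight, h, mt (isRecord_swap_iff hi hm).1 h]

/-- Peel off the smallest index `m`: later records are unaffected by permuting the entries up to
`m`, so the product over them is an admissible `F`. This replaces independence of the records, which
ties would spoil. -/
theorem lintegral_prod_recordWeight_le {ν : Measure (ℕ → ℝ)} [IsProbabilityMeasure ν]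
    (hν : IsExchangeable ν) (x : ENNReal) (T : Finset ℕ) :
    ∫⁻ a, ∏ k ∈ T, recordWeight x k a ∂ν ≤ ∏ k ∈ T, (1 + x * (k + 1 : ENNReal)⁻¹) := by
  induction T using Finset.induction_on_min with
  | empty => simp
  | insert m s hm ih =>
    have hms : m ∉ s := fun h => lt_irrefl m (hm m h)
    simp only [Finset.prod_insert hms]
    set F : (ℕ → ℝ) → ENNReal := fun a => ∏ k ∈ s, recordWeight x k a with hF
    have hFm : Measurable F := Finset.measurable_prod s fun k _ => measurable_recordWeight x k
    have h1 := mul_setLIntegral_isRecord_le hν m hFm fun i hi a =>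
      Finset.prod_congr rfl fun k hk => recordWeight_swap x hi (hm k hk) a
    have hm0 : (m + 1 : ENNReal) ≠ 0 := by positivity
    have hmt : (m + 1 : ENNReal) ≠ ⊤ := by simp
    have h2 : ∫⁻ a in {a | IsRecord a m}, F a ∂ν ≤ (m + 1 : ENNReal)⁻¹ * ∫⁻ a, F a ∂ν := by
      rw [← ENNReal.mul_le_mul_iff_right hm0 hmt, ← mul_assoc, ENNReal.mul_inv_cancel hm0 hmt,
        one_mul]
      exact h1
    have h3 : ∀ a, recordWeight x m a * F a =
        F a + x * Set.indicator {a | IsRecord a m} F a := fun a => by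
      rw [recordWeight, add_mul, one_mul]
      by_cases h : a ∈ {a | IsRecord a m}
      · rw [Set.indicator_of_mem h, Set.indicator_of_mem h]
      · rw [Set.indicator_of_notMem h, Set.indicator_of_notMem h, mul_zero, zero_mul]
    calc ∫⁻ a, recordWeight x m a * F a ∂ν
        = ∫⁻ a, F a ∂ν + x * ∫⁻ a in {a | IsRecord a m}, F a ∂ν := by
          simp only [h3]
          rw [lintegral_add_left hFm, lintegral_const_mul _
            (hFm.indicator (measurableSet_isRecord m)),
            lintegral_indicator (measurableSet_isRecord m)]
      _ ≤ ∫⁻ a, F a ∂ν + x * ((m + 1 : ENNReal)⁻¹ * ∫⁻ a, F a ∂ν) := by gcongr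
      _ = (1 + x * (m + 1 : ENNReal)⁻¹) * ∫⁻ a, F a ∂ν := by ring
      _ ≤ _ := by gcongr

/-- The number of records with indices in `T`. -/
noncomputable def recordCount (T : Finset ℕ) (a : ℕ → ℝ) : ℕ :=
  (@Finset.filter ℕ (IsRecord a) (Classical.decPred _) T).card

theorem prod_recordWeight_eq (x : ENNReal) (T : Finset ℕ) (a : ℕ → ℝ) :
    ∏ k ∈ T, recordWeight x k a = (1 + x) ^ recordCount T a := by
  classical
  have h : ∀ k, recordWeight x k a = if IsRecord a k then 1 + x else 1 := fun k => by
    by_cases h : IsRecord a k <;> simp [recordWeight, h]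
  simp only [h]
  rw [Finset.prod_ite, Finset.prod_const_one, mul_one, Finset.prod_const, recordCount]

/-- Chernoff bound with weight `1 + x = exp r` per record. -/
theorem measure_le_recordCount_le {ν : Measure (ℕ → ℝ)} [IsProbabilityMeasure ν]
    (hν : IsExchangeable ν) (T : Finset ℕ) {r : ℝ} (hr : 0 ≤ r) (m : ℝ) :
    ν {a | m ≤ recordCount T a} ≤
      ENNReal.ofReal (Real.exp (Real.exp r * ∑ k ∈ T, ((k : ℝ) + 1)⁻¹ - r * m)) := by
  set x : ℝ := Real.exp r - 1 with hx
  have hx0 : 0 ≤ x := by rw [hx, sub_nonneg]; exact Real.one_le_exp hr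
  have h1x : (1 : ENNReal) + ENNReal.ofReal x = ENNReal.ofReal (Real.exp r) := by
    rw [← ENNReal.ofReal_one, ← ENNReal.ofReal_add zero_le_one hx0, hx]; congr 1; ring
  have hsub : {a | m ≤ recordCount T a} ⊆
      {a | ENNReal.ofReal (Real.exp (r * m)) ≤ ∏ k ∈ T, recordWeight (ENNReal.ofReal x) k a} := by
    intro a ha
    rw [Set.mem_ofPred_eq, prod_recordWeight_eq, h1x, ← ENNReal.ofReal_pow (Real.exp_pos r).le,
      ← Real.exp_nat_mul]
    refine ENNReal.ofReal_le_ofReal (Real.exp_le_exp.2 ?_)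
    rw [mul_comm r m]
    exact mul_le_mul_of_nonneg_right ha hr
  have hmk := mul_meas_ge_le_lintegral (μ := ν)
    (Finset.measurable_prod T fun k _ => measurable_recordWeight (ENNReal.ofReal x) k)
    (ENNReal.ofReal (Real.exp (r * m)))
  have hprod : ∏ k ∈ T, (1 + ENNReal.ofReal x * (k + 1 : ENNReal)⁻¹) ≤
      ENNReal.ofReal (Real.exp (Real.exp r * ∑ k ∈ T, ((k : ℝ) + 1)⁻¹)) := by
    rw [Finset.mul_sum, Real.exp_sum, ENNReal.ofReal_prod_of_nonneg fun k _ => (Real.exp_pos _).le]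
    refine Finset.prod_le_prod' fun k _ => ?_
    have e1 : (k + 1 : ENNReal)⁻¹ = ENNReal.ofReal (((k : ℝ) + 1)⁻¹) := by
      rw [ENNReal.ofReal_inv_of_pos (by positivity), ENNReal.ofReal_add (by positivity) zero_le_one]
      simp
    rw [e1, ← ENNReal.ofReal_mul hx0, ← ENNReal.ofReal_one,
      ← ENNReal.ofReal_add zero_le_one (by positivity)]
    refine ENNReal.ofReal_le_ofReal ?_
    have h2 := Real.add_one_le_exp (Real.exp r * ((k : ℝ) + 1)⁻¹)
    have h3 : x * ((k : ℝ) + 1)⁻¹ ≤ Real.exp r * ((k : ℝ) + 1)⁻¹ := by gcongr; linarith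
    linarith
  have hall := ((mul_le_mul_right (measure_mono hsub) _).trans hmk).trans
    ((lintegral_prod_recordWeight_le hν _ T).trans hprod)
  rw [Real.exp_sub, ENNReal.ofReal_div_of_pos (Real.exp_pos _), ENNReal.le_div_iff_mul_le
    (Or.inl (by positivity)) (Or.inl ENNReal.ofReal_ne_top), mul_comm]
  exact hall

/-- The hypothesis makes the `n`-th probability at most `exp C / n ^ 2`, so Borel–Cantelli applies.
The permutations `σ n` allow records to be read from the other end. -/
theorem ae_eventually_recordCount_lt {ν : Measure (ℕ → ℝ)} [IsProbabilityMeasure ν]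
    (hν : IsExchangeable ν) (σ : ℕ → Equiv.Perm ℕ) (T : ℕ → Finset ℕ) (m : ℕ → ℝ) {r C : ℝ}
    (hr : 0 ≤ r)
    (h : ∀ n : ℕ, 1 ≤ n → Real.exp r * ∑ k ∈ T n, ((k : ℝ) + 1)⁻¹ ≤
      C - 2 * Real.log n + r * m n) :
    ∀ᵐ a ∂ν, ∀ᶠ n in atTop, (recordCount (T n) (a ∘ σ n) : ℝ) < m n := by
  have hb : ∀ n : ℕ, 1 ≤ n → ν {a | m n ≤ recordCount (T n) (a ∘ σ n)} ≤
      ENNReal.ofReal (Real.exp C * (1 / (n : ℝ) ^ 2)) := by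
    intro n hn
    have hn' : (0 : ℝ) < n := by exact_mod_cast hn
    have e : ν {a | m n ≤ recordCount (T n) (a ∘ σ n)} ≤
        ν {a | m n ≤ recordCount (T n) a} :=
      (hν (σ n)).measure_preimage_le _
    refine (e.trans (measure_le_recordCount_le hν (T n) hr (m n))).trans
      (ENNReal.ofReal_le_ofReal ?_)
    have e2 : Real.exp C * (1 / (n : ℝ) ^ 2) = Real.exp (C - 2 * Real.log n) := by
      rw [Real.exp_sub, two_mul, Real.exp_add, Real.exp_log hn']; ring
    rw [e2]
    exact Real.exp_le_exp.2 (by linarith [h n hn])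
  have hsum : ∑' n : ℕ, ν {a | m (n + 1) ≤ recordCount (T (n + 1)) (a ∘ σ (n + 1))} ≠ ⊤ := by
    refine ne_top_of_le_ne_top ?_ (ENNReal.tsum_le_tsum fun n : ℕ => hb (n + 1) (by omega))
    have hs : Summable fun n : ℕ => Real.exp C * (1 / (((n + 1 : ℕ) : ℝ)) ^ 2) :=
      ((summable_nat_add_iff 1).2 (Real.summable_one_div_nat_pow.2 one_lt_two)).mul_left _
    exact hs.tsum_ofReal_ne_top
  filter_upwards [ae_eventually_notMem hsum] with a ha
  rw [← map_add_atTop_eq_nat 1, eventually_map]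
  exact ha.mono fun n hn => not_le.1 hn

theorem inv_le_log_sub_log (k : ℕ) : ((k : ℝ) + 1 + 1)⁻¹ ≤ Real.log (k + 1 + 1) - Real.log (k + 1) := by
  have h1 : (0 : ℝ) < k + 1 := by positivity
  have h2 : (0 : ℝ) < k + 1 + 1 := by positivity
  have h := Real.one_sub_inv_le_log_of_pos (div_pos h2 h1)
  rw [Real.log_div h2.ne' h1.ne'] at h
  refine le_trans (le_of_eq ?_) h
  field_simp
  ring

theorem sum_Ioc_inv_le {D n : ℕ} (h : D ≤ n) :
    ∑ k ∈ Finset.Ioc D n, ((k : ℝ) + 1)⁻¹ ≤ Real.log (n + 1) - Real.log (D + 1) := by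
  induction n, h using Nat.le_induction with
  | base => simp
  | succ n hn ih =>
    rw [← Finset.insert_Ioc_right_eq_Ioc_add_one (by omega), Finset.sum_insert (by simp)]
    have := inv_le_log_sub_log n
    push_cast
    linarith

theorem sum_range_inv_le (n : ℕ) :
    ∑ k ∈ Finset.range (n + 1), ((k : ℝ) + 1)⁻¹ ≤ 1 + Real.log (n + 1) := by
  induction n with
  | zero => simp
  | succ n ih =>
    rw [Finset.sum_range_succ]
    have := inv_le_log_sub_log n
    push_cast at *
    linarith

/-- `reflect n` as a permutation. -/
def reflectPerm (n : ℕ) : Equiv.Perm ℕ :=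
  Function.Involutive.toPerm (reflect n) fun k => by
    unfold reflect; split_ifs <;> omega

theorem card_le_recordCount_add_recordCount {a : ℕ → ℝ} {n : ℕ} {U T : Finset ℕ}
    (hU : U ⊆ recordIndices a n) (h1 : U ⊆ T) (h2 : ∀ w ∈ U, n - w ∈ T) :
    U.card ≤ recordCount T a + recordCount T (a ∘ reflectPerm n) := by
  classical
  have hsub : U ⊆ @Finset.filter ℕ (IsRecord a) (Classical.decPred _) T ∪
      (@Finset.filter ℕ (IsRecord (a ∘ reflectPerm n)) (Classical.decPred _) T).image
        (n - ·) := by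
    intro w hw
    have hwn := le_of_mem_recordIndices (hU hw)
    rcases (mem_recordIndices.1 (hU hw)).2 with h | h
    · exact Finset.mem_union_left _ (Finset.mem_filter.2 ⟨h1 hw, h⟩)
    · exact Finset.mem_union_right _ (Finset.mem_image.2
        ⟨n - w, Finset.mem_filter.2 ⟨h2 w hw, h⟩, by omega⟩)
  exact (Finset.card_le_card hsub).trans ((Finset.card_union_le _ _).trans
    (Nat.add_le_add_left Finset.card_image_le _))

/-! ### Choice of parameters and the almost sure limit. -/

theorem realRootCount_le_mul {a : ℕ → ℝ} {n k₀ D : ℕ} (h₀ : a k₀ ≠ 0) (hk₀n : k₀ ≤ n)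
    {γ E : ℝ} (hγ : 0 < γ) (hγ1 : γ ≤ 1 / 24) (hk₀ : k₀ ≤ γ ^ 3 * n) (hD : D ≤ γ ^ 3 * n)
    (hE1 : 1 ≤ E) (hE2 : E ^ 2 ≤ γ ^ 3 * n) (hL : Real.log (n + 1) ≤ E)
    (hS : ((recordIndices a n).card * D : ℝ) ≤ γ ^ 3 * n)
    (hE : Real.exp (600 * ((midIndices (recordIndices a n) n D).card + 1) / γ ^ 3) ≤ E) :
    (realRootCount a n : ℝ) ≤ 1000 * γ * n := by
  have h := realRootCount_le (D := D) hk₀n h₀ hγ hγ1 hE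
  set L := Real.log ((n : ℝ) + 1)
  set s : ℝ := (recordIndices a n).card * D
  set N : ℝ := (n : ℝ) with hN
  have hN0 : 0 ≤ N := Nat.cast_nonneg n
  have hE3 : E ≤ γ ^ 3 * N := by nlinarith
  have hg2 : γ ^ 2 ≤ γ / 24 := by nlinarith
  have hg3 : γ ^ 3 ≤ γ / 24 := by nlinarith [pow_pos hγ 2]
  have hs0 : 0 ≤ s := by positivity
  have e1 : γ ^ 3 * (s + N) ≤ 2 * (γ ^ 3 * N) := by
    have h1 : γ ^ 3 ≤ 1 := by linarith
    have : γ ^ 3 * s ≤ s := mul_le_of_le_one_left hs0 h1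
    linarith
  have e2 : E * (2 + 4 / γ) * (E + L) ≤ (2 + 4 / γ) * (2 * (γ ^ 3 * N)) := by
    have h1 : E * (E + L) ≤ 2 * (γ ^ 3 * N) := by nlinarith
    have h2 : 0 ≤ 2 + 4 / γ := by positivity
    calc E * (2 + 4 / γ) * (E + L) = (2 + 4 / γ) * (E * (E + L)) := by ring
      _ ≤ _ := by gcongr
  have e3 : (4 + 4 / γ) * (E + γ ^ 3 * (s + N) + L) ≤ (4 + 4 / γ) * (4 * (γ ^ 3 * N)) := by
    gcongr; linarith
  -- The prefactors cost `γ ^ (-2)`; this is why all errors are kept at the order `γ ^ 3 * n`.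
  have e4 : 8 / γ * (E * (2 + 4 / γ) * (E + L) + (4 + 4 / γ) * (E + γ ^ 3 * (s + N) + L)) ≤
      160 * (γ ^ 2 * N) + 192 * (γ * N) := by
    refine (mul_le_mul_of_nonneg_left (add_le_add e2 e3) (by positivity)).trans (le_of_eq ?_)
    field_simp; ring
  have e5 : γ ^ 2 * N ≤ γ / 24 * N := by gcongr
  have e6 : γ ^ 3 * N ≤ γ / 24 * N := by gcongr
  have e7 : 0 ≤ γ * N := by positivity
  nlinarith

theorem eventually_realRootCount_le {a : ℕ → ℝ} {k₀ : ℕ} (h₀ : a k₀ ≠ 0) {γ c : ℝ}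
    (hγ : 0 < γ) (hγ1 : γ ≤ 1 / 24) (hc : 0 < c) {D : ℕ → ℕ}
    (hD : ∀ n, (D n : ℝ) ≤ (n : ℝ) ^ (1 - c))
    (hmid : ∀ᶠ n in atTop, ((midIndices (recordIndices a n) n (D n)).card : ℝ) ≤
      2 * (γ ^ 3 / 9600 * Real.log n))
    (hall : ∀ᶠ n in atTop, ((recordIndices a n).card : ℝ) ≤ 2 * (10 * Real.log n)) :
    ∀ᶠ n in atTop, (realRootCount a n : ℝ) ≤ 1000 * γ * n := by
  have hg3 : 0 < γ ^ 3 := by positivity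
  have hcast : Tendsto (fun n : ℕ => (n : ℝ)) atTop atTop := tendsto_natCast_atTop_atTop
  have t1 : ∀ᶠ n : ℕ in atTop, (k₀ : ℝ) / γ ^ 3 ≤ n := hcast.eventually_ge_atTop _
  have t2 : ∀ᶠ n : ℕ in atTop, ‖Real.log n‖ ≤ γ ^ 3 / 20 * ‖(n : ℝ) ^ c‖ :=
    hcast.eventually ((isLittleO_log_rpow_atTop hc).def (by positivity))
  have t3 : ∀ᶠ n : ℕ in atTop, ‖Real.log n‖ ≤ 1 / 2 * ‖(n : ℝ) ^ (1 / 4 : ℝ)‖ :=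
    hcast.eventually ((isLittleO_log_rpow_atTop (by norm_num)).def (by positivity))
  have t4 : ∀ᶠ n : ℕ in atTop, max 2 (600 / γ ^ 3 * 8) ≤ Real.log n :=
    (Real.tendsto_log_atTop.comp hcast).eventually_ge_atTop _
  have t5 : ∀ᶠ n : ℕ in atTop, (1 / γ ^ 3) ≤ (n : ℝ) ^ (1 / 2 : ℝ) :=
    ((tendsto_rpow_atTop (by norm_num)).comp hcast).eventually_ge_atTop _
  filter_upwards [t1, t2, t3, t4, t5, hmid, hall, eventually_ge_atTop k₀, eventually_ge_atTop 2]
    with n h1 h2 h3 h4 h5 h6 h7 h8 h9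
  have hn : (2 : ℝ) ≤ n := by exact_mod_cast h9
  have hn0 : (0 : ℝ) < n := by linarith
  have hlog2 : 2 ≤ Real.log n := (le_max_left _ _).trans h4
  have hlogg : 600 / γ ^ 3 * 8 ≤ Real.log n := (le_max_right _ _).trans h4
  have hlog0 : 0 ≤ Real.log n := by linarith
  have hrp : ∀ x : ℝ, 0 < (n : ℝ) ^ x := fun x => Real.rpow_pos_of_pos hn0 x
  rw [Real.norm_of_nonneg hlog0, Real.norm_of_nonneg (hrp _).le] at h2 h3
  have hDn : Real.log n * 20 * D n ≤ γ ^ 3 * n := by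
    calc Real.log n * 20 * D n ≤ γ ^ 3 / 20 * (n : ℝ) ^ c * 20 * (n : ℝ) ^ (1 - c) := by
          gcongr; exact hD n
      _ = γ ^ 3 * ((n : ℝ) ^ c * (n : ℝ) ^ (1 - c)) := by ring
      _ = γ ^ 3 * n := by rw [← Real.rpow_add hn0]; norm_num
  have hD0 : (0 : ℝ) ≤ D n := Nat.cast_nonneg _
  refine realRootCount_le_mul (D := D n) (E := (n : ℝ) ^ (1 / 4 : ℝ)) h₀ h8 hγ hγ1 ?_ ?_ ?_ ?_ ?_
    ?_ ?_
  · rwa [div_le_iff₀' hg3] at h1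
  · nlinarith
  · exact Real.one_le_rpow (by linarith) (by norm_num)
  · rw [div_le_iff₀' hg3] at h5
    have e : ((n : ℝ) ^ (1 / 4 : ℝ)) ^ 2 = (n : ℝ) ^ (1 / 2 : ℝ) := by
      rw [← Real.rpow_natCast, ← Real.rpow_mul hn0.le]; norm_num
    have e2 : (n : ℝ) ^ (1 / 2 : ℝ) * (n : ℝ) ^ (1 / 2 : ℝ) = n := by
      rw [← Real.rpow_add hn0]; norm_num
    rw [e]
    nlinarith [hrp (1 / 2)]
  · have e : Real.log ((n : ℝ) + 1) ≤ 2 * Real.log n := by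
      rw [two_mul, ← Real.log_mul hn0.ne' hn0.ne']
      exact Real.log_le_log (by positivity) (by nlinarith)
    linarith
  · refine le_trans ?_ hDn
    gcongr
    linarith
  · rw [Real.rpow_def_of_pos hn0]
    refine Real.exp_le_exp.2 ?_
    calc 600 * (((midIndices (recordIndices a n) n (D n)).card : ℝ) + 1) / γ ^ 3
        ≤ 600 * (2 * (γ ^ 3 / 9600 * Real.log n) + 1) / γ ^ 3 := by gcongr
      _ = Real.log n / 8 + 600 / γ ^ 3 := by field_simp; ring
      _ ≤ Real.log n * (1 / 4) := by linarith

theorem ae_eventually_realRootCount_le {ν : Measure (ℕ → ℝ)} [IsProbabilityMeasure ν]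
    (hν : IsExchangeable ν) {γ : ℝ} (hγ : 0 < γ) (hγ1 : γ ≤ 1 / 24) :
    ∀ᵐ a ∂ν, (∃ k, a k ≠ 0) → ∀ᶠ n in atTop, (realRootCount a n : ℝ) ≤ 1000 * γ * n := by
  -- With at most `2 * κ * log n` middle records the exponent `600 * (K + 1) / γ ^ 3` is `log n / 8`
  -- plus a constant, hence eventually at most `log n / 4`; so `E = n ^ (1 / 4)` will do.
  set κ : ℝ := γ ^ 3 / 9600 with hκ
  have hκ0 : 0 < κ := by positivity
  set r : ℝ := 3 / κ with hr
  have hr0 : 0 < r := by positivity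
  -- The harmonic sum over `(n ^ (1 - c), n]` is at most `1 + c * log n`, and `exp r * c = 1` turns
  -- this into `log n` plus a constant. Since `r * κ = 3`, the Chernoff exponent retains the `-2 *
  -- log n` needed for summability.
  set c : ℝ := Real.exp (-r) with hc
  have hc0 : 0 < c := Real.exp_pos _
  have hc1 : c < 1 := Real.exp_lt_one_iff.2 (by linarith)
  have hrc : Real.exp r * c = 1 := by rw [hc, ← Real.exp_add]; simp
  set D : ℕ → ℕ := fun n => ⌊(n : ℝ) ^ (1 - c)⌋₊ with hDdef
  have hD : ∀ n, (D n : ℝ) ≤ (n : ℝ) ^ (1 - c) := fun n =>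
    Nat.floor_le (Real.rpow_nonneg (Nat.cast_nonneg n) _)
  have hlog1 : ∀ n : ℕ, 1 ≤ n → 0 ≤ Real.log n ∧ Real.log ((n : ℝ) + 1) ≤ 1 + Real.log n := by
    intro n hn
    have hn' : (1 : ℝ) ≤ n := by exact_mod_cast hn
    refine ⟨Real.log_nonneg hn', ?_⟩
    have h1 : Real.log ((n : ℝ) + 1) ≤ Real.log (2 * n) :=
      Real.log_le_log (by positivity) (by linarith)
    rw [Real.log_mul two_ne_zero (by positivity)] at h1
    have h2 := Real.log_two_lt_d9
    linarith
  have hA : ∀ n : ℕ, 1 ≤ n → Real.exp r * ∑ k ∈ Finset.Ioc (D n) n, ((k : ℝ) + 1)⁻¹ ≤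
      Real.exp r - 2 * Real.log n + r * (κ * Real.log n) := by
    intro n hn
    have hn' : (1 : ℝ) ≤ n := by exact_mod_cast hn
    have hDn : D n ≤ n := by
      have : (D n : ℝ) ≤ n := (hD n).trans (by
        calc (n : ℝ) ^ (1 - c) ≤ (n : ℝ) ^ (1 : ℝ) :=
              Real.rpow_le_rpow_of_exponent_le hn' (by linarith)
          _ = n := Real.rpow_one _)
      exact_mod_cast this
    have h1 : (1 - c) * Real.log n ≤ Real.log ((D n : ℝ) + 1) := by
      rw [← Real.log_rpow (by linarith)]
      exact Real.log_le_log (Real.rpow_pos_of_pos (by linarith) _) (Nat.lt_floor_add_one _).le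
    have h2 := sum_Ioc_inv_le hDn
    obtain ⟨h3, h4⟩ := hlog1 n hn
    have h5 : ∑ k ∈ Finset.Ioc (D n) n, ((k : ℝ) + 1)⁻¹ ≤ 1 + c * Real.log n := by linarith
    have h6 := mul_le_mul_of_nonneg_left h5 (Real.exp_pos r).le
    have h7 : r * (κ * Real.log n) = 3 * Real.log n := by rw [hr]; field_simp
    have h8 : Real.exp r * (1 + c * Real.log n) = Real.exp r + Real.log n := by
      rw [mul_add, ← mul_assoc, hrc]; ring
    linarith
  have hB : ∀ n : ℕ, 1 ≤ n → Real.exp 1 * ∑ k ∈ Finset.range (n + 1), ((k : ℝ) + 1)⁻¹ ≤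
      6 - 2 * Real.log n + 1 * (10 * Real.log n) := by
    intro n hn
    obtain ⟨h3, h4⟩ := hlog1 n hn
    have h5 := sum_range_inv_le n
    have h6 : Real.exp 1 ≤ 3 := (Real.exp_one_lt_d9.trans (by norm_num)).le
    have h7 : Real.exp 1 * ∑ k ∈ Finset.range (n + 1), ((k : ℝ) + 1)⁻¹ ≤
        3 * (2 + Real.log n) := by
      refine mul_le_mul h6 (by linarith) ?_ (by norm_num)
      exact Finset.sum_nonneg fun k _ => by positivity
    linarith
  filter_upwards [ae_eventually_recordCount_lt hν (fun _ => 1) _ _ hr0.le hA,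
    ae_eventually_recordCount_lt hν reflectPerm _ _ hr0.le hA,
    ae_eventually_recordCount_lt hν (fun _ => 1) _ _ zero_le_one hB,
    ae_eventually_recordCount_lt hν reflectPerm _ _ zero_le_one hB] with a h1 h2 h3 h4
  rintro ⟨k₀, h₀⟩
  refine eventually_realRootCount_le h₀ hγ hγ1 hc0 hD ?_ ?_
  · filter_upwards [h1, h2] with n g1 g2
    have := card_le_recordCount_add_recordCount (a := a) (n := n)
      (U := midIndices (recordIndices a n) n (D n)) (T := Finset.Ioc (D n) n)
      (Finset.filter_subset _ _)
      (fun w hw => by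
        obtain ⟨u1, u2, u3⟩ := Finset.mem_filter.1 hw
        exact Finset.mem_Ioc.2 ⟨u2, by omega⟩)
      (fun w hw => by
        obtain ⟨u1, u2, u3⟩ := Finset.mem_filter.1 hw
        exact Finset.mem_Ioc.2 ⟨by omega, by omega⟩)
    have h : ((midIndices (recordIndices a n) n (D n)).card : ℝ) ≤
        recordCount (Finset.Ioc (D n) n) a +
          recordCount (Finset.Ioc (D n) n) (a ∘ reflectPerm n) := by exact_mod_cast this
    have e : a ∘ (1 : Equiv.Perm ℕ) = a := rfl
    rw [e] at g1
    rw [← hκ]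
    linarith
  · filter_upwards [h3, h4] with n g1 g2
    have := card_le_recordCount_add_recordCount (a := a) (n := n)
      (U := recordIndices a n) (T := Finset.range (n + 1)) subset_rfl
      (fun w hw => (mem_recordIndices.1 hw).1)
      (fun w hw => Finset.mem_range.2 (by omega))
    have h : ((recordIndices a n).card : ℝ) ≤ recordCount (Finset.range (n + 1)) a +
        recordCount (Finset.range (n + 1)) (a ∘ reflectPerm n) := by exact_mod_cast this
    have e : a ∘ (1 : Equiv.Perm ℕ) = a := rfl
    rw [e] at g1
    linarith

theorem ae_tendsto_realRootCount_div {ν : Measure (ℕ → ℝ)} [IsProbabilityMeasure ν]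
    (hν : IsExchangeable ν) (hne : ∀ᵐ a ∂ν, ∃ k, a k ≠ 0) :
    ∀ᵐ a ∂ν, Tendsto (fun n : ℕ => (realRootCount a n : ℝ) / n) atTop (𝓝 0) := by
  have h : ∀ m : ℕ, ∀ᵐ a ∂ν, (∃ k, a k ≠ 0) →
      ∀ᶠ n in atTop, (realRootCount a n : ℝ) ≤ 1000 * (1 / ((m : ℝ) + 24)) * n := fun m =>
    ae_eventually_realRootCount_le hν (by positivity)
      (one_div_le_one_div_of_le (by norm_num) (by linarith [(Nat.cast_nonneg m : (0 : ℝ) ≤ m)]))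
  filter_upwards [ae_all_iff.2 h, hne] with a ha hk
  rw [Metric.tendsto_nhds]
  intro ε hε
  obtain ⟨m, hm⟩ := exists_nat_gt (1000 / ε)
  filter_upwards [ha m hk, eventually_gt_atTop 0] with n h1 h2
  have hn : (0 : ℝ) < n := by exact_mod_cast h2
  rw [Real.dist_eq, sub_zero, abs_of_nonneg (by positivity), div_lt_iff₀ hn]
  refine h1.trans_lt ?_
  gcongr
  rw [mul_one_div, div_lt_iff₀ (by positivity)]
  rw [div_lt_iff₀ hε] at hm
  nlinarith

/-! ### Measurability of the number of real roots -/

theorem continuous_coeff_mul {T : Type*} [TopologicalSpace T] {p q : T → ℝ[X]}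
    (hp : ∀ k, Continuous fun t => (p t).coeff k) (hq : ∀ k, Continuous fun t => (q t).coeff k)
    (k : ℕ) : Continuous fun t => (p t * q t).coeff k := by
  simp only [coeff_mul]
  exact continuous_finsetSum _ fun i _ => (hp _).mul (hq _)

theorem continuous_coeff_prod {T ι : Type*} [TopologicalSpace T] (s : Finset ι)
    {p : ι → T → ℝ[X]} (hp : ∀ i k, Continuous fun t => (p i t).coeff k) (k : ℕ) :
    Continuous fun t => (∏ i ∈ s, p i t).coeff k := by
  classical
  induction s using Finset.induction_on generalizing k with
  | empty => simp only [Finset.prod_empty]; exact continuous_const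
  | insert a s ha ih =>
    simp only [Finset.prod_insert ha]
    exact continuous_coeff_mul (hp a) ih k

/-- The product of the monic polynomial with roots `x` and the polynomial with coefficients `b`. -/
noncomputable def polyOfRoots {m N : ℕ} (t : (Fin m → ℝ) × (Fin N → ℝ)) : ℝ[X] :=
  (∏ i, (X - C (t.1 i))) * ∑ j : Fin N, C (t.2 j) * X ^ (j : ℕ)

theorem continuous_coeff_polyOfRoots {m N : ℕ} :
    Continuous fun t : (Fin m → ℝ) × (Fin N → ℝ) => (polyOfRoots t).coeff := by
  refine continuous_pi fun k => continuous_coeff_mul (fun k => continuous_coeff_prod _ ?_ k) ?_ k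
  · intro i k
    simp only [coeff_sub, coeff_C]
    refine continuous_const.sub ?_
    split_ifs <;> fun_prop
  · intro k
    simp only [Polynomial.finsetSum_coeff, coeff_C_mul]
    fun_prop

theorem _root_.IsSigmaCompact.measurableSet {α : Type*} [TopologicalSpace α] [T2Space α]
    [MeasurableSpace α] [OpensMeasurableSpace α] {s : Set α} (hs : IsSigmaCompact s) :
    MeasurableSet s := by
  obtain ⟨K, hK, rfl⟩ := hs
  exact MeasurableSet.iUnion fun n => (hK n).isClosed.measurableSet

/-- Splitting off `m` linear factors leaves a cofactor of degree at most `n`. This presents the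
polynomials with at least `m` roots as a continuous image of a finite-dimensional space, a σ-compact
and so measurable set of coefficient sequences. -/
theorem le_card_roots_iff {P : ℝ[X]} (hP : P ≠ 0) {n : ℕ} (hn : P.natDegree ≤ n) (m : ℕ) :
    m ≤ P.roots.card ↔ ∃ t : (Fin m → ℝ) × (Fin (n + 1) → ℝ), polyOfRoots t = P := by
  constructor
  · intro h
    obtain ⟨l, hl⟩ : ∃ l : List ℝ, (l : Multiset ℝ) = P.roots := ⟨_, Multiset.coe_toList _⟩
    have hlen : (l.take m).length = m := by
      rw [← hl, Multiset.coe_card] at h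
      rw [List.length_take, min_eq_left h]
    obtain ⟨x, hx⟩ : ∃ x : Fin m → ℝ, Finset.univ.val.map x = (l.take m : Multiset ℝ) := by
      generalize l.take m = l' at hlen
      subst hlen
      exact ⟨l'.get, by rw [Fin.univ_val_map, List.ofFn_get]⟩
    have hdvd : ∏ i, (X - C (x i)) ∣ P := by
      have h1 := (Multiset.prod_X_sub_C_dvd_iff_le_roots hP (l.take m : Multiset ℝ)).2 (by
        rw [← hl]; exact (List.take_sublist m l).subperm)
      rw [← hx, Multiset.map_map] at h1
      exact h1
    obtain ⟨q, hq⟩ := hdvd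
    have hqn : q.natDegree < n + 1 := by
      have : q.natDegree ≤ P.natDegree := natDegree_le_of_dvd ⟨_, by rw [hq, mul_comm]⟩ hP
      omega
    refine ⟨(x, fun j => q.coeff j), ?_⟩
    rw [polyOfRoots, Fin.sum_univ_eq_sum_range (fun j => C (q.coeff j) * X ^ j) (n + 1),
      ← as_sum_range_C_mul_X_pow' q hqn, ← hq]
  · rintro ⟨t, ht⟩
    have hdvd : ((Finset.univ.val.map t.1).map fun a => X - C a).prod ∣ P := by
      rw [Multiset.map_map]
      exact ⟨_, ht.symm⟩
    have := Multiset.card_le_card ((Multiset.prod_X_sub_C_dvd_iff_le_roots hP _).1 hdvd)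
    simpa using this

theorem measurable_realRootCount (n : ℕ) : Measurable fun a : ℕ → ℝ => realRootCount a n := by
  have hcoeff : Measurable fun a : ℕ → ℝ => (partialPoly a n).coeff := by
    refine measurable_pi_iff.2 fun k => ?_
    simp only [coeff_partialPoly]
    split_ifs <;> fun_prop
  refine measurable_of_Ici fun m => ?_
  rcases Nat.eq_zero_or_pos m with rfl | hm
  · simp
  have h : (fun a : ℕ → ℝ => realRootCount a n) ⁻¹' Set.Ici m =
      (fun a : ℕ → ℝ => (partialPoly a n).coeff) ⁻¹' (Set.range
        (fun t : (Fin m → ℝ) × (Fin (n + 1) → ℝ) => (polyOfRoots t).coeff) \ {0}) := by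
    ext a
    simp only [Set.mem_preimage, Set.mem_Ici, Set.mem_sdiff, Set.mem_range, Set.mem_singleton_iff]
    -- The zero polynomial also factors in this way, but its root count is `0`, so it is removed
    -- from the image.
    by_cases h0 : partialPoly a n = 0
    · simp [realRootCount, h0, hm.ne', funext_iff]
    · have h1 : (partialPoly a n).coeff ≠ 0 := fun h => h0 (by ext k; simp [h])
      rw [realRootCount, le_card_roots_iff h0 (natDegree_partialPoly_le a n)]
      simp only [h1, not_false_eq_true, and_true, Polynomial.coeff_inj]
  rw [h]
  exact hcoeff ((isSigmaCompact_range continuous_coeff_polyOfRoots).measurableSet.diff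
    (measurableSet_singleton 0))

/-! ### Independent identically distributed coefficients -/

section IID

variable {Ω : Type*} [MeasurableSpace Ω] {μ : Measure Ω}
  {η : ℕ → Ω → ℝ}

theorem map_perm_eq (hmeas : ∀ k, Measurable (η k)) (hindep : iIndepFun η μ)
    (hident : ∀ k, IdentDistrib (η k) (η 0) μ μ) (σ : Equiv.Perm ℕ) :
    μ.map (fun ω k => η (σ k) ω) = Measure.infinitePi fun _ : ℕ => μ.map (η 0) := by
  have h := (hindep.precomp σ.injective).map_fun_eq_infinitePi_map fun k => hmeas (σ k)
  simp only [(hident _).map_eq] at h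
  exact h

theorem isExchangeable_map (hmeas : ∀ k, Measurable (η k)) (hindep : iIndepFun η μ)
    (hident : ∀ k, IdentDistrib (η k) (η 0) μ μ) :
    IsExchangeable (μ.map fun ω k => η k ω) := by
  intro σ
  have hm : Measurable fun a : ℕ → ℝ => a ∘ σ :=
    measurable_pi_iff.2 fun k => measurable_pi_apply (σ k)
  refine ⟨hm, ?_⟩
  rw [Measure.map_map hm (measurable_pi_iff.2 hmeas)]
  exact (map_perm_eq hmeas hindep hident σ).trans (map_perm_eq hmeas hindep hident 1).symm

theorem ae_exists_ne_zero [IsProbabilityMeasure μ] (hmeas : ∀ k, Measurable (η k))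
    (hindep : iIndepFun η μ)
    (hident : ∀ k, IdentDistrib (η k) (η 0) μ μ) (hne : ¬ ∀ᵐ ω ∂μ, η 0 ω = 0) :
    ∀ᵐ ω ∂μ, ∃ k, η k ω ≠ 0 := by
  set p := μ (η 0 ⁻¹' {0}) with hp
  have hp1 : p < 1 := by
    refine lt_of_le_of_ne prob_le_one fun h => hne ?_
    exact (prob_compl_eq_zero_iff (hmeas 0 (measurableSet_singleton 0))).2 h
  have hle : ∀ n : ℕ, μ {ω | ¬ ∃ k, η k ω ≠ 0} ≤ p ^ n := by
    intro n
    have h := hindep.measure_inter_preimage_eq_mul (Finset.range n) (sets := fun _ => {0})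
      fun _ _ => measurableSet_singleton 0
    have hk : ∀ k ∈ Finset.range n, μ (η k ⁻¹' {0}) = p := fun k _ =>
      (hident k).measure_mem_eq (measurableSet_singleton 0)
    rw [Finset.prod_congr rfl hk, Finset.prod_const, Finset.card_range] at h
    rw [← h]
    refine measure_mono fun ω hω => ?_
    simp only [Set.mem_ofPred_eq, not_exists, not_not] at hω
    simp [hω]
  exact nonpos_iff_eq_zero.1 (ge_of_tendsto'
    (ENNReal.tendsto_pow_atTop_nhds_zero_of_lt_one hp1) hle)

theorem ae_tendsto_realRootCount [IsProbabilityMeasure μ] (hmeas : ∀ k, Measurable (η k))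
    (hindep : iIndepFun η μ)
    (hident : ∀ k, IdentDistrib (η k) (η 0) μ μ) (hne : ¬ ∀ᵐ ω ∂μ, η 0 ω = 0) :
    ∀ᵐ ω ∂μ, Tendsto (fun n : ℕ => (realRootCount (fun k => η k ω) n : ℝ) / (n : ℝ))
      atTop (𝓝 0) := by
  have hm : Measurable fun ω k => η k ω := measurable_pi_iff.2 hmeas
  have : IsProbabilityMeasure (μ.map fun ω k => η k ω) :=
    Measure.isProbabilityMeasure_map hm.aemeasurable
  refine ae_of_ae_map hm.aemeasurable (ae_tendsto_realRootCount_div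
    (isExchangeable_map hmeas hindep hident) ?_)
  refine (ae_map_iff hm.aemeasurable ?_).2 (ae_exists_ne_zero hmeas hindep hident hne)
  rw [Set.ofPred_exists]
  exact MeasurableSet.iUnion fun k =>
    (measurable_pi_apply k (measurableSet_singleton 0)).compl

theorem integrable_realRootCount [IsProbabilityMeasure μ] (hmeas : ∀ k, Measurable (η k)) (n : ℕ) :
    Integrable (fun ω => (realRootCount (fun k => η k ω) n : ℝ)) μ := by
  refine Integrable.of_bound (C := n) (measurable_from_top.comp
    ((measurable_realRootCount n).comp (measurable_pi_iff.2 hmeas))).aestronglyMeasurable ?_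
  refine Eventually.of_forall fun ω => ?_
  rw [Real.norm_of_nonneg (Nat.cast_nonneg _)]
  exact Nat.cast_le.2 (realRootCount_le_self _ n)

end IID

end RandomPolynomial

/-! ### The theorem for independent identically distributed coefficients. -/

theorem theorem4 {Ω : Type*} [MeasurableSpace Ω] (μ : Measure Ω) [IsProbabilityMeasure μ]
    (η : ℕ → Ω → ℝ)
    (hmeas : ∀ k, Measurable (η k))
    (hindep : iIndepFun η μ)
    (hident : ∀ k, IdentDistrib (η k) (η 0) μ μ)
    (hne : ¬ ∀ᵐ ω ∂μ, η 0 ω = 0) :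
    (∀ᵐ ω ∂μ, Tendsto
      (fun n : ℕ => (RandomPolynomial.realRootCount (fun k => η k ω) n : ℝ) / (n : ℝ))
      atTop (𝓝 0)) ∧
    (∀ n : ℕ, Integrable
      (fun ω => (RandomPolynomial.realRootCount (fun k => η k ω) n : ℝ)) μ) ∧
    (fun n : ℕ => ∫ ω, (RandomPolynomial.realRootCount (fun k => η k ω) n : ℝ) ∂μ)
      =o[atTop] (fun n : ℕ => (n : ℝ)) := by
  have hlim := RandomPolynomial.ae_tendsto_realRootCount hmeas hindep hident hne
  have hint := RandomPolynomial.integrable_realRootCount (μ := μ) hmeas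
  refine ⟨hlim, hint, ?_⟩
  -- The quotient is bounded by `1` because there are at most `n` roots; at `n = 0` it is `0 / 0 =
  -- 0`.
  have hdom := tendsto_integral_of_dominated_convergence (μ := μ) (fun _ => (1 : ℝ))
    (fun n => ((hint n).div_const (n : ℝ)).aestronglyMeasurable) (integrable_const 1)
    (fun n => Eventually.of_forall fun ω => by
      rw [Real.norm_of_nonneg (by positivity)]
      exact div_le_one_of_le₀ (Nat.cast_le.2 (RandomPolynomial.realRootCount_le_self _ n))
        (Nat.cast_nonneg n)) hlim
  simp only [integral_div, integral_zero] at hdom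
  refine (isLittleO_iff_tendsto' ?_).2 hdom
  filter_upwards [eventually_gt_atTop 0] with n hn h
  exact absurd (Nat.cast_eq_zero.1 h) hn.ne'
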